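/- Notation. For a probability distribution $\mathcal D$ on $\mathbb R^d$ with mean $\mu$ and $k>2$, let $\sigma_k(\mathcal D)=\sup_{\|v\|_2=1}\mathbb E_{X\sim\mathcal D}[|\langle X-\mu,v\rangle|^k]^{1/k}$. A dataset consists of $n$ people, each holding $m$ samples in $\mathbb R^d$. A randomized algorithm $A$ is person-level $(\varepsilon,\delta)$-DP if $\Pr[A(X)\in S]\le e^{\varepsilon}\Pr[A(X')\in S]+\delta$ for all measurable $S$ and all datasets $X,X'$ that differ in the samples of at most one person. For $\rho>0$ and $u\in\mathbb R^d$, $\mathrm{clip}_{\rho,u}$ denotes the clipping map to the $\ell_2$ ball of radius $\rho$ centered at $u$: $\mathrm{clip}_{\rho,u}(x)=x$ if $\|x-u\|_2\le\rho$, and $\mathrm{clip}_{\rho,u}(x)=u+\rho\,\frac{x-u}{\|x-u\|_2}$ otherwise. Theorem (Single-Round Clip and Noise). There is a universal constant $a$ such that for every real $k>2$ there are a constant $C_k>0$, a natural number $b_k$ and one program $P$ with the following properties. The program is a real-RAM program with unit-cost arithmetic, comparisons, square roots, exponentials, logarithms and draws of independent standard Gaussians, and without rounding operations; it takes as input $n,m,d,\varepsilon,\delta,\alpha,R,k$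 and the dataset. Let $n,m,d\ge 1$, $\varepsilon,\delta,\alpha>0$ and $R\ge 0$, and put $$n_0=C_k\,\log^{b_k}(2+md)\left(\frac{d}{\alpha^2m}+\frac{d\log^{1/2}(1/\delta)}{\alpha m^{1/2}\varepsilon}+\frac{d^{1+1/(2k-2)}\log^{1/2}(1/\delta)}{\alpha^{k/(k-1)}m\varepsilon}+\frac{d^{1/2}\log^{3/2}(1/\delta)}{\varepsilon}\right).$$ 1. (Efficiency) On every dataset and for all outcomes of the random draws, $P$ halts within $C_k\,(n+m+d+\log(2+R))^{a}$ steps. 2. (Privacy) $P$ is person-level $(\varepsilon,\delta)$-DP. 3. (Accuracy) If $\varepsilon,\delta\le 1$ and $n\ge n_0$, then for every distribution $\mathcal D$ on $\mathbb R^d$ with mean $\mu\in[-R,R]^d$ and $\sigma_k(\mathcal D)\le 1$, given $m$ i.i.d. samples from $\mathcal D$ for each of the $n$ people, $P$ outputs $\hat\mu$ with $\|\hat\mu-\mu\|_2\le\alpha$ with probability at least $2/3$. 4. (Method) If $\delta\le 1/2$, then $P$ is a coarse estimate followed by a single clip-and-noise round. That is, there are a person-level $(\varepsilon/2,\delta/2)$-DP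 estimator $X\mapsto u$, a nonempty set $B$ of people, and numbers $\rho,\sigma>0$, such that the output of $P$ on $X$ is distributed as $$\frac1{|B|}\sum_{i\in B}\mathrm{clip}_{\rho,u}\Big(\frac1m\sum_{j=1}^mX^{(i)}_j\Big)+\mathcal N(0,\sigma^2I_d),$$ where for every fixed $u$ this last step is person-level $(\varepsilon/2,\delta/2)$-DP. Moreover, if also $\varepsilon\le 1$ and $n\ge n_0$, then for every $\mathcal D$ as in part 3 the estimate $u$ satisfies $\|u-\mu\|_2\le C_k\sqrt{d/m}$ with probability at least $2/3$. -/

import Mathlib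

open MeasureTheory ProbabilityTheory
open scoped ENNReal NNReal

/-! ### Distributions, datasets and person-level privacy -/

/-- Euclidean space `ℝ^d` with the `ℓ₂` norm. -/
abbrev Vec (d : ℕ) : Type := EuclideanSpace ℝ (Fin d)

/-- A dataset of `n` people with `m` samples in `ℝ^d` each: `X i j` is sample `j` of person `i`. -/
abbrev Dataset (n m d : ℕ) : Type := Fin n → Fin m → Vec d

/-- The `k`-th moment `σ_k(D) = sup_{‖v‖ = 1} E[|⟨X - μ, v⟩|^k]^{1/k}`, where `μ` is the mean of `D`,
as an extended nonnegative real. -/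
noncomputable def kthMoment {d : ℕ} (k : ℝ) (D : Measure (Vec d)) : ℝ≥0∞ :=
  ⨆ v ∈ Metric.sphere (0 : Vec d) 1,
    eLpNorm (fun x => inner ℝ (x - ∫ y, y ∂D) v) (ENNReal.ofReal k) D

/-- The law of a dataset all of whose `n * m` samples are drawn independently from `D`. -/
noncomputable def dataLaw (n m : ℕ) {d : ℕ} (D : Measure (Vec d)) : Measure (Dataset n m d) :=
  Measure.pi fun _ => Measure.pi fun _ => D

/-- Person-level `(ε, δ)`-differential privacy of a randomized algorithm, given by the law `M X` of
its output on the dataset `X`: two datasets are neighbors if at most one person's samples differ. -/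
def PersonLevelDP {n m d : ℕ} (M : Dataset n m d → Measure (Vec d)) (ε δ : ℝ) : Prop :=
  ∀ X X' : Dataset n m d, {i | X i ≠ X' i}.ncard ≤ 1 → ∀ S : Set (Vec d), MeasurableSet S →
    M X S ≤ ENNReal.ofReal (Real.exp ε) * M X' S + ENNReal.ofReal δ

/-- For every distribution with mean in `[-R, R]^d` and `k`-th moment at most `1`, the output of `M`
on i.i.d. samples is within `ℓ₂` distance `α` of the mean with probability at least `2/3`
(over the data and the randomness of the algorithm). -/
def EstimatesMean {n m d : ℕ} (M : Kernel (Dataset n m d) (Vec d)) (k R α : ℝ) : Prop :=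
  ∀ D : Measure (Vec d), IsProbabilityMeasure D → Integrable (fun x => x) D →
    (∀ c : Fin d, |(∫ x, x ∂D) c| ≤ R) → kthMoment k D ≤ 1 →
    2 / 3 ≤ (dataLaw n m D).bind M {y | ‖y - ∫ x, x ∂D‖ ≤ α}

/-! ### The clip-and-noise method -/

/-- Clipping to the ball of radius `ρ` centered at `u`. -/
noncomputable def clip {d : ℕ} (ρ : ℝ) (u x : Vec d) : Vec d :=
  if ‖x - u‖ ≤ ρ then x else u + (ρ / ‖x - u‖) • (x - u)

/-- The average over the people in `B` of their sample means, each clipped to the ball of radius `ρ`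
centered at `u`. -/
noncomputable def clippedMean {n m d : ℕ} (B : Finset (Fin n)) (ρ : ℝ) (u : Vec d)
    (X : Dataset n m d) : Vec d :=
  (B.card : ℝ)⁻¹ • ∑ i ∈ B, clip ρ u ((m : ℝ)⁻¹ • ∑ j, X i j)

/-- The law of the clipped mean plus Gaussian noise `N(0, σ² I)`. -/
noncomputable def clipAndNoise {n m d : ℕ} (B : Finset (Fin n)) (ρ σ : ℝ) (u : Vec d)
    (X : Dataset n m d) : Measure (Vec d) :=
  (stdGaussian (Vec d)).map fun g => clippedMean B ρ u X + σ • g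

/-- `M` is a single-round clip-and-noise algorithm with coarse estimator `coarse`: it computes a
coarse estimate `u`, and then runs one clip-and-noise step around `u` (on a nonempty set of people,
with a fixed radius and a fixed noise level); both steps are person-level `(ε/2, δ/2)`-DP. -/
def IsSingleRoundClipAndNoise {n m d : ℕ} (M coarse : Kernel (Dataset n m d) (Vec d))
    (ε δ : ℝ) : Prop :=
  PersonLevelDP coarse (ε / 2) (δ / 2) ∧
  ∃ (B : Finset (Fin n)) (ρ σ : ℝ), B.Nonempty ∧ 0 < ρ ∧ 0 < σ ∧
    (∀ u : Vec d, PersonLevelDP (clipAndNoise (m := m) B ρ σ u) (ε / 2) (δ / 2)) ∧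
    ∀ X, M X = (coarse X).bind fun u => clipAndNoise B ρ σ u X

/-- The expression inside the `Õ_k` of the sample complexity. -/
noncomputable def sampleBound (k : ℝ) (m d : ℕ) (ε δ α : ℝ) : ℝ :=
  d / (α ^ 2 * m)
    + d * Real.log (1 / δ) ^ (1 / 2 : ℝ) / (α * (m : ℝ) ^ (1 / 2 : ℝ) * ε)
    + (d : ℝ) ^ (1 + 1 / (2 * k - 2)) * Real.log (1 / δ) ^ (1 / 2 : ℝ)
        / (α ^ (k / (k - 1)) * m * ε)
    + (d : ℝ) ^ (1 / 2 : ℝ) * Real.log (1 / δ) ^ (3 / 2 : ℝ) / ε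

/-! ### A real RAM with Gaussian randomness

A finite program over natural-number registers (for counters and addresses) and arrays of real
cells. Each arithmetic operation, comparison, memory access, square root, exponential, logarithm
and draw of a standard Gaussian costs one step; there is no rounding operation. Program constants
are natural numbers. -/

namespace RealRAM

/-- A machine state: natural-number registers, arrays of real cells (`real a i` is cell `i` of
array `a`), and the number of random draws made so far. -/
structure State where
  nat : ℕ → ℕ
  real : ℕ → ℕ → ℝ
  pos : ℕ

/-- Write `v` into cell `i` of array `a`. -/
noncomputable def State.write (s : State) (a i : ℕ) (v : ℝ) : State :=
  { s with real := Function.update s.real a (Function.update (s.real a) i v) }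

/-- Natural-number expressions; `sub` is truncated subtraction. -/
inductive NatExpr where
  | const (c : ℕ)
  | reg (x : ℕ)
  | add (e f : NatExpr)
  | sub (e f : NatExpr)
  | mul (e f : NatExpr)

namespace NatExpr

def eval (s : State) : NatExpr → ℕ
  | const c => c
  | reg x => s.nat x
  | add e f => e.eval s + f.eval s
  | sub e f => e.eval s - f.eval s
  | mul e f => e.eval s * f.eval s

/-- The number of elementary steps of the evaluation. -/
def cost : NatExpr → ℕ
  | const _ => 1
  | reg _ => 1
  | add e f => e.cost + f.cost + 1
  | sub e f => e.cost + f.cost + 1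
  | mul e f => e.cost + f.cost + 1

end NatExpr

/-- Real expressions; `cell a i` is cell `i` of array `a`, `ofNat` converts a natural number, and
partial operations are total by the usual conventions (`x / 0 = 0`, and so on). -/
inductive RealExpr where
  | ofNat (e : NatExpr)
  | cell (a : ℕ) (i : NatExpr)
  | add (e f : RealExpr)
  | sub (e f : RealExpr)
  | mul (e f : RealExpr)
  | div (e f : RealExpr)
  | sqrt (e : RealExpr)
  | exp (e : RealExpr)
  | log (e : RealExpr)

namespace RealExpr

noncomputable def eval (s : State) : RealExpr → ℝ
  | ofNat e => (e.eval s : ℝ)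
  | cell a i => s.real a (i.eval s)
  | add e f => e.eval s + f.eval s
  | sub e f => e.eval s - f.eval s
  | mul e f => e.eval s * f.eval s
  | div e f => e.eval s / f.eval s
  | sqrt e => Real.sqrt (e.eval s)
  | exp e => Real.exp (e.eval s)
  | log e => Real.log (e.eval s)

/-- The number of elementary steps of the evaluation. -/
def cost : RealExpr → ℕ
  | ofNat e => e.cost + 1
  | cell _ i => i.cost + 1
  | add e f => e.cost + f.cost + 1
  | sub e f => e.cost + f.cost + 1
  | mul e f => e.cost + f.cost + 1
  | div e f => e.cost + f.cost + 1
  | sqrt e => e.cost + 1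
  | exp e => e.cost + 1
  | log e => e.cost + 1

end RealExpr

/-- Comparisons. -/
inductive Test where
  | natLT (e f : NatExpr)
  | realLT (e f : RealExpr)

namespace Test

def Holds (s : State) : Test → Prop
  | natLT e f => e.eval s < f.eval s
  | realLT e f => e.eval s < f.eval s

/-- The number of elementary steps of the comparison. -/
def cost : Test → ℕ
  | natLT e f => e.cost + f.cost + 1
  | realLT e f => e.cost + f.cost + 1

end Test

/-- Programs. -/
inductive Program where
  | skip
  | setNat (x : ℕ) (e : NatExpr)
  | setReal (a : ℕ) (i : NatExpr) (e : RealExpr)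
  | gaussian (a : ℕ) (i : NatExpr)
  | seq (p q : Program)
  | branch (b : Test) (p q : Program)
  | loop (b : Test) (p : Program)

/-- `Exec ω p s s' t`: with the sequence of random draws `ω`, program `p` started in state `s` halts
in state `s'` after `t` steps. Here `loop b p` repeats `p` while `b` holds. -/
inductive Exec (ω : ℕ → ℝ) : Program → State → State → ℕ → Prop where
  | skip (s : State) : Exec ω .skip s s 1
  | setNat (s : State) (x : ℕ) (e : NatExpr) :
      Exec ω (.setNat x e) s { s with nat := Function.update s.nat x (e.eval s) } (e.cost + 1)
  | setReal (s : State) (a : ℕ) (i : NatExpr) (e : RealExpr) :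
      Exec ω (.setReal a i e) s
        (s.write a (i.eval s) (e.eval s))
        (i.cost + e.cost + 1)
  | gaussian (s : State) (a : ℕ) (i : NatExpr) :
      Exec ω (.gaussian a i) s
        { s.write a (i.eval s) (ω s.pos) with pos := s.pos + 1 }
        (i.cost + 1)
  | seq {p q : Program} {s s' s'' : State} {t t' : ℕ} :
      Exec ω p s s' t → Exec ω q s' s'' t' → Exec ω (.seq p q) s s'' (t + t')
  | branch_true {b : Test} {p q : Program} {s s' : State} {t : ℕ} :
      b.Holds s → Exec ω p s s' t → Exec ω (.branch b p q) s s' (b.cost + t)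
  | branch_false {b : Test} {p q : Program} {s s' : State} {t : ℕ} :
      ¬ b.Holds s → Exec ω q s s' t → Exec ω (.branch b p q) s s' (b.cost + t)
  | loop_done {b : Test} {p : Program} {s : State} :
      ¬ b.Holds s → Exec ω (.loop b p) s s b.cost
  | loop_step {b : Test} {p : Program} {s s' s'' : State} {t t' : ℕ} :
      b.Holds s → Exec ω p s s' t → Exec ω (.loop b p) s' s'' t' →
      Exec ω (.loop b p) s s'' (b.cost + t + t')

/-- The law of the random draws: independent standard Gaussians. -/
noncomputable def drawLaw : Measure (ℕ → ℝ) := Measure.infinitePi fun _ => gaussianReal 0 1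

/-- The input state: registers `0, 1, 2` hold `n, m, d`, array `0` holds the real parameters
`ε, δ, α, R, k`, and cell `(i * m + j) * d + c` of array `1` holds coordinate `c` of sample `j` of
person `i`; everything else is zero. -/
noncomputable def input {n m d : ℕ} (ε δ α R k : ℝ) (X : Dataset n m d) : State where
  nat x := if x = 0 then n else if x = 1 then m else if x = 2 then d else 0
  real a p :=
    if a = 0 then
      if p = 0 then ε else if p = 1 then δ else if p = 2 then α else if p = 3 then R
      else if p = 4 then k else 0
    else if a = 1 then
      if h : p < n * m * d then
        let q := finProdFinEquiv.symm (⟨p, h⟩ : Fin (n * m * d))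
        let r := finProdFinEquiv.symm q.1
        X r.1 r.2 q.2
      else 0
    else 0
  pos := 0

/-- With the given parameters, the program `P` halts within `T` steps on every dataset and for all
outcomes of the random draws, and the law of its output (cells `0, …, d - 1` of array `2`) on the
dataset `X` is `M X`. -/
def Computes (P : Program) {n m d : ℕ} (ε δ α R k T : ℝ) (M : Kernel (Dataset n m d) (Vec d)) :
    Prop :=
  ∃ F : Dataset n m d → (ℕ → ℝ) → Vec d,
    (∀ X ω, ∃ (s : State) (t : ℕ), Exec ω P (input ε δ α R k X) s t ∧ (t : ℝ) ≤ T ∧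
      ∀ c : Fin d, s.real 2 c = F X ω c) ∧
    ∀ X, M X = drawLaw.map (F X)

end RealRAM

/-! The people are split into two halves. The first half produces a coarse center `u`, typically
within `O(√(d/m))` of the mean `μ`. The sample means of the second half are clipped to a ball of
radius `ρ` around `u`, averaged, and perturbed by Gaussian noise. A person belongs to one half only,
so a change of their samples reaches only one of the two stages. Hence the whole mechanism has the
privacy of a single stage (`personLevelDP_twoStageKernel`), and `u` is independent of the data that
are averaged (`lintegral_pi_piecewise`).

Clipping bias. The bias is at most the expected excess of `‖sampleMean - μ‖` over `ρ / 2`. By the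
Fuk–Nagaev type bound `lintegral_norm_sum_sub_le`, beyond the range `√(d/m) log(2 + md)` this excess
is `O_k(d^(k/2) / (mρ)^(k-1))`. To prove that bound, the summands are truncated. The exponential
moment of the truncated sum is obtained by iterating a one-step inequality for `cosh ‖·‖`, which has
no dimension factor, and the discarded parts are paid for with the `k`-th moment. Making the bias at
most `α / 3` leads to `ρ ≈ √(d/m) log(2 + md) + d^(k/(2(k-1))) / (m α^(1/(k-1)))`. The requirement
that the noise, of norm about `ρ √(d log(1/δ)) / (nε)`, stay below `α` then gives exactly the second
and third terms of `sampleBound`. Clipping to a ball that contains `μ` does not increase distances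
to `μ`, so the variance stays below `d / (nm)`, which gives the first term.

Coarse stage. A sample mean receives a positive weight when more than half of the sample means are
within `2r` of it, where `r` is of order `√(d/m)`. Two strict majorities intersect, so all points of
positive weight are within `4r` of each other. Changing one of the `h` people moves the total weight
by at most `3h`. When the total weight is of order `h²`, the weighted average moves by `O(r / h)`
(`norm_stableCenter_sub_stableCenter_le`). The average is therefore released with Gaussian noise,
after a noisy test that the total weight is large; this stage needs only the last term of
`sampleBound`.

Large `δ`. As `δ` tends to `1`, `log (1/δ)` vanishes and the bound on `n` no longer pays for the
noise. From `δ ≥ 3/4` on, the empirical mean itself is released with probability `3/4`: this is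
private because `3/4 ≤ δ`, and it fails with probability at most `1/4 + 1/12`.

The program is verified with a small program logic: `Runs` bounds the time and describes the final
state, and `Agree` records what is left untouched. -/

/-! ### Tail bounds for sums of independent vectors -/

section TailBound

/-- Iterated one-step bounds: if adding one independent summand changes the expectation of `f` at
most affinely, the expectation of `f` at the sum is bounded by the iterated affine map. -/
theorem lintegral_comp_sum_le {E : Type*} [NormedAddCommGroup E] [MeasurableSpace E] [BorelSpace E] [SecondCountableTopology E]
    {Ω ι : Type*} [MeasurableSpace Ω] {P : Measure Ω} [IsProbabilityMeasure P]
    {X : ι → Ω → E} (hX : ∀ i, Measurable (X i)) (hind : iIndepFun X P)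
    {f : E → ℝ≥0∞} (hf : Measurable f) {a b : ℝ≥0∞}
    (h : ∀ i y, ∫⁻ ω, f (y + X i ω) ∂P ≤ a * f y + b) (s : Finset ι) :
    ∫⁻ ω, f (∑ i ∈ s, X i ω) ∂P ≤ a ^ s.card * f 0 + b * ∑ j ∈ Finset.range s.card, a ^ j := by
  classical
  induction s using Finset.induction_on with
  | empty => simp
  | insert i s hi ih =>
    have hS : Measurable fun ω => ∑ j ∈ s, X j ω := by fun_prop
    have hI : IndepFun (fun ω => ∑ j ∈ s, X j ω) (X i) P := by
      have := hind.indepFun_finsetSum_of_notMem hX hi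
      convert this using 1
      ext ω; simp
    -- Independence turns the expectation into an iterated one, where the inner integral sees the
    -- partial sum as a fixed `y` and `h` applies.
    have key : ∫⁻ ω, f (∑ j ∈ insert i s, X j ω) ∂P =
        ∫⁻ y, ∫⁻ x, f (y + x) ∂(P.map (X i)) ∂(P.map fun ω => ∑ j ∈ s, X j ω) := by
      have hm := (indepFun_iff_map_prod_eq_prod_map_map hS.aemeasurable (hX i).aemeasurable).1 hI
      have : Measurable fun p : E × E => f (p.1 + p.2) := by fun_prop
      have hP := Measure.isProbabilityMeasure_map (μ := P) (hX i).aemeasurable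
      rw [← lintegral_prod (fun p : E × E => f (p.1 + p.2)) this.aemeasurable, ← hm,
        lintegral_map this (hS.prodMk (hX i))]
      refine lintegral_congr fun ω => ?_
      rw [Finset.sum_insert hi, add_comm]
    rw [key, lintegral_map (by
      have := Measure.isProbabilityMeasure_map (μ := P) (hX i).aemeasurable
      have hm : Measurable fun p : E × E => f (p.1 + p.2) := by fun_prop
      exact hm.lintegral_prod_right') hS]
    calc ∫⁻ ω, ∫⁻ x, f (∑ j ∈ s, X j ω + x) ∂(P.map (X i)) ∂P
        ≤ ∫⁻ ω, (a * f (∑ j ∈ s, X j ω) + b) ∂P := by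
          refine lintegral_mono fun ω => ?_
          rw [lintegral_map (by fun_prop) (hX i)]
          exact h i _
      _ = a * ∫⁻ ω, f (∑ j ∈ s, X j ω) ∂P + b := by
          rw [lintegral_add_right _ measurable_const, lintegral_const_mul _ (by fun_prop)]
          simp
      _ ≤ a * (a ^ s.card * f 0 + b * ∑ j ∈ Finset.range s.card, a ^ j) + b := by gcongr
      _ = _ := by
          rw [Finset.card_insert_of_notMem hi, Finset.sum_range_succ', pow_succ]
          simp_rw [pow_succ]
          rw [← Finset.sum_mul]
          ring

variable {E : Type*} [NormedAddCommGroup E] [InnerProductSpace ℝ E]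

/-- `‖y + z‖²` is a convex combination of `(‖y‖ + ‖z‖)²` and `(‖y‖ - ‖z‖)²`, with weight fixed by
the cosine of the angle. As a function of the square of its argument, `cosh` is convex, because its
power series has nonnegative coefficients; the addition formulas give the rest. -/
theorem cosh_norm_add_le_of_pos {y z : E} (hy : 0 < ‖y‖) (hz : 0 < ‖z‖) :
    Real.cosh ‖y + z‖ ≤ Real.cosh ‖y‖ * Real.cosh ‖z‖ +
      (inner ℝ y z / (‖y‖ * ‖z‖)) * (Real.sinh ‖y‖ * Real.sinh ‖z‖) := by
  set a := ‖y‖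
  set b := ‖z‖
  set c := (inner ℝ y z : ℝ)
  have hab : 0 < a * b := by positivity
  have hc : |c| ≤ a * b := abs_real_inner_le_norm y z
  set θ := (1 + c / (a * b)) / 2 with hθ
  have hc1 : -1 ≤ c / (a * b) := by
    rw [le_div_iff₀ hab]; linarith [(abs_le.1 hc).1]
  have hc2 : c / (a * b) ≤ 1 := by
    rw [div_le_iff₀ hab]; linarith [(abs_le.1 hc).2]
  have hθ0 : 0 ≤ θ := by rw [hθ]; linarith
  have hθ1 : 0 ≤ 1 - θ := by rw [hθ]; linarith
  have hsq : ‖y + z‖ ^ 2 = θ * (a + b) ^ 2 + (1 - θ) * (a - b) ^ 2 := by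
    rw [norm_add_sq_real]
    have : c = (2 * θ - 1) * (a * b) := by rw [hθ]; field_simp; ring
    change a ^ 2 + 2 * c + b ^ 2 = _
    rw [this]; ring
  have hle : Real.cosh ‖y + z‖ ≤ θ * Real.cosh (a + b) + (1 - θ) * Real.cosh (a - b) := by
    refine hasSum_le (fun n => ?_) (Real.hasSum_cosh _)
      (((Real.hasSum_cosh (a + b)).mul_left θ).add ((Real.hasSum_cosh (a - b)).mul_left (1 - θ)))
    have := (convexOn_pow (𝕜 := ℝ) n).2 (x := (a + b) ^ 2) (y := (a - b) ^ 2)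
      (Set.mem_Ici.2 (sq_nonneg _)) (Set.mem_Ici.2 (sq_nonneg _)) hθ0 hθ1 (by ring)
    simp only [smul_eq_mul] at this
    rw [pow_mul, hsq, pow_mul, pow_mul, mul_div_assoc', mul_div_assoc', ← add_div]
    gcongr
  refine hle.trans (le_of_eq ?_)
  rw [Real.cosh_add, Real.cosh_sub, hθ]
  ring

/-- This isolates a part linear in `z`, whose expectation is that of a fixed functional at the mean
of `z`. The remaining factor `exp ‖z‖ - ‖z‖` has no first-order term. It arises by replacing `sinh
‖z‖` with `‖z‖` in the angular term and bounding the cosine by `1` in what is left over. -/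
theorem cosh_norm_add_le (y z : E) :
    Real.cosh ‖y + z‖ ≤ Real.cosh ‖y‖ * (Real.exp ‖z‖ - ‖z‖) +
      inner ℝ ((Real.sinh ‖y‖ / ‖y‖) • y) z := by
  have hs : ‖z‖ ≤ Real.sinh ‖z‖ := Real.self_le_sinh_iff.2 (norm_nonneg z)
  have he : Real.exp ‖z‖ = Real.cosh ‖z‖ + Real.sinh ‖z‖ := (Real.cosh_add_sinh _).symm
  rcases (norm_nonneg y).eq_or_lt with hy | hy
  · have : y = 0 := norm_eq_zero.1 hy.symm
    subst this
    simp only [zero_add, norm_zero, Real.cosh_zero, smul_zero, inner_zero_left]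
    rw [he]; linarith
  rcases (norm_nonneg z).eq_or_lt with hz | hz
  · have : z = 0 := norm_eq_zero.1 hz.symm
    subst this
    simp
  refine (cosh_norm_add_le_of_pos hy hz).trans ?_
  have hc : inner ℝ y z ≤ ‖y‖ * ‖z‖ := real_inner_le_norm y z
  rw [real_inner_smul_left, he]
  have h1 : inner ℝ y z / (‖y‖ * ‖z‖) * (Real.sinh ‖y‖ * Real.sinh ‖z‖) =
      Real.sinh ‖y‖ / ‖y‖ * inner ℝ y z +
      (inner ℝ y z / (‖y‖ * ‖z‖)) * (Real.sinh ‖y‖ * (Real.sinh ‖z‖ - ‖z‖)) := by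
    field_simp; ring
  have h2 : inner ℝ y z / (‖y‖ * ‖z‖) ≤ 1 := by
    rw [div_le_iff₀ (by positivity)]; linarith
  have h3 : 0 ≤ Real.sinh ‖y‖ := Real.sinh_nonneg_iff.2 hy.le
  have h4 : Real.sinh ‖y‖ ≤ Real.cosh ‖y‖ := (Real.sinh_lt_cosh _).le
  have h5 : (inner ℝ y z / (‖y‖ * ‖z‖)) * (Real.sinh ‖y‖ * (Real.sinh ‖z‖ - ‖z‖)) ≤
      Real.cosh ‖y‖ * (Real.sinh ‖z‖ - ‖z‖) :=
    calc _ ≤ 1 * (Real.sinh ‖y‖ * (Real.sinh ‖z‖ - ‖z‖)) := by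
          gcongr
      _ ≤ _ := by rw [one_mul]; gcongr
  rw [h1]; linarith

theorem norm_sinh_smul_le (y : E) : ‖(Real.sinh ‖y‖ / ‖y‖) • y‖ ≤ Real.cosh ‖y‖ := by
  rcases (norm_nonneg y).eq_or_lt with hy | hy
  · simp [← hy]
  · rw [norm_smul, norm_div, norm_norm, div_mul_cancel₀ _ hy.ne', Real.norm_eq_abs,
      abs_of_nonneg (Real.sinh_nonneg_iff.2 hy.le)]
    exact (Real.sinh_lt_cosh _).le

/-- Up to `1` a second-order Taylor bound suffices; beyond `1` the factor `u ^ k ≥ 1` absorbs the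
exponential. Only second and `k`-th moments are then needed. -/
theorem exp_sub_self_le {k q u : ℝ} (hk : 2 ≤ k) (hu : 0 ≤ u) (huq : u ≤ q) :
    Real.exp u - u ≤ 1 + u ^ 2 + Real.exp q * u ^ k := by
  rcases le_or_gt u 1 with h | h
  · have := Real.abs_exp_sub_one_sub_id_le (x := u) (by rwa [abs_of_nonneg hu])
    have h2 := (abs_le.1 this).2
    have : 0 ≤ Real.exp q * u ^ k := by positivity
    linarith
  · have h1 : 1 ≤ u ^ k := Real.one_le_rpow h.le (by linarith)
    have h2 : Real.exp u ≤ Real.exp q * u ^ k :=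
      calc Real.exp u ≤ Real.exp q * 1 := by rw [mul_one]; exact Real.exp_le_exp.2 huq
        _ ≤ _ := by gcongr
    nlinarith

/-- One step of the exponential-moment recursion. -/
theorem lintegral_cosh_norm_add_le [CompleteSpace E] [MeasurableSpace E] [BorelSpace E]
    [SecondCountableTopology E] {Ω : Type*} [MeasurableSpace Ω] {P : Measure Ω}
    [IsProbabilityMeasure P] {φ : Ω → E} (hφ : Measurable φ) {b : ℝ} (hb : ∀ ω, ‖φ ω‖ ≤ b)
    (y : E) :
    ∫⁻ ω, ENNReal.ofReal (Real.cosh ‖y + φ ω‖) ∂P ≤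
      ENNReal.ofReal (∫ ω, (Real.exp ‖φ ω‖ - ‖φ ω‖) ∂P + ‖∫ ω, φ ω ∂P‖) *
        ENNReal.ofReal (Real.cosh ‖y‖) := by
  have hi1 : Integrable φ P := Integrable.of_bound hφ.aestronglyMeasurable b (.of_forall hb)
  have hi2 : Integrable (fun ω => Real.exp ‖φ ω‖ - ‖φ ω‖) P := by
    refine Integrable.sub (Integrable.of_bound (C := Real.exp b) (by fun_prop) (.of_forall ?_))
      hi1.norm
    intro ω
    rw [Real.norm_eq_abs, Real.abs_exp]
    exact Real.exp_le_exp.2 (hb ω)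
  have hi3 : Integrable (fun ω => Real.cosh ‖y‖ * (Real.exp ‖φ ω‖ - ‖φ ω‖) +
      inner ℝ ((Real.sinh ‖y‖ / ‖y‖) • y) (φ ω)) P :=
    (hi2.const_mul _).add (hi1.const_inner _)
  have h0 : ∀ ω, 0 ≤ Real.cosh ‖y‖ * (Real.exp ‖φ ω‖ - ‖φ ω‖) +
      inner ℝ ((Real.sinh ‖y‖ / ‖y‖) • y) (φ ω) := fun ω =>
    (Real.cosh_pos _).le.trans (cosh_norm_add_le y (φ ω))
  calc ∫⁻ ω, ENNReal.ofReal (Real.cosh ‖y + φ ω‖) ∂P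
      ≤ ∫⁻ ω, ENNReal.ofReal (Real.cosh ‖y‖ * (Real.exp ‖φ ω‖ - ‖φ ω‖) +
          inner ℝ ((Real.sinh ‖y‖ / ‖y‖) • y) (φ ω)) ∂P :=
        lintegral_mono fun ω => ENNReal.ofReal_le_ofReal (cosh_norm_add_le y (φ ω))
    _ = ENNReal.ofReal (Real.cosh ‖y‖ * ∫ ω, (Real.exp ‖φ ω‖ - ‖φ ω‖) ∂P +
          inner ℝ ((Real.sinh ‖y‖ / ‖y‖) • y) (∫ ω, φ ω ∂P)) := by
        rw [← ofReal_integral_eq_lintegral_ofReal hi3 (.of_forall h0),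
          integral_add (hi2.const_mul _) (hi1.const_inner _), integral_const_mul,
          integral_inner hi1]
    _ ≤ _ := by
        rw [← ENNReal.ofReal_mul' (Real.cosh_pos _).le]
        refine ENNReal.ofReal_le_ofReal ?_
        have : inner ℝ ((Real.sinh ‖y‖ / ‖y‖) • y) (∫ ω, φ ω ∂P) ≤
            Real.cosh ‖y‖ * ‖∫ ω, φ ω ∂P‖ :=
          (real_inner_le_norm _ _).trans (by gcongr; exact norm_sinh_smul_le y)
        linarith

end TailBound

section TailBound

variable {E : Type*} [NormedAddCommGroup E]

/-- Truncation of `x` to `0` when its norm exceeds `τ`. -/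
noncomputable def truncNorm (τ : ℝ) (x : E) : E :=
  if ‖x‖ ≤ τ then x else 0

theorem norm_truncNorm_le_self (τ : ℝ) (x : E) : ‖truncNorm τ x‖ ≤ ‖x‖ := by
  unfold truncNorm; split_ifs <;> simp

theorem norm_truncNorm_le {τ : ℝ} (hτ : 0 ≤ τ) (x : E) : ‖truncNorm τ x‖ ≤ τ := by
  unfold truncNorm; split_ifs with h
  · exact h
  · simpa

/-- The truncation error is controlled by any moment of order `1 + p`. -/
theorem norm_sub_truncNorm_le {τ p : ℝ} (hτ : 0 < τ) (hp : 0 ≤ p) (x : E) :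
    ‖x - truncNorm τ x‖ ≤ ‖x‖ ^ (p + 1) / τ ^ p := by
  unfold truncNorm; split_ifs with h
  · simp; positivity
  · push Not at h
    have hx : 0 < ‖x‖ := hτ.trans h
    rw [sub_zero, le_div_iff₀ (by positivity), Real.rpow_add hx, Real.rpow_one, mul_comm]
    gcongr

theorem measurable_truncNorm [MeasurableSpace E] [BorelSpace E] (τ : ℝ) :
    Measurable (truncNorm τ : E → E) :=
  Measurable.ite (measurableSet_le measurable_norm measurable_const) measurable_id
    measurable_const

/-- From `x ≤ exp x` at `x = q / (2k)`. It bounds, uniformly in `q`, the contribution of the `k`-th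
moment to the exponential moment. -/
theorem rpow_mul_exp_neg_half_le {k q : ℝ} (hk : 0 < k) (hq : 0 ≤ q) :
    q ^ k * Real.exp (-(q / 2)) ≤ (2 * k) ^ k := by
  have h1 : q ≤ 2 * k * Real.exp (q / (2 * k)) := by
    have := Real.add_one_le_exp (q / (2 * k))
    have h2 : q = 2 * k * (q / (2 * k)) := by field_simp
    calc q = 2 * k * (q / (2 * k)) := h2
      _ ≤ _ := by gcongr; linarith
  calc q ^ k * Real.exp (-(q / 2)) ≤ (2 * k * Real.exp (q / (2 * k))) ^ k * Real.exp (-(q / 2)) := by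
        gcongr
    _ = (2 * k) ^ k := by
        rw [Real.mul_rpow (by positivity) (by positivity), ← Real.exp_mul, mul_assoc, ← Real.exp_add]
        have : q / (2 * k) * k + -(q / 2) = 0 := by field_simp; ring
        rw [this]; simp

variable [InnerProductSpace ℝ E]

/-- The exponential moment of the truncated sum. -/
theorem lintegral_cosh_norm_sum_truncNorm_le [CompleteSpace E] [MeasurableSpace E] [BorelSpace E]
    [SecondCountableTopology E] {Ω ι : Type*} [MeasurableSpace Ω]
    {P : Measure Ω} [IsProbabilityMeasure P] {Z : ι → Ω → E} (hZ : ∀ i, Measurable (Z i))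
    (hind : iIndepFun Z P) (hint : ∀ i, Integrable (Z i) P) (hmean : ∀ i, ∫ ω, Z i ω ∂P = 0)
    {k : ℝ} (hk : 2 < k) (h2i : ∀ i, Integrable (fun ω => ‖Z i ω‖ ^ 2) P)
    (h2 : ∀ i, ∫ ω, ‖Z i ω‖ ^ 2 ∂P ≤ 1) (hki : ∀ i, Integrable (fun ω => ‖Z i ω‖ ^ k) P)
    (hk1 : ∀ i, ∫ ω, ‖Z i ω‖ ^ k ∂P ≤ 1) (s : Finset ι) {t q : ℝ} (ht : 0 < t) (hq : 1 ≤ q) :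
    ∫⁻ ω, ENNReal.ofReal (Real.cosh (q / t * ‖∑ i ∈ s, truncNorm (t / 2) (Z i ω)‖)) ∂P ≤
      ENNReal.ofReal (Real.exp (s.card *
        (3 * q ^ 2 / t ^ 2 + Real.exp (q / 2) * (q / t) ^ k))) := by
  set lam := q / t with hlam
  have hlam0 : 0 < lam := by positivity
  set c := 3 * q ^ 2 / t ^ 2 + Real.exp (q / 2) * (q / t) ^ k with hc
  have hc0 : 0 ≤ c := by positivity
  have hφm : ∀ i, Measurable fun ω => lam • truncNorm (t / 2) (Z i ω) := fun i =>
    ((measurable_truncNorm _).comp (hZ i)).const_smul lam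
  -- Truncation at half the level `t` costs only a factor `exp (q / 2)`, which a later factor `exp
  -- (-q)` beats.
  have hφb : ∀ i ω, ‖lam • truncNorm (t / 2) (Z i ω)‖ ≤ q / 2 := fun i ω => by
    rw [norm_smul, Real.norm_of_nonneg hlam0.le]
    calc lam * _ ≤ lam * (t / 2) := by gcongr; exact norm_truncNorm_le (by positivity) _
      _ = q / 2 := by rw [hlam]; field_simp
  have hti : ∀ i, Integrable (fun ω => truncNorm (t / 2) (Z i ω)) P := fun i =>
    (hint i).mono ((measurable_truncNorm _).comp (hZ i)).aestronglyMeasurable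
      (.of_forall fun ω => norm_truncNorm_le_self _ _)
  -- Truncation destroys centering. The new mean is minus the mean of the discarded part, which the
  -- second moment controls.
  have hmean' : ∀ i, ‖∫ ω, lam • truncNorm (t / 2) (Z i ω) ∂P‖ ≤ 2 * q / t ^ 2 := fun i => by
    have h1 : ∫ ω, truncNorm (t / 2) (Z i ω) ∂P =
        -∫ ω, (Z i ω - truncNorm (t / 2) (Z i ω)) ∂P := by
      rw [integral_sub (hint i) (hti i), hmean i]; simp
    rw [integral_smul, norm_smul, h1, norm_neg, Real.norm_of_nonneg hlam0.le]
    have h3 : ‖∫ ω, (Z i ω - truncNorm (t / 2) (Z i ω)) ∂P‖ ≤ 2 / t := by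
      calc _ ≤ ∫ ω, ‖Z i ω - truncNorm (t / 2) (Z i ω)‖ ∂P := norm_integral_le_integral_norm _
        _ ≤ ∫ ω, ‖Z i ω‖ ^ 2 * (2 / t) ∂P := by
          refine integral_mono ((hint i).sub (hti i)).norm ((h2i i).mul_const _) fun ω => ?_
          have := norm_sub_truncNorm_le (τ := t / 2) (p := 1) (by positivity) zero_le_one (Z i ω)
          rw [show (1 : ℝ) + 1 = 2 by norm_num, Real.rpow_one, Real.rpow_two] at this
          refine this.trans (le_of_eq ?_)
          field_simp
        _ = (∫ ω, ‖Z i ω‖ ^ 2 ∂P) * (2 / t) := integral_mul_const _ _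
        _ ≤ 1 * (2 / t) := by gcongr; exact h2 i
        _ = 2 / t := one_mul _
    calc lam * _ ≤ lam * (2 / t) := by gcongr
      _ = 2 * q / t ^ 2 := by rw [hlam]; field_simp
  have hexp : ∀ i, ∫ ω, (Real.exp ‖lam • truncNorm (t / 2) (Z i ω)‖ -
      ‖lam • truncNorm (t / 2) (Z i ω)‖) ∂P ≤ 1 + (lam ^ 2 + Real.exp (q / 2) * lam ^ k) := by
    intro i
    have hi' : Integrable (fun ω => lam ^ 2 * ‖Z i ω‖ ^ 2 +
        Real.exp (q / 2) * lam ^ k * ‖Z i ω‖ ^ k) P :=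
      ((h2i i).const_mul _).add ((hki i).const_mul _)
    have hi : Integrable (fun ω => 1 + (lam ^ 2 * ‖Z i ω‖ ^ 2 +
        Real.exp (q / 2) * lam ^ k * ‖Z i ω‖ ^ k)) P :=
      (integrable_const _).add hi'
    calc _ ≤ ∫ ω, (1 + (lam ^ 2 * ‖Z i ω‖ ^ 2 + Real.exp (q / 2) * lam ^ k * ‖Z i ω‖ ^ k)) ∂P := by
          refine integral_mono_of_nonneg (.of_forall fun ω => ?_) hi (.of_forall fun ω => ?_)
          · have := Real.add_one_le_exp ‖lam • truncNorm (t / 2) (Z i ω)‖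
            simp only [Pi.zero_apply]; linarith
          · have hle : ‖lam • truncNorm (t / 2) (Z i ω)‖ ≤ lam * ‖Z i ω‖ := by
              rw [norm_smul, Real.norm_of_nonneg hlam0.le]
              gcongr; exact norm_truncNorm_le_self _ _
            refine (exp_sub_self_le hk.le (norm_nonneg _) (hφb i ω)).trans ?_
            change _ ≤ 1 + (lam ^ 2 * ‖Z i ω‖ ^ 2 + Real.exp (q / 2) * lam ^ k * ‖Z i ω‖ ^ k)
            rw [add_assoc, mul_assoc, ← Real.mul_rpow hlam0.le (norm_nonneg _), ← mul_pow]
            gcongr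
      _ = 1 + (lam ^ 2 * ∫ ω, ‖Z i ω‖ ^ 2 ∂P +
            Real.exp (q / 2) * lam ^ k * ∫ ω, ‖Z i ω‖ ^ k ∂P) := by
          rw [integral_add (integrable_const _) hi',
            integral_add ((h2i i).const_mul _) ((hki i).const_mul _), integral_const_mul,
            integral_const_mul]
          simp
      _ ≤ 1 + (lam ^ 2 * 1 + Real.exp (q / 2) * lam ^ k * 1) := by
          gcongr
          · exact h2 i
          · exact hk1 i
      _ = _ := by ring
  have hstep : ∀ i (y : E), ∫⁻ ω, ENNReal.ofReal (Real.cosh ‖y + lam • truncNorm (t / 2) (Z i ω)‖) ∂P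
      ≤ ENNReal.ofReal (Real.exp c) * ENNReal.ofReal (Real.cosh ‖y‖) + 0 := fun i y => by
    rw [add_zero]
    refine (lintegral_cosh_norm_add_le (hφm i) (hφb i) y).trans ?_
    gcongr
    have h1 := hexp i
    have h3 := hmean' i
    -- The `3` in the exponent is `1` from the second moment plus `2` from this drift of the mean.
    have h4 : 2 * q / t ^ 2 ≤ 2 * q ^ 2 / t ^ 2 := by gcongr; nlinarith
    have h5 : lam ^ 2 = q ^ 2 / t ^ 2 := by rw [hlam, div_pow]
    have h6 : q ^ 2 / t ^ 2 + 2 * q ^ 2 / t ^ 2 = 3 * q ^ 2 / t ^ 2 := by ring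
    have := Real.add_one_le_exp c
    linarith
  have hind' : iIndepFun (fun i ω => lam • truncNorm (t / 2) (Z i ω)) P :=
    hind.comp (fun _ x => lam • truncNorm (t / 2) x)
      fun _ => (measurable_truncNorm _).const_smul lam
  have := lintegral_comp_sum_le hφm hind' (f := fun y => ENNReal.ofReal (Real.cosh ‖y‖))
    (by fun_prop) hstep s
  simp only [norm_zero, Real.cosh_zero, ENNReal.ofReal_one, mul_one, zero_mul, add_zero,
    ← Finset.smul_sum, norm_smul, Real.norm_of_nonneg hlam0.le] at this
  rwa [← ENNReal.ofReal_pow (by positivity), ← Real.exp_nat_mul] at this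

/-- A Fuk–Nagaev type bound in expectation: beyond the Gaussian range, the excess of the norm of a
sum of independent centered vectors is governed by a single large summand. -/
theorem lintegral_norm_sum_sub_le [CompleteSpace E] [MeasurableSpace E] [BorelSpace E]
    [SecondCountableTopology E] {Ω ι : Type*} [MeasurableSpace Ω]
    {P : Measure Ω} [IsProbabilityMeasure P] {Z : ι → Ω → E} (hZ : ∀ i, Measurable (Z i))
    (hind : iIndepFun Z P) (hint : ∀ i, Integrable (Z i) P) (hmean : ∀ i, ∫ ω, Z i ω ∂P = 0)
    {k : ℝ} (hk : 2 < k) (h2i : ∀ i, Integrable (fun ω => ‖Z i ω‖ ^ 2) P)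
    (h2 : ∀ i, ∫ ω, ‖Z i ω‖ ^ 2 ∂P ≤ 1) (hki : ∀ i, Integrable (fun ω => ‖Z i ω‖ ^ k) P)
    (hk1 : ∀ i, ∫ ω, ‖Z i ω‖ ^ k ∂P ≤ 1) (s : Finset ι) (hs : s.Nonempty) {t : ℝ}
    (ht : 16 * k ^ 2 * Real.sqrt s.card * Real.log (2 + s.card) ≤ t) :
    ∫⁻ ω, ENNReal.ofReal (‖∑ i ∈ s, Z i ω‖ - t) ∂P ≤
      ENNReal.ofReal ((2 * Real.exp (3 + (2 * k) ^ k) + 2 ^ (k - 1)) * (s.card / t ^ (k - 1))) := by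
  set M : ℝ := (s.card : ℝ) with hM
  have hM1 : 1 ≤ M := by rw [hM]; exact_mod_cast hs.card_pos
  have hM0 : 0 < M := by linarith
  have hlog1 : 1 ≤ Real.log (2 + M) := by
    rw [Real.le_log_iff_exp_le (by linarith)]
    linarith [Real.exp_one_lt_d9]
  have hsM : 0 < Real.sqrt M := Real.sqrt_pos.2 hM0
  obtain ⟨x, htx⟩ : ∃ x, t = Real.sqrt M * x := ⟨t / Real.sqrt M, by field_simp⟩
  have hxL : 16 * k ^ 2 * Real.log (2 + M) ≤ x := by
    refine le_of_mul_le_mul_left (a := Real.sqrt M) ?_ hsM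
    rw [← htx]; linarith
  have hx16 : 16 * k ^ 2 ≤ x := by nlinarith [sq_nonneg k]
  have hx0 : 0 < x := by nlinarith
  have ht0 : 0 < t := by rw [htx]; positivity
  -- With this `q` the Chernoff factor `exp (-q)` equals `M / t ^ k`, the probability scale of one
  -- large summand.
  set q := Real.log (t ^ k / M) with hq
  have hqe : Real.exp q = t ^ k / M := Real.exp_log (by positivity)
  have hqx : q = k * Real.log x + (k / 2 - 1) * Real.log M := by
    rw [hq, Real.log_div (by positivity) (by positivity), Real.log_rpow ht0, htx,
      Real.log_mul (by positivity) (by positivity), Real.log_sqrt hM0.le]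
    ring
  have hlogM : 0 ≤ Real.log M := Real.log_nonneg hM1
  have hlogx1 : 1 ≤ Real.log x := by
    rw [Real.le_log_iff_exp_le hx0]
    nlinarith [Real.exp_one_lt_d9]
  have hq1 : 1 ≤ q := by
    rw [hqx]; nlinarith
  have hqle : q ≤ x := by
    have h1 : Real.log x ≤ 2 * Real.sqrt x := by
      have := Real.log_le_sub_one_of_pos (Real.sqrt_pos.2 hx0)
      rw [Real.log_sqrt hx0.le] at this
      linarith
    have h3 : 4 * k ≤ Real.sqrt x := Real.le_sqrt_of_sq_le (by nlinarith)
    have h4 : Real.sqrt x * Real.sqrt x = x := Real.mul_self_sqrt hx0.le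
    have h5 : k * Real.log x ≤ x / 2 := by
      have : 0 ≤ Real.sqrt x := Real.sqrt_nonneg x
      nlinarith
    have h6 : Real.log M ≤ Real.log (2 + M) := Real.log_le_log hM0 (by linarith)
    have h7 : (k / 2 - 1) * Real.log M ≤ x / 2 := by nlinarith
    rw [hqx]; linarith
  have hqt : q / t ≤ 1 / Real.sqrt M := by
    rw [htx, div_le_div_iff₀ (by positivity) hsM]; nlinarith
  -- the truncated sum
  have hA : M * (3 * q ^ 2 / t ^ 2 + Real.exp (q / 2) * (q / t) ^ k) ≤ 3 + (2 * k) ^ k := by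
    have h1 : M * (q ^ 2 / t ^ 2) ≤ 1 := by
      rw [← div_pow]
      calc M * (q / t) ^ 2 ≤ M * (1 / Real.sqrt M) ^ 2 := by gcongr
        _ = 1 := by rw [div_pow, Real.sq_sqrt hM0.le]; field_simp
    have h3 : M * (Real.exp (q / 2) * (q / t) ^ k) ≤ (2 * k) ^ k := by
      have : M * (Real.exp (q / 2) * (q / t) ^ k) = q ^ k * Real.exp (-(q / 2)) := by
        have h8 : Real.exp (-(q / 2)) = Real.exp (q / 2) / Real.exp q := by
          rw [← Real.exp_sub]; congr 1; ring
        rw [Real.div_rpow (by linarith) ht0.le, h8, hqe]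
        have : t ^ k ≠ 0 := by positivity
        field_simp
      rw [this]
      exact rpow_mul_exp_neg_half_le (by linarith) (by linarith)
    calc _ = 3 * (M * (q ^ 2 / t ^ 2)) + M * (Real.exp (q / 2) * (q / t) ^ k) := by ring
      _ ≤ _ := by linarith
  have htm : ∀ i, Measurable fun ω => truncNorm (t / 2) (Z i ω) := fun i =>
    (measurable_truncNorm _).comp (hZ i)
  have h1 : ∫⁻ ω, ENNReal.ofReal (‖∑ i ∈ s, truncNorm (t / 2) (Z i ω)‖ - t) ∂P ≤
      ENNReal.ofReal (2 * Real.exp (3 + (2 * k) ^ k) * (M / t ^ (k - 1))) := by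
    calc _ ≤ ∫⁻ ω, ENNReal.ofReal (2 * (M / t ^ (k - 1))) *
          ENNReal.ofReal (Real.cosh (q / t * ‖∑ i ∈ s, truncNorm (t / 2) (Z i ω)‖)) ∂P := by
          refine lintegral_mono fun ω => ?_
          rw [← ENNReal.ofReal_mul (by positivity)]
          refine ENNReal.ofReal_le_ofReal ?_
          set v := ‖∑ i ∈ s, truncNorm (t / 2) (Z i ω)‖
          have e1 : q / t * (v - t) ≤ Real.exp (q / t * (v - t)) := by
            linarith [Real.add_one_le_exp (q / t * (v - t))]
          have e2 : Real.exp (q / t * (v - t)) ≤ 2 * Real.cosh (q / t * v) * Real.exp (-q) := by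
            have : q / t * (v - t) = q / t * v + -q := by field_simp; ring
            rw [this, Real.exp_add, Real.cosh_eq]
            gcongr
            have := Real.exp_pos (-(q / t * v))
            linarith
          -- The excess itself, not only its probability, is bounded through `x ≤ exp x` at `x = (q
          -- / t) (v - t)`.
          have e3 : v - t ≤ t / q * (2 * Real.cosh (q / t * v) * Real.exp (-q)) :=
            calc v - t = t / q * (q / t * (v - t)) := by field_simp
              _ ≤ _ := mul_le_mul_of_nonneg_left (e1.trans e2) (by positivity)
          have e4 : t / q ≤ t := div_le_self ht0.le hq1
          have e5 : Real.exp (-q) = M / t ^ k := by rw [Real.exp_neg, hqe, inv_div]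
          have e6 : t * (M / t ^ k) = M / t ^ (k - 1) := by
            rw [Real.rpow_sub_one ht0.ne']; field_simp
          calc v - t ≤ t / q * (2 * Real.cosh (q / t * v) * Real.exp (-q)) := e3
            _ ≤ t * (2 * Real.cosh (q / t * v) * Real.exp (-q)) := by gcongr
            _ = 2 * (t * (M / t ^ k)) * Real.cosh (q / t * v) := by rw [e5]; ring
            _ = _ := by rw [e6]
      _ = ENNReal.ofReal (2 * (M / t ^ (k - 1))) *
          ∫⁻ ω, ENNReal.ofReal (Real.cosh (q / t * ‖∑ i ∈ s, truncNorm (t / 2) (Z i ω)‖)) ∂P :=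
        lintegral_const_mul _ (by fun_prop)
      _ ≤ ENNReal.ofReal (2 * (M / t ^ (k - 1))) * ENNReal.ofReal (Real.exp (3 + (2 * k) ^ k)) := by
        gcongr
        refine (lintegral_cosh_norm_sum_truncNorm_le hZ hind hint hmean hk h2i h2 hki hk1 s ht0
          hq1).trans (ENNReal.ofReal_le_ofReal (Real.exp_le_exp.2 hA))
      _ = _ := by
        rw [← ENNReal.ofReal_mul (by positivity)]
        congr 1; ring
  -- the large summands
  have h3 : ∀ i, ∫⁻ ω, ENNReal.ofReal ‖Z i ω - truncNorm (t / 2) (Z i ω)‖ ∂P ≤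
      ENNReal.ofReal (2 ^ (k - 1) / t ^ (k - 1)) := fun i => by
    calc _ ≤ ∫⁻ ω, ENNReal.ofReal (‖Z i ω‖ ^ k * (2 ^ (k - 1) / t ^ (k - 1))) ∂P := by
          refine lintegral_mono fun ω => ENNReal.ofReal_le_ofReal ?_
          have := norm_sub_truncNorm_le (τ := t / 2) (p := k - 1) (by positivity) (by linarith) (Z i ω)
          rw [sub_add_cancel, Real.div_rpow ht0.le two_pos.le] at this
          refine this.trans (le_of_eq ?_)
          field_simp
      _ = ENNReal.ofReal ((∫ ω, ‖Z i ω‖ ^ k ∂P) * (2 ^ (k - 1) / t ^ (k - 1))) := by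
          rw [← integral_mul_const, ofReal_integral_eq_lintegral_ofReal ((hki i).mul_const _)
            (.of_forall fun ω => by positivity)]
      _ ≤ ENNReal.ofReal (1 * (2 ^ (k - 1) / t ^ (k - 1))) := by
          gcongr; exact hk1 i
      _ = _ := by rw [one_mul]
  calc ∫⁻ ω, ENNReal.ofReal (‖∑ i ∈ s, Z i ω‖ - t) ∂P
      ≤ ∫⁻ ω, (ENNReal.ofReal (‖∑ i ∈ s, truncNorm (t / 2) (Z i ω)‖ - t) +
          ∑ i ∈ s, ENNReal.ofReal ‖Z i ω - truncNorm (t / 2) (Z i ω)‖) ∂P := by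
        -- The excess of the full sum is at most that of the truncated sum plus the norms of all
        -- discarded parts.
        refine lintegral_mono fun ω => ?_
        rw [← ENNReal.ofReal_sum_of_nonneg fun i _ => norm_nonneg _]
        refine (ENNReal.ofReal_le_ofReal ?_).trans ENNReal.ofReal_add_le
        have e1 : ∑ i ∈ s, Z i ω = ∑ i ∈ s, truncNorm (t / 2) (Z i ω) +
            ∑ i ∈ s, (Z i ω - truncNorm (t / 2) (Z i ω)) := by
          rw [← Finset.sum_add_distrib]; simp
        have e2 := norm_add_le (∑ i ∈ s, truncNorm (t / 2) (Z i ω))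
          (∑ i ∈ s, (Z i ω - truncNorm (t / 2) (Z i ω)))
        have e3 := norm_sum_le s fun i => Z i ω - truncNorm (t / 2) (Z i ω)
        rw [e1]; linarith
    _ = ∫⁻ ω, ENNReal.ofReal (‖∑ i ∈ s, truncNorm (t / 2) (Z i ω)‖ - t) ∂P +
          ∑ i ∈ s, ∫⁻ ω, ENNReal.ofReal ‖Z i ω - truncNorm (t / 2) (Z i ω)‖ ∂P := by
        rw [lintegral_add_left (by fun_prop), lintegral_finsetSum _ fun i _ => by fun_prop]
    _ ≤ ENNReal.ofReal (2 * Real.exp (3 + (2 * k) ^ k) * (M / t ^ (k - 1))) +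
          ∑ i ∈ s, ENNReal.ofReal (2 ^ (k - 1) / t ^ (k - 1)) := by
        gcongr with i _
        exact h3 i
    _ = _ := by
        rw [Finset.sum_const, nsmul_eq_mul, ← ENNReal.ofReal_natCast, ← hM,
          ← ENNReal.ofReal_mul hM0.le, ← ENNReal.ofReal_add (by positivity) (by positivity)]
        congr 1; ring

end TailBound

/-! ### The Gaussian mechanism -/

section Gaussian

variable {ι : Type*} [Fintype ι]

variable (ι) in
/-- The law of a family of independent standard Gaussians. -/
noncomputable def gaussPi : Measure (ι → ℝ) := Measure.pi fun _ => gaussianReal 0 1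

instance : IsProbabilityMeasure (gaussPi ι) := by unfold gaussPi; infer_instance

theorem gaussianReal_eq_withDensity (v : ℝ) :
    gaussianReal v 1 =
      (gaussianReal 0 1).withDensity fun x => ENNReal.ofReal (Real.exp (v * x - v ^ 2 / 2)) := by
  rw [gaussianReal_of_var_ne_zero _ one_ne_zero, gaussianReal_of_var_ne_zero _ one_ne_zero,
    ← withDensity_mul _ (measurable_gaussianPDF _ _) (by fun_prop)]
  congr 1
  ext x
  simp only [Pi.mul_apply, gaussianPDF, gaussianPDFReal]
  rw [← ENNReal.ofReal_mul (by positivity), mul_assoc, mul_assoc, ← Real.exp_add]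
  congr 3
  simp only [NNReal.coe_one]
  ring

/-- The likelihood ratio of a shift is the product of the one-dimensional ratios, which is checked
on boxes. -/
theorem pi_gaussianReal_eq_withDensity (v : ι → ℝ) :
    Measure.pi (fun i => gaussianReal (v i) 1) =
      (gaussPi ι).withDensity fun x =>
        ENNReal.ofReal (Real.exp (∑ i, v i * x i - (∑ i, v i ^ 2) / 2)) := by
  refine Measure.pi_eq fun s hs => ?_
  rw [withDensity_apply _ (MeasurableSet.univ_pi hs), ← lintegral_indicator (.univ_pi hs)]
  have h1 : ∀ x : ι → ℝ, (Set.univ.pi s).indicator (fun x =>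
      ENNReal.ofReal (Real.exp (∑ i, v i * x i - (∑ i, v i ^ 2) / 2))) x =
      ∏ i, (s i).indicator (fun y => ENNReal.ofReal (Real.exp (v i * y - v i ^ 2 / 2))) (x i) := by
    intro x
    by_cases hx : x ∈ Set.univ.pi s
    · rw [Set.indicator_of_mem hx, Finset.sum_div, ← Finset.sum_sub_distrib, Real.exp_sum,
        ENNReal.ofReal_prod_of_nonneg fun _ _ => (Real.exp_pos _).le]
      exact Finset.prod_congr rfl fun i _ => (Set.indicator_of_mem (hx i trivial)
        fun y => ENNReal.ofReal (Real.exp (v i * y - v i ^ 2 / 2))).symm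
    · rw [Set.indicator_of_notMem hx]
      simp only [Set.mem_univ_pi, not_forall] at hx
      obtain ⟨i, hi⟩ := hx
      exact (Finset.prod_eq_zero (Finset.mem_univ i) (Set.indicator_of_notMem hi _)).symm
  simp_rw [h1]
  have hm : ∀ i, Measurable ((s i).indicator
      fun y => ENNReal.ofReal (Real.exp (v i * y - v i ^ 2 / 2))) := fun i =>
    Measurable.indicator (by fun_prop) (hs i)
  have hind := iIndepFun_pi (μ := fun _ : ι => gaussianReal 0 1)
    (X := fun i => (s i).indicator fun y => ENNReal.ofReal (Real.exp (v i * y - v i ^ 2 / 2)))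
    fun i => (hm i).aemeasurable
  rw [gaussPi, lintegral_prod_eq_prod_lintegral_of_indepFun _ _ hind
    fun i => (hm i).comp (measurable_pi_apply i)]
  refine Finset.prod_congr rfl fun i _ => ?_
  rw [gaussianReal_eq_withDensity (v i), withDensity_apply _ (hs i), ← lintegral_indicator (hs i),
    ← (measurePreserving_eval (fun _ : ι => gaussianReal 0 1) i).lintegral_comp (hm i)]

theorem gaussPi_map_add (v : ι → ℝ) :
    (gaussPi ι).map (fun x => v + x) = Measure.pi fun i => gaussianReal (v i) 1 := by
  have := Measure.pi_map_pi (μ := fun _ : ι => gaussianReal 0 1) (f := fun i x => v i + x)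
    (fun i => by fun_prop)
  simp only [gaussianReal_map_const_add, zero_add] at this
  exact this

/-- The shifted law has total mass `1`, and its density is this exponential up to a constant. -/
theorem lintegral_exp_gaussPi (v : ι → ℝ) :
    ∫⁻ x, ENNReal.ofReal (Real.exp (∑ i, v i * x i)) ∂(gaussPi ι) =
      ENNReal.ofReal (Real.exp ((∑ i, v i ^ 2) / 2)) := by
  have h := congrArg (fun μ => μ Set.univ) (pi_gaussianReal_eq_withDensity v)
  simp only [measure_univ, withDensity_apply _ MeasurableSet.univ, Measure.restrict_univ] at h
  have h2 : ∀ x : ι → ℝ, ENNReal.ofReal (Real.exp (∑ i, v i * x i)) =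
      ENNReal.ofReal (Real.exp ((∑ i, v i ^ 2) / 2)) *
        ENNReal.ofReal (Real.exp (∑ i, v i * x i - (∑ i, v i ^ 2) / 2)) := fun x => by
    rw [← ENNReal.ofReal_mul (Real.exp_pos _).le, ← Real.exp_add]
    congr 2; ring
  simp_rw [h2]
  rw [lintegral_const_mul _ (by fun_prop), ← h, mul_one]

theorem gaussPi_linear_tail {v : ι → ℝ} {V a : ℝ} (hV : 0 < V) (hv : ∑ i, v i ^ 2 ≤ V)
    (ha : 0 ≤ a) :
    gaussPi ι {x | a < ∑ i, v i * x i} ≤ ENNReal.ofReal (Real.exp (-(a ^ 2 / (2 * V)))) := by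
  -- The Chernoff bound with its optimal parameter `a / V`.
  have hsub : {x : ι → ℝ | a < ∑ i, v i * x i} ⊆
      {x | ENNReal.ofReal (Real.exp (a / V * a)) ≤
        ENNReal.ofReal (Real.exp (∑ i, (a / V * v i) * x i))} := fun x hx => by
    simp only [Set.mem_ofPred_eq] at hx ⊢
    refine ENNReal.ofReal_le_ofReal (Real.exp_le_exp.2 ?_)
    simp_rw [mul_assoc]
    rw [← Finset.mul_sum]
    gcongr
  refine (measure_mono hsub).trans ((meas_ge_le_lintegral_div
    (Measurable.aemeasurable (by fun_prop)) (by positivity)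
    ENNReal.ofReal_ne_top).trans ?_)
  rw [lintegral_exp_gaussPi, ← ENNReal.ofReal_div_of_pos (Real.exp_pos _), ← Real.exp_sub]
  refine ENNReal.ofReal_le_ofReal (Real.exp_le_exp.2 ?_)
  simp_rw [mul_pow]
  rw [← Finset.mul_sum]
  have h1 : (a / V) ^ 2 * ∑ i, v i ^ 2 ≤ (a / V) ^ 2 * V := by gcongr
  have h2 : (a / V) ^ 2 * V = a ^ 2 / V := by field_simp
  have h3 : a / V * a = a ^ 2 / V := by ring
  have h4 : a ^ 2 / (2 * V) = a ^ 2 / V / 2 := by field_simp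
  linarith

/-- Privacy of the Gaussian mechanism: shifting independent standard Gaussians by vectors at squared
distance at most `V`. -/
theorem gaussPi_shift_le {a b : ι → ℝ} {V ε δ : ℝ} (hV : 0 < V)
    (hab : ∑ i, (a i - b i) ^ 2 ≤ V) (hVε : V / 2 ≤ ε)
    (hδ : Real.exp (-((ε - V / 2) ^ 2 / (2 * V))) ≤ δ) {S : Set (ι → ℝ)} (hS : MeasurableSet S) :
    gaussPi ι {x | a + x ∈ S} ≤
      ENNReal.ofReal (Real.exp ε) * gaussPi ι {x | b + x ∈ S} + ENNReal.ofReal δ := by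
  set v := a - b with hv
  set T := {x | b + x ∈ S} with hT
  have hTm : MeasurableSet T := (measurable_const_add b) hS
  have hshift : ∀ {U : Set (ι → ℝ)}, MeasurableSet U → gaussPi ι {x | v + x ∈ U} =
      ∫⁻ x in U, ENNReal.ofReal (Real.exp (∑ i, v i * x i - (∑ i, v i ^ 2) / 2)) ∂(gaussPi ι) := by
    intro U hU
    rw [← withDensity_apply _ hU, ← pi_gaussianReal_eq_withDensity, ← gaussPi_map_add,
      Measure.map_apply (by fun_prop) hU]
    rfl
  have heq : {x | a + x ∈ S} = {x | v + x ∈ T} := by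
    ext x
    have : b + (a - b + x) = a + x := by abel
    simp [hT, hv, this]
  -- On `G` the privacy loss is at most `ε`. Under the shifted law the complement of `G` is a
  -- one-dimensional Gaussian tail beyond `ε - V / 2`, and it is charged to `δ`.
  set G := {x : ι → ℝ | ∑ i, v i * x i - (∑ i, v i ^ 2) / 2 ≤ ε} with hG
  have hGm : MeasurableSet G := measurableSet_le (by fun_prop) measurable_const
  have hbad : gaussPi ι {x | v + x ∈ Gᶜ} ≤ ENNReal.ofReal δ := by
    have hsub : {x | v + x ∈ Gᶜ} ⊆ {x | ε - V / 2 < ∑ i, v i * x i} := fun x hx => by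
      simp only [hG, Set.mem_ofPred_eq, Set.mem_compl_iff, not_le, Pi.add_apply] at hx ⊢
      have : ∑ i, v i * (v i + x i) = ∑ i, v i ^ 2 + ∑ i, v i * x i := by
        rw [← Finset.sum_add_distrib]
        exact Finset.sum_congr rfl fun i _ => by ring
      have hab' : ∑ i, v i ^ 2 ≤ V := hab
      linarith
    exact (measure_mono hsub).trans ((gaussPi_linear_tail hV hab (by linarith)).trans
      (ENNReal.ofReal_le_ofReal hδ))
  rw [heq]
  calc gaussPi ι {x | v + x ∈ T}
      ≤ gaussPi ι ({x | v + x ∈ T ∩ G} ∪ {x | v + x ∈ Gᶜ}) := by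
        refine measure_mono fun x hx => ?_
        by_cases h : v + x ∈ G
        · exact Or.inl ⟨hx, h⟩
        · exact Or.inr h
    _ ≤ gaussPi ι {x | v + x ∈ T ∩ G} + gaussPi ι {x | v + x ∈ Gᶜ} := measure_union_le _ _
    _ ≤ ENNReal.ofReal (Real.exp ε) * gaussPi ι T + ENNReal.ofReal δ := by
        refine add_le_add ?_ hbad
        rw [hshift (hTm.inter hGm)]
        calc _ ≤ ∫⁻ _ in T ∩ G, ENNReal.ofReal (Real.exp ε) ∂(gaussPi ι) :=
              setLIntegral_mono measurable_const fun x hx =>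
                ENNReal.ofReal_le_ofReal (Real.exp_le_exp.2 hx.2)
          _ = ENNReal.ofReal (Real.exp ε) * gaussPi ι (T ∩ G) := setLIntegral_const _ _
          _ ≤ _ := by gcongr; exact Set.inter_subset_left

/-- The noise multiplier of the Gaussian mechanism for `(ε, δ)`-privacy at sensitivity `√2`. -/
noncomputable def noiseMult (ε δ : ℝ) : ℝ := 4 * (1 + Real.sqrt (Real.log (2 / δ))) / ε

theorem noiseMult_pos {ε δ : ℝ} (hε : 0 < ε) : 0 < noiseMult ε δ := by
  unfold noiseMult; positivity

/-- The distance is measured after dividing by the noise level. The numerator `2` leaves room for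
the coarse stage, which releases two quantities at once, each of squared sensitivity `1 / noiseMult
²` in these units. For `ε ≤ 1` the drift `V / 2` of the privacy loss is at most `ε / 4`. -/
theorem gaussPi_shift_le_of_noiseMult {a b : ι → ℝ} {ε δ : ℝ} (hε : 0 < ε) (hε1 : ε ≤ 1)
    (hδ : 0 < δ) (hδ1 : δ ≤ 1) (hab : ∑ i, (a i - b i) ^ 2 ≤ 2 / noiseMult ε δ ^ 2)
    {S : Set (ι → ℝ)} (hS : MeasurableSet S) :
    gaussPi ι {x | a + x ∈ S} ≤
      ENNReal.ofReal (Real.exp ε) * gaussPi ι {x | b + x ∈ S} + ENNReal.ofReal δ := by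
  have hs := noiseMult_pos (δ := δ) hε
  set L := Real.sqrt (Real.log (2 / δ)) with hL
  have hL0 : 0 ≤ L := Real.sqrt_nonneg _
  have hlog : 0 ≤ Real.log (2 / δ) := Real.log_nonneg (by rw [le_div_iff₀ hδ]; linarith)
  have hL2 : L ^ 2 = Real.log (2 / δ) := Real.sq_sqrt hlog
  have hVeq : 2 / noiseMult ε δ ^ 2 = ε ^ 2 / (8 * (1 + L) ^ 2) := by
    rw [noiseMult, ← hL]; field_simp; norm_num
  have hV : 0 < 2 / noiseMult ε δ ^ 2 := by positivity
  have hVle : 2 / noiseMult ε δ ^ 2 ≤ ε ^ 2 / 8 := by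
    rw [hVeq]; gcongr; nlinarith
  refine gaussPi_shift_le hV hab (by nlinarith) ?_ hS
  have h1 : L ^ 2 ≤ (ε - 2 / noiseMult ε δ ^ 2 / 2) ^ 2 / (2 * (2 / noiseMult ε δ ^ 2)) := by
    rw [le_div_iff₀ (by positivity)]
    have h2 : 3 / 4 * ε ≤ ε - 2 / noiseMult ε δ ^ 2 / 2 := by nlinarith
    have h3 : (3 / 4 * ε) ^ 2 ≤ (ε - 2 / noiseMult ε δ ^ 2 / 2) ^ 2 := by gcongr
    refine le_trans ?_ h3
    rw [hVeq]
    have h4 : L ^ 2 * (2 * (ε ^ 2 / (8 * (1 + L) ^ 2))) = (L ^ 2 / (1 + L) ^ 2) * (ε ^ 2 / 4) := by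
      field_simp; ring
    have h5 : L ^ 2 / (1 + L) ^ 2 ≤ 1 := by
      rw [div_le_one (by positivity)]; gcongr; linarith
    rw [h4]
    nlinarith [sq_nonneg ε]
  calc _ ≤ Real.exp (-(L ^ 2)) := Real.exp_le_exp.2 (by linarith)
    _ = δ / 2 := by rw [hL2, Real.exp_neg, Real.exp_log (by positivity), inv_div]
    _ ≤ δ := by linarith

end Gaussian

/-! ### A stable weighted average -/

set_option linter.unusedSectionVars false

section StableAverage

variable {ι E : Type*} [DecidableEq ι] [NormedAddCommGroup E] [NormedSpace ℝ E]

/-- The number of points with index in `A` at squared distance less than `τ` from point `i`. -/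
noncomputable def closeCount (A : Finset ι) (τ : ℝ) (Y : ι → E) (i : ι) : ℕ :=
  open Classical in (A.filter fun j => ‖Y i - Y j‖ ^ 2 < τ).card

/-- The weight of a point: positive when more than half of the points are close to it. -/
noncomputable def stableWeight (A : Finset ι) (τ : ℝ) (Y : ι → E) (i : ι) : ℕ :=
  2 * closeCount A τ Y i - A.card

noncomputable def totalWeight (A : Finset ι) (τ : ℝ) (Y : ι → E) : ℕ :=
  ∑ i ∈ A, stableWeight A τ Y i

/-- If no point has positive weight, the inverse is `0` and so is the value. -/
noncomputable def stableCenter (A : Finset ι) (τ : ℝ) (Y : ι → E) : E :=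
  (totalWeight A τ Y : ℝ)⁻¹ • ∑ i ∈ A, (stableWeight A τ Y i : ℝ) • Y i

variable {A : Finset ι} {τ r : ℝ} {Y Y' : ι → E} {i₀ : ι}

theorem closeCount_le_card (i : ι) : closeCount A τ Y i ≤ A.card :=
  Finset.card_filter_le _ _

theorem stableWeight_le_card (i : ι) : stableWeight A τ Y i ≤ A.card := by
  have := closeCount_le_card (A := A) (τ := τ) (Y := Y) i
  unfold stableWeight; omega

theorem closeCount_le_add_one (hY : ∀ i, i ≠ i₀ → Y i = Y' i) {i : ι} (hi : i ≠ i₀) :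
    closeCount A τ Y i ≤ closeCount A τ Y' i + 1 := by
  classical
  unfold closeCount
  refine le_trans (Finset.card_le_card ?_) (Finset.card_insert_le i₀ _)
  intro j hj
  rw [Finset.mem_filter] at hj
  rw [Finset.mem_insert, Finset.mem_filter]
  by_cases h : j = i₀
  · exact Or.inl h
  · exact Or.inr ⟨hj.1, by rw [← hY i hi, ← hY j h]; exact hj.2⟩

theorem stableWeight_le_add (hY : ∀ i, i ≠ i₀ → Y i = Y' i) {i : ι} (hi : i ≠ i₀) :
    stableWeight A τ Y i ≤ stableWeight A τ Y' i + 2 := by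
  have := closeCount_le_add_one (A := A) (τ := τ) hY hi
  unfold stableWeight; omega

theorem sum_ite_eq_le (A : Finset ι) (i₀ : ι) (a b : ℕ) :
    ∑ i ∈ A, (if i = i₀ then a else b) ≤ a + b * A.card := by
  calc ∑ i ∈ A, (if i = i₀ then a else b) ≤ ∑ i ∈ A, ((if i = i₀ then a else 0) + b) :=
        Finset.sum_le_sum fun i _ => by split_ifs <;> omega
    _ = (∑ i ∈ A, if i = i₀ then a else 0) + b * A.card := by
        rw [Finset.sum_add_distrib, Finset.sum_const, smul_eq_mul, mul_comm]
    _ ≤ _ := by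
        rw [Finset.sum_ite_eq']
        split_ifs <;> omega

/-- The changed point may gain its whole weight, at most `A.card`. Every other point gains at most
`2`, because the weight doubles the count. -/
theorem totalWeight_le_add (hY : ∀ i, i ≠ i₀ → Y i = Y' i) :
    totalWeight A τ Y ≤ totalWeight A τ Y' + 3 * A.card := by
  calc totalWeight A τ Y ≤ ∑ i ∈ A, (stableWeight A τ Y' i + if i = i₀ then A.card else 2) := by
        refine Finset.sum_le_sum fun i _ => ?_
        split_ifs with h
        · exact le_add_left (stableWeight_le_card i)
        · exact stableWeight_le_add hY h
    _ ≤ totalWeight A τ Y' + (A.card + 2 * A.card) := by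
        rw [Finset.sum_add_distrib]
        exact Nat.add_le_add_left (sum_ite_eq_le A i₀ _ _) _
    _ = _ := by ring

/-- A positive weight means that strictly more than half of `A` is close to `Y i`, and such a set
meets every subset holding at least half of `A`. -/
theorem exists_mem_of_stableWeight_pos {i : ι} (hi : 0 < stableWeight A τ Y i) {G : Finset ι}
    (hG : G ⊆ A) (hcard : A.card ≤ 2 * G.card) : ∃ j ∈ G, ‖Y i - Y j‖ ^ 2 < τ := by
  classical
  by_contra! h
  have hd : Disjoint (A.filter fun j => ‖Y i - Y j‖ ^ 2 < τ) G :=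
    Finset.disjoint_left.2 fun j hj hjG => absurd (Finset.mem_filter.1 hj).2 (not_lt.2 (h j hjG))
  have := Finset.card_le_card (Finset.union_subset (Finset.filter_subset
    (fun j => ‖Y i - Y j‖ ^ 2 < τ) A) hG)
  rw [Finset.card_union_of_disjoint hd] at this
  have h2 : closeCount A τ Y i = (A.filter fun j => ‖Y i - Y j‖ ^ 2 < τ).card := by
    unfold closeCount; congr
  unfold stableWeight at hi
  omega

/-- The two strict majorities share a point, which lies within `2r` of both. -/
theorem norm_sub_lt_of_stableWeight_pos (hr : 0 ≤ r) {i j : ι}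
    (hi : 0 < stableWeight A ((2 * r) ^ 2) Y i) (hj : 0 < stableWeight A ((2 * r) ^ 2) Y j) :
    ‖Y i - Y j‖ < 4 * r := by
  classical
  obtain ⟨l, hl, hil⟩ := exists_mem_of_stableWeight_pos hi
    (Finset.filter_subset (fun l => ‖Y j - Y l‖ ^ 2 < (2 * r) ^ 2) A) (by
      have h2 : closeCount A ((2 * r) ^ 2) Y j =
          (A.filter fun l => ‖Y j - Y l‖ ^ 2 < (2 * r) ^ 2).card := by
        unfold closeCount; congr
      unfold stableWeight at hj; omega)
  have h1 := lt_of_pow_lt_pow_left₀ 2 (by positivity) hil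
  have h2 := lt_of_pow_lt_pow_left₀ 2 (by positivity) (Finset.mem_filter.1 hl).2
  calc ‖Y i - Y j‖ = ‖(Y i - Y l) - (Y j - Y l)‖ := by congr 1; abel
    _ ≤ ‖Y i - Y l‖ + ‖Y j - Y l‖ := norm_sub_le _ _
    _ < 4 * r := by linarith

/-- Otherwise every unchanged point with positive weight for `Y` has weight `0` for `Y'`, hence
weight at most `2` for `Y`, and the total is at most `3 * A.card`. The common point serves as an
origin for comparing the two averages. -/
theorem exists_common_stableWeight_pos (hY : ∀ i, i ≠ i₀ → Y i = Y' i)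
    (hW : 3 * A.card < totalWeight A τ Y) :
    ∃ p ∈ A, p ≠ i₀ ∧ 0 < stableWeight A τ Y p ∧ 0 < stableWeight A τ Y' p := by
  by_contra! h
  have : totalWeight A τ Y ≤ A.card + 2 * A.card := by
    refine le_trans (Finset.sum_le_sum fun i hi => ?_) (sum_ite_eq_le A i₀ A.card 2)
    split_ifs with hi0
    · exact stableWeight_le_card i
    · have h1 := stableWeight_le_add (A := A) (τ := τ) hY hi0
      rcases Nat.eq_zero_or_pos (stableWeight A τ Y i) with h2 | h2
      · omega
      · have := h i hi hi0 h2; omega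
  omega

theorem stableCenter_eq (hW : 0 < totalWeight A τ Y) (p : E) :
    stableCenter A τ Y = p + (totalWeight A τ Y : ℝ)⁻¹ •
      ∑ i ∈ A, (stableWeight A τ Y i : ℝ) • (Y i - p) := by
  have h : (totalWeight A τ Y : ℝ) ≠ 0 := by exact_mod_cast hW.ne'
  have h2 : ∑ i ∈ A, (stableWeight A τ Y i : ℝ) = totalWeight A τ Y := by
    unfold totalWeight; push_cast; rfl
  simp_rw [smul_sub]
  rw [Finset.sum_sub_distrib, ← Finset.sum_smul, h2, smul_sub, inv_smul_smul₀ h]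
  unfold stableCenter; abel

theorem norm_weighted_sum_le {p : E} {D : ℝ}
    (hD : ∀ i ∈ A, 0 < stableWeight A τ Y i → ‖Y i - p‖ ≤ D) :
    ‖∑ i ∈ A, (stableWeight A τ Y i : ℝ) • (Y i - p)‖ ≤ totalWeight A τ Y * D := by
  calc _ ≤ ∑ i ∈ A, (stableWeight A τ Y i : ℝ) * D := by
        refine norm_sum_le_of_le _ fun i hi => ?_
        rw [norm_smul, Real.norm_of_nonneg (Nat.cast_nonneg _)]
        rcases Nat.eq_zero_or_pos (stableWeight A τ Y i) with h2 | h2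
        · simp [h2]
        · gcongr; exact hD i hi h2
    _ = _ := by rw [← Finset.sum_mul]; unfold totalWeight; push_cast; rfl

theorem norm_stableCenter_sub_le (hW : 0 < totalWeight A τ Y) {p : E} {D : ℝ}
    (hD : ∀ i ∈ A, 0 < stableWeight A τ Y i → ‖Y i - p‖ ≤ D) : ‖stableCenter A τ Y - p‖ ≤ D := by
  have h : 0 < (totalWeight A τ Y : ℝ) := by exact_mod_cast hW
  rw [stableCenter_eq hW p, add_sub_cancel_left, norm_smul, norm_inv, Real.norm_of_nonneg h.le,
    inv_mul_le_iff₀ h]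
  exact norm_weighted_sum_le hD

/-- Stability of the weighted average when one point changes. -/
theorem norm_stableCenter_sub_stableCenter_le (hr : 0 ≤ r) (hY : ∀ i, i ≠ i₀ → Y i = Y' i)
    (hW : 3 * A.card < totalWeight A ((2 * r) ^ 2) Y) (hW' : 0 < totalWeight A ((2 * r) ^ 2) Y') :
    ‖stableCenter A ((2 * r) ^ 2) Y - stableCenter A ((2 * r) ^ 2) Y'‖ ≤
      28 * A.card * r / totalWeight A ((2 * r) ^ 2) Y := by
  set τ := (2 * r) ^ 2 with hτ
  obtain ⟨p, hpA, hp0, hp, hp'⟩ := exists_common_stableWeight_pos hY hW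
  have hWp : 0 < totalWeight A τ Y := by omega
  have hYs : ∀ i, i ≠ i₀ → Y' i = Y i := fun i hi => (hY i hi).symm
  set q := Y p with hq
  have hq' : q = Y' p := hY p hp0
  set N := ∑ i ∈ A, (stableWeight A τ Y i : ℝ) • (Y i - q) with hN
  set N' := ∑ i ∈ A, (stableWeight A τ Y' i : ℝ) • (Y' i - q) with hN'
  set W : ℝ := (totalWeight A τ Y : ℝ) with hWd
  set W' : ℝ := (totalWeight A τ Y' : ℝ) with hWd'
  have hW0 : 0 < W := by rw [hWd]; exact_mod_cast hWp
  have hW0' : 0 < W' := by rw [hWd']; exact_mod_cast hW'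
  have hclose : ∀ i, 0 < stableWeight A τ Y i → ‖Y i - q‖ ≤ 4 * r := fun i hi =>
    (norm_sub_lt_of_stableWeight_pos hr hi hp).le
  have hclose' : ∀ i, 0 < stableWeight A τ Y' i → ‖Y' i - q‖ ≤ 4 * r := fun i hi => by
    rw [hq']; exact (norm_sub_lt_of_stableWeight_pos hr hi hp').le
  have hN'le : ‖N'‖ ≤ W' * (4 * r) := norm_weighted_sum_le fun i _ hi => hclose' i hi
  -- An unchanged point contributes a weight difference of at most `2` times a distance of at most
  -- `4r`; the changed point contributes two terms of norm at most `A.card * 4r`. Together they give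
  -- the `16` in `hNN`.
  have hterm : ∀ i ∈ A, ‖(stableWeight A τ Y i : ℝ) • (Y i - q) -
      (stableWeight A τ Y' i : ℝ) • (Y' i - q)‖ ≤ ((if i = i₀ then A.card else 1 : ℕ) : ℝ) * (8 * r) := by
    intro i _
    split_ifs with hi
    · have h1 : ‖(stableWeight A τ Y i : ℝ) • (Y i - q)‖ ≤ A.card * (4 * r) := by
        rw [norm_smul, Real.norm_of_nonneg (Nat.cast_nonneg _)]
        rcases Nat.eq_zero_or_pos (stableWeight A τ Y i) with h2 | h2
        · rw [h2, Nat.cast_zero, zero_mul]; positivity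
        · gcongr
          · exact_mod_cast stableWeight_le_card i
          · exact hclose i h2
      have h1' : ‖(stableWeight A τ Y' i : ℝ) • (Y' i - q)‖ ≤ A.card * (4 * r) := by
        rw [norm_smul, Real.norm_of_nonneg (Nat.cast_nonneg _)]
        rcases Nat.eq_zero_or_pos (stableWeight A τ Y' i) with h2 | h2
        · rw [h2, Nat.cast_zero, zero_mul]; positivity
        · gcongr
          · exact_mod_cast stableWeight_le_card i
          · exact hclose' i h2
      linarith [norm_sub_le ((stableWeight A τ Y i : ℝ) • (Y i - q))
        ((stableWeight A τ Y' i : ℝ) • (Y' i - q))]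
    · rw [← hY i hi, ← sub_smul, norm_smul, Nat.cast_one, one_mul]
      have h1 : ‖(stableWeight A τ Y i : ℝ) - stableWeight A τ Y' i‖ ≤ 2 := by
        have a1 : (stableWeight A τ Y i : ℝ) ≤ stableWeight A τ Y' i + 2 := by
          exact_mod_cast stableWeight_le_add hY hi
        have a2 : (stableWeight A τ Y' i : ℝ) ≤ stableWeight A τ Y i + 2 := by
          exact_mod_cast stableWeight_le_add hYs hi
        rw [Real.norm_eq_abs, abs_le]; constructor <;> linarith
      rcases Nat.eq_zero_or_pos (stableWeight A τ Y i) with h2 | h2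
      · rcases Nat.eq_zero_or_pos (stableWeight A τ Y' i) with h3 | h3
        · rw [h2, h3]; simp; exact hr
        · have := hclose' i h3
          rw [← hY i hi] at this
          calc _ ≤ 2 * (4 * r) := by gcongr
            _ = _ := by ring
      · calc _ ≤ 2 * (4 * r) := by gcongr; exact hclose i h2
          _ = _ := by ring
  have hNN : ‖N - N'‖ ≤ 16 * A.card * r := by
    rw [hN, hN', ← Finset.sum_sub_distrib]
    refine (norm_sum_le_of_le _ hterm).trans ?_
    rw [← Finset.sum_mul, ← Nat.cast_sum]
    have : ((∑ i ∈ A, (if i = i₀ then A.card else 1) : ℕ) : ℝ) ≤ 2 * A.card := by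
      have := sum_ite_eq_le A i₀ A.card 1
      calc _ ≤ ((A.card + 1 * A.card : ℕ) : ℝ) := by exact_mod_cast this
        _ = _ := by push_cast; ring
    nlinarith
  have hWW : |W' - W| ≤ 3 * A.card := by
    have a1 : W ≤ W' + 3 * A.card := by
      rw [hWd, hWd']; exact_mod_cast totalWeight_le_add (A := A) (τ := τ) hY
    have a2 : W' ≤ W + 3 * A.card := by
      rw [hWd, hWd']; exact_mod_cast totalWeight_le_add (A := A) (τ := τ) hYs
    rw [abs_le]; constructor <;> linarith
  -- The change of the numerator and that of the normalization are separated. Since `N'` has norm at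
  -- most `4r W'`, the normalization costs `3 * 4 = 12`, and `28 = 16 + 12`.
  have heq : stableCenter A τ Y - stableCenter A τ Y' =
      W⁻¹ • ((N - N') + ((W' - W) * W'⁻¹) • N') := by
    rw [stableCenter_eq hWp q, stableCenter_eq hW' q, ← hN, ← hN', ← hWd, ← hWd', smul_add,
      smul_sub, smul_smul]
    have : W⁻¹ * ((W' - W) * W'⁻¹) = W⁻¹ - W'⁻¹ := by field_simp
    rw [this, sub_smul]; abel
  rw [heq, norm_smul, norm_inv, Real.norm_of_nonneg hW0.le, inv_mul_le_iff₀ hW0]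
  have h5 : ‖((W' - W) * W'⁻¹) • N'‖ ≤ 12 * A.card * r := by
    rw [norm_smul, norm_mul, norm_inv, Real.norm_of_nonneg hW0'.le, Real.norm_eq_abs]
    calc |W' - W| * W'⁻¹ * ‖N'‖ ≤ (3 * A.card) * W'⁻¹ * (W' * (4 * r)) := by gcongr
      _ = 12 * A.card * r := by field_simp; ring
  have h6 : W * (28 * A.card * r / W) = 28 * A.card * r := by field_simp
  rw [h6]
  linarith [norm_add_le (N - N') (((W' - W) * W'⁻¹) • N')]

/-! Accuracy when most points are close to a common point. -/

section Accuracy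

variable {μ : E} {G : Finset ι}

theorem card_le_closeCount (hGA : G ⊆ A) (hG : ∀ i ∈ G, ‖Y i - μ‖ < r) {i : ι} (hi : i ∈ G) :
    G.card ≤ closeCount A ((2 * r) ^ 2) Y i := by
  classical
  refine Finset.card_le_card fun j hj => Finset.mem_filter.2 ⟨hGA hj, ?_⟩
  have h1 := hG i hi
  have h2 := hG j hj
  have : ‖Y i - Y j‖ < 2 * r := by
    calc ‖Y i - Y j‖ = ‖(Y i - μ) - (Y j - μ)‖ := by congr 1; abel
      _ ≤ ‖Y i - μ‖ + ‖Y j - μ‖ := norm_sub_le _ _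
      _ < 2 * r := by linarith
  gcongr

/-- Points within `r` of `μ` are within `2r` of each other. So at least `9/10` of the points have
weight at least `4/5` of `A.card`, and `9/10 * 4/5 = 18/25`. -/
theorem le_totalWeight (hGA : G ⊆ A) (hG : ∀ i ∈ G, ‖Y i - μ‖ < r)
    (hcard : 9 * A.card ≤ 10 * G.card) : 18 * A.card ^ 2 ≤ 25 * totalWeight A ((2 * r) ^ 2) Y := by
  have h1 : ∑ i ∈ G, stableWeight A ((2 * r) ^ 2) Y i ≤ totalWeight A ((2 * r) ^ 2) Y :=
    Finset.sum_le_sum_of_subset hGA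
  have h2 : ∀ i ∈ G, 4 * A.card ≤ 5 * stableWeight A ((2 * r) ^ 2) Y i := fun i hi => by
    have := card_le_closeCount hGA hG hi
    unfold stableWeight; omega
  have h3 : G.card * (4 * A.card) ≤ 5 * ∑ i ∈ G, stableWeight A ((2 * r) ^ 2) Y i := by
    rw [Finset.mul_sum, ← smul_eq_mul]
    exact Finset.card_nsmul_le_sum _ _ _ h2
  nlinarith

/-- Even an outlier of positive weight is within `2r` of a point of `G`, hence within `3r` of `μ`,
and an average of such points is too. -/
theorem norm_stableCenter_sub_le_of_close (hr : 0 ≤ r) (hGA : G ⊆ A)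
    (hG : ∀ i ∈ G, ‖Y i - μ‖ < r) (hcard : 9 * A.card ≤ 10 * G.card)
    (hW : 0 < totalWeight A ((2 * r) ^ 2) Y) :
    ‖stableCenter A ((2 * r) ^ 2) Y - μ‖ ≤ 3 * r := by
  refine norm_stableCenter_sub_le hW fun i _ hi => ?_
  obtain ⟨j, hj, hij⟩ := exists_mem_of_stableWeight_pos hi hGA (by omega)
  have h1 := lt_of_pow_lt_pow_left₀ 2 (by positivity) hij
  have h2 := hG j hj
  calc ‖Y i - μ‖ = ‖(Y i - Y j) + (Y j - μ)‖ := by congr 1; abel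
    _ ≤ ‖Y i - Y j‖ + ‖Y j - μ‖ := norm_add_le _ _
    _ ≤ 3 * r := by linarith

end Accuracy

end StableAverage

/-! ### The coarse estimator -/

section Coarse

variable {n d : ℕ}

/-- The noisy weighted average, released when the noisy total weight exceeds the threshold `t`.
Coordinate `0` of `x` perturbs the total weight, the others perturb the average. -/
noncomputable def coarseVal (A : Finset (Fin n)) (τ t σ₁ σ₂ : ℝ) (Y : Fin n → Vec d)
    (x : Fin (d + 1) → ℝ) : Vec d :=
  if t < totalWeight A τ Y + σ₁ * x 0 then
    stableCenter A τ Y + σ₂ • WithLp.toLp 2 fun c : Fin d => x c.succ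
  else 0

/-- The release threshold for `h` people. -/
noncomputable def coarseThreshold (h ε δ : ℝ) : ℝ :=
  h ^ 2 / 4 + 6 * h + 3 * h * noiseMult ε δ * (2 * (1 + Real.sqrt (Real.log (2 / δ))))

/-- This is the event that noise alone lifts an insufficient total weight over the release
threshold. -/
theorem gaussPi_coord_tail {N : ℕ} {δ : ℝ} (hδ : 0 < δ) (hδ1 : δ ≤ 1) :
    gaussPi (Fin (N + 1)) {x | 2 * (1 + Real.sqrt (Real.log (2 / δ))) < x 0} ≤
      ENNReal.ofReal (δ / 2) := by
  set L := Real.sqrt (Real.log (2 / δ)) with hL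
  have hL0 : 0 ≤ L := Real.sqrt_nonneg _
  have hlog : 0 ≤ Real.log (2 / δ) := Real.log_nonneg (by rw [le_div_iff₀ hδ]; linarith)
  have hL2 : L ^ 2 = Real.log (2 / δ) := Real.sq_sqrt hlog
  have h := gaussPi_linear_tail (ι := Fin (N + 1)) (v := Pi.single 0 1) (V := 1) one_pos
    (by simp [Pi.single_apply]) (a := 2 * (1 + L)) (by positivity)
  simp only [Pi.single_apply, ite_mul, one_mul, zero_mul, Finset.sum_ite_eq', Finset.mem_univ,
    if_true] at h
  refine h.trans (ENNReal.ofReal_le_ofReal ?_)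
  calc _ ≤ Real.exp (-(L ^ 2)) := Real.exp_le_exp.2 (by nlinarith)
    _ = δ / 2 := by rw [hL2, Real.exp_neg, Real.exp_log (by positivity), inv_div]

/-- If each of two output laws equals `0` outside an event of small probability, they are close. -/
theorem measure_le_of_eq_zero_off {Ω V : Type*} [MeasurableSpace Ω] [Zero V] {P : Measure Ω}
    [IsProbabilityMeasure P] {F F' : Ω → V} {B : Set Ω} {δ : ℝ}
    (hB : P B ≤ ENNReal.ofReal (δ / 2)) (hδ : 0 ≤ δ)
    (hF : ∀ ω ∉ B, F ω = 0) (hF' : ∀ ω ∉ B, F' ω = 0) (S : Set V) :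
    P {ω | F ω ∈ S} ≤ P {ω | F' ω ∈ S} + ENNReal.ofReal δ := by
  have h2 : {ω | F ω ∈ S} ⊆ {ω | F' ω ∈ S} ∪ B := fun ω hω => by
    by_cases h : ω ∈ B
    · exact Or.inr h
    · left
      have : F ω ∈ S := hω
      rw [hF ω h] at this
      change F' ω ∈ S
      rwa [hF' ω h]
  refine (measure_mono h2).trans ((measure_union_le _ _).trans ?_)
  gcongr
  exact hB.trans (ENNReal.ofReal_le_ofReal (by linarith))

/-- If both total weights exceed `h² / 4 + 3h`, the average is stable and the Gaussian mechanism
applies to weight and average jointly. Otherwise, as the weights differ by at most `3h`, both are at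
most `h² / 4 + 6h`. By the choice of `coarseThreshold`, both outputs are then `0` outside an event
of probability `δ / 2`. -/
theorem gaussPi_coarseVal_le {A : Finset (Fin n)} (hA : A.Nonempty) {r ε δ : ℝ} (hr : 0 < r)
    (hε : 0 < ε) (hε1 : ε ≤ 1) (hδ : 0 < δ) (hδ1 : δ ≤ 1) {Y Y' : Fin n → Vec d} {i₀ : Fin n}
    (hY : ∀ i, i ≠ i₀ → Y i = Y' i) {S : Set (Vec d)} (hS : MeasurableSet S) :
    gaussPi (Fin (d + 1)) {x | coarseVal A ((2 * r) ^ 2) (coarseThreshold A.card ε δ)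
        (3 * A.card * noiseMult ε δ) (112 * (r / A.card) * noiseMult ε δ) Y x ∈ S} ≤
      ENNReal.ofReal (Real.exp ε) * gaussPi (Fin (d + 1)) {x | coarseVal A ((2 * r) ^ 2)
        (coarseThreshold A.card ε δ) (3 * A.card * noiseMult ε δ)
        (112 * (r / A.card) * noiseMult ε δ) Y' x ∈ S} + ENNReal.ofReal δ := by
  set s := noiseMult ε δ with hs
  have hs0 : 0 < s := noiseMult_pos hε
  set h : ℝ := (A.card : ℝ) with hh
  have hh0 : 0 < h := by rw [hh]; exact_mod_cast hA.card_pos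
  set τ := (2 * r) ^ 2 with hτ
  set t := coarseThreshold h ε δ with ht
  set σ₁ := 3 * h * s with hσ₁
  set σ₂ := 112 * (r / h) * s with hσ₂
  have hσ₁0 : 0 < σ₁ := by positivity
  have hσ₂0 : 0 < σ₂ := by positivity
  have hYs : ∀ i, i ≠ i₀ → Y' i = Y i := fun i hi => (hY i hi).symm
  set W : ℝ := (totalWeight A τ Y : ℝ) with hW
  set W' : ℝ := (totalWeight A τ Y' : ℝ) with hW'
  have hWW1 : W ≤ W' + 3 * h := by
    rw [hW, hW', hh]; exact_mod_cast totalWeight_le_add (A := A) (τ := τ) hY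
  have hWW2 : W' ≤ W + 3 * h := by
    rw [hW, hW', hh]; exact_mod_cast totalWeight_le_add (A := A) (τ := τ) hYs
  by_cases hcase : h ^ 2 / 4 + 3 * h < W ∧ h ^ 2 / 4 + 3 * h < W'
  · obtain ⟨h1, h2⟩ := hcase
    -- After division by `σ₁` and `σ₂` the data only shift a standard Gaussian vector, and the test
    -- and the release become post-processing that is the same for both datasets.
    let post : (Fin (d + 1) → ℝ) → Vec d := fun y =>
      if t < σ₁ * y 0 then σ₂ • WithLp.toLp 2 fun c : Fin d => y c.succ else 0
    have hpost : Measurable post := by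
      refine Measurable.ite (measurableSet_lt measurable_const (by fun_prop)) ?_ measurable_const
      fun_prop
    let a : (Fin n → Vec d) → Fin (d + 1) → ℝ := fun Z =>
      Fin.cons ((totalWeight A τ Z : ℝ) / σ₁) fun c => (stableCenter A τ Z) c / σ₂
    have heq : ∀ Z x, coarseVal A τ t σ₁ σ₂ Z x = post (a Z + x) := fun Z x => by
      have e1 : σ₁ * (a Z + x) 0 = totalWeight A τ Z + σ₁ * x 0 := by
        simp only [a, Pi.add_apply, Fin.cons_zero]; field_simp
      have e2 : (σ₂ • WithLp.toLp 2 fun c : Fin d => (a Z + x) c.succ : Vec d) =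
          stableCenter A τ Z + σ₂ • WithLp.toLp 2 fun c : Fin d => x c.succ := by
        ext c
        simp only [a, Pi.add_apply, Fin.cons_succ, PiLp.smul_apply, PiLp.add_apply, smul_eq_mul]
        field_simp
      simp only [coarseVal, post, e1, e2]
    have hD : 3 * A.card < totalWeight A τ Y := by
      have : 3 * h < W := by nlinarith
      rw [hW, hh] at this
      exact_mod_cast this
    have hD' : 0 < totalWeight A τ Y' := by
      have : 0 < W' := by nlinarith
      rw [hW'] at this
      exact_mod_cast this
    -- The stability bound `28 h r / W` with `W > h² / 4` gives `112 = 4 * 28`.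
    have hcen : ‖stableCenter A τ Y - stableCenter A τ Y'‖ ≤ 112 * (r / h) := by
      refine (norm_stableCenter_sub_stableCenter_le hr.le hY hD hD').trans ?_
      rw [← hh, ← hτ, ← hW]
      have hW0 : 0 < W := by nlinarith
      rw [mul_div_assoc', div_le_div_iff₀ hW0 hh0]
      nlinarith [mul_pos hr hh0]
    have hsum : ∑ i, (a Y i - a Y' i) ^ 2 ≤ 2 / s ^ 2 := by
      rw [Fin.sum_univ_succ]
      simp only [a, Fin.cons_zero, Fin.cons_succ]
      have e1 : (W / σ₁ - W' / σ₁) ^ 2 ≤ 1 / s ^ 2 := by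
        rw [← sub_div, div_pow, div_le_div_iff₀ (by positivity) (by positivity), one_mul]
        have : (W - W') ^ 2 ≤ (3 * h) ^ 2 := sq_le_sq' (by linarith) (by linarith)
        calc _ ≤ (3 * h) ^ 2 * s ^ 2 := by gcongr
          _ = _ := by rw [hσ₁]; ring
      have e2 : ∑ c, (stableCenter A τ Y c / σ₂ - stableCenter A τ Y' c / σ₂) ^ 2 ≤ 1 / s ^ 2 := by
        simp_rw [← sub_div, div_pow]
        rw [← Finset.sum_div]
        have : ∑ c, (stableCenter A τ Y c - stableCenter A τ Y' c) ^ 2 =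
            ‖stableCenter A τ Y - stableCenter A τ Y'‖ ^ 2 := by
          rw [EuclideanSpace.real_norm_sq_eq]; rfl
        rw [this, div_le_div_iff₀ (by positivity) (by positivity), one_mul]
        calc _ ≤ (112 * (r / h)) ^ 2 * s ^ 2 := by gcongr
          _ = _ := by rw [hσ₂]; ring
      calc _ ≤ 1 / s ^ 2 + 1 / s ^ 2 := add_le_add e1 e2
        _ = _ := by ring
    simp only [heq]
    exact gaussPi_shift_le_of_noiseMult hε hε1 hδ hδ1 hsum (hpost hS)
  · have hboth : W ≤ h ^ 2 / 4 + 6 * h ∧ W' ≤ h ^ 2 / 4 + 6 * h := by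
      by_cases h1 : h ^ 2 / 4 + 3 * h < W
      · have : ¬ h ^ 2 / 4 + 3 * h < W' := fun h2 => hcase ⟨h1, h2⟩
        constructor <;> linarith
      · constructor <;> linarith
    have hz : ∀ (Z : Fin n → Vec d), (totalWeight A τ Z : ℝ) ≤ h ^ 2 / 4 + 6 * h →
        ∀ x ∉ {x : Fin (d + 1) → ℝ | 2 * (1 + Real.sqrt (Real.log (2 / δ))) < x 0},
          coarseVal A τ t σ₁ σ₂ Z x = 0 := fun Z hZ x hx => by
      simp only [Set.mem_ofPred_eq, not_lt] at hx
      refine if_neg (not_lt.2 ?_)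
      rw [ht, coarseThreshold, ← hs, ← hσ₁]
      gcongr
    refine (measure_le_of_eq_zero_off (gaussPi_coord_tail hδ hδ1) hδ.le (hz Y hboth.1)
      (hz Y' hboth.2) S).trans ?_
    gcongr
    refine le_mul_of_one_le_left zero_le ?_
    rw [ENNReal.one_le_ofReal]
    exact Real.one_le_exp hε.le

end Coarse

/-! ### The clip-and-noise step -/

section Clip

variable {n m d : ℕ}

theorem norm_clip_sub_le {ρ : ℝ} (hρ : 0 ≤ ρ) (u x : Vec d) : ‖clip ρ u x - u‖ ≤ ρ := by
  unfold clip; split_ifs with h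
  · exact h
  · push Not at h
    have : 0 < ‖x - u‖ := hρ.trans_lt h
    rw [add_sub_cancel_left, norm_smul, norm_div, norm_norm, Real.norm_of_nonneg hρ,
      div_mul_cancel₀ _ this.ne']

/-- One summand changes, and both of its values lie in the ball of radius `ρ` around `u`. -/
theorem norm_clippedMean_sub_le {B : Finset (Fin n)} (hB : B.Nonempty) {ρ : ℝ} (hρ : 0 ≤ ρ)
    (u : Vec d) {X X' : Dataset n m d} {i₀ : Fin n} (hX : ∀ i, i ≠ i₀ → X i = X' i) :
    ‖clippedMean B ρ u X - clippedMean B ρ u X'‖ ≤ 2 * ρ / B.card := by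
  have hB0 : 0 < (B.card : ℝ) := by exact_mod_cast hB.card_pos
  unfold clippedMean
  rw [← smul_sub, norm_smul, norm_inv, Real.norm_of_nonneg hB0.le, inv_mul_le_iff₀ hB0,
    mul_div_cancel₀ _ hB0.ne', ← Finset.sum_sub_distrib]
  refine (norm_sum_le _ _).trans ?_
  calc _ ≤ ∑ i ∈ B, if i = i₀ then 2 * ρ else 0 := by
        refine Finset.sum_le_sum fun i _ => ?_
        split_ifs with hi
        · calc _ = ‖(clip ρ u ((m : ℝ)⁻¹ • ∑ j, X i j) - u) -
                (clip ρ u ((m : ℝ)⁻¹ • ∑ j, X' i j) - u)‖ := by congr 1; abel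
            _ ≤ ρ + ρ := (norm_sub_le _ _).trans
                (add_le_add (norm_clip_sub_le hρ u _) (norm_clip_sub_le hρ u _))
            _ = _ := by ring
        · rw [hX i hi]; simp
    _ ≤ 2 * ρ := by
        rw [Finset.sum_ite_eq']; split_ifs <;> linarith

/-- For equal datasets any person serves as `i₀`, so there must be one. -/
theorem exists_forall_ne_eq {n : ℕ} {β : Type*} (hn : 1 ≤ n) {X X' : Fin n → β}
    (h : {i | X i ≠ X' i}.ncard ≤ 1) : ∃ i₀, ∀ i, i ≠ i₀ → X i = X' i := by
  rcases Set.eq_empty_or_nonempty {i | X i ≠ X' i} with he | ⟨i₀, hi₀⟩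
  · refine ⟨⟨0, hn⟩, fun i _ => ?_⟩
    by_contra hc
    exact (Set.eq_empty_iff_forall_notMem.1 he i) hc
  · refine ⟨i₀, fun i hi => ?_⟩
    by_contra hc
    exact hi ((Set.ncard_le_one (Set.toFinite _)).1 h i hc i₀ hi₀)

/-- In units of the noise level the step is a shift of a standard Gaussian vector, the form treated
by `gaussPi_shift_le`. -/
theorem clipAndNoise_apply {B : Finset (Fin n)} {ρ σ : ℝ} (hσ : σ ≠ 0) (u : Vec d)
    (X : Dataset n m d) {S : Set (Vec d)} (hS : MeasurableSet S) :
    clipAndNoise B ρ σ u X S = gaussPi (Fin d)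
      {x | (fun c => clippedMean B ρ u X c / σ) + x ∈
        {y : Fin d → ℝ | σ • (WithLp.toLp 2 y : Vec d) ∈ S}} := by
  unfold clipAndNoise
  rw [Measure.map_apply (by fun_prop) hS, ← map_pi_eq_stdGaussian, Measure.map_apply (by fun_prop)
    ((by fun_prop : Measurable fun g : Vec d => clippedMean B ρ u X + σ • g) hS)]
  change gaussPi (Fin d) _ = _
  congr 1
  ext x
  have : (σ • (WithLp.toLp 2 ((fun c => clippedMean B ρ u X c / σ) + x) : Vec d)) =
      clippedMean B ρ u X + σ • WithLp.toLp 2 x := by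
    ext c
    simp only [PiLp.smul_apply, PiLp.add_apply, Pi.add_apply, smul_eq_mul]
    field_simp
  simp only [Set.mem_preimage, Set.mem_ofPred_eq, this]

theorem personLevelDP_clipAndNoise (hn : 1 ≤ n) {B : Finset (Fin n)} (hB : B.Nonempty) {ρ ε δ : ℝ}
    (hρ : 0 < ρ) (hε : 0 < ε) (hε1 : ε ≤ 1) (hδ : 0 < δ) (hδ1 : δ ≤ 1) (u : Vec d) :
    PersonLevelDP (clipAndNoise (m := m) B ρ (noiseMult ε δ * (2 * ρ / B.card)) u) ε δ := by
  intro X X' hXX S hS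
  obtain ⟨i₀, hi₀⟩ := exists_forall_ne_eq hn hXX
  have hB0 : 0 < (B.card : ℝ) := by exact_mod_cast hB.card_pos
  have hs0 := noiseMult_pos (δ := δ) hε
  set σ := noiseMult ε δ * (2 * ρ / B.card) with hσ
  have hσ0 : 0 < σ := by positivity
  rw [clipAndNoise_apply hσ0.ne' u X hS, clipAndNoise_apply hσ0.ne' u X' hS]
  refine gaussPi_shift_le_of_noiseMult hε hε1 hδ hδ1 ?_
    ((by fun_prop : Measurable fun y : Fin d → ℝ => σ • (WithLp.toLp 2 y : Vec d)) hS)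
  simp_rw [← sub_div, div_pow]
  rw [← Finset.sum_div]
  have : ∑ c, (clippedMean B ρ u X c - clippedMean B ρ u X' c) ^ 2 =
      ‖clippedMean B ρ u X - clippedMean B ρ u X'‖ ^ 2 := by
    rw [EuclideanSpace.real_norm_sq_eq]; rfl
  rw [this, div_le_div_iff₀ (by positivity) (by positivity)]
  have h1 := norm_clippedMean_sub_le hB hρ.le u hi₀
  calc _ ≤ (2 * ρ / B.card) ^ 2 * noiseMult ε δ ^ 2 := by gcongr
    _ = 1 * σ ^ 2 := by rw [hσ]; ring
    _ ≤ _ := by gcongr; norm_num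

end Clip

/-! ### Moments of sample means -/

section Moments

theorem lintegral_norm_sq_add_le {E : Type*} [NormedAddCommGroup E] [InnerProductSpace ℝ E]
    [CompleteSpace E] [MeasurableSpace E] [BorelSpace E]
    {Ω : Type*} [MeasurableSpace Ω] {P : Measure Ω} [IsProbabilityMeasure P] {X : Ω → E}
    (hint : Integrable X P) (hmean : ∫ ω, X ω ∂P = 0)
    (h2i : Integrable (fun ω => ‖X ω‖ ^ 2) P) {v : ℝ} (h2 : ∫ ω, ‖X ω‖ ^ 2 ∂P ≤ v) (y : E) :
    ∫⁻ ω, ENNReal.ofReal (‖y + X ω‖ ^ 2) ∂P ≤ ENNReal.ofReal (‖y‖ ^ 2) + ENNReal.ofReal v := by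
  have hv : 0 ≤ v := (integral_nonneg fun ω => by positivity).trans h2
  have h1 : ∀ ω, ‖y + X ω‖ ^ 2 = ‖y‖ ^ 2 + (2 * inner ℝ y (X ω) + ‖X ω‖ ^ 2) := fun ω => by
    rw [norm_add_sq_real]; ring
  have hi2 : Integrable (fun ω => 2 * inner ℝ y (X ω)) P := (hint.const_inner y).const_mul 2
  have hi1 : Integrable (fun ω => 2 * inner ℝ y (X ω) + ‖X ω‖ ^ 2) P := hi2.add h2i
  have hi : Integrable (fun ω => ‖y + X ω‖ ^ 2) P := by
    simp_rw [h1]; exact (integrable_const _).add hi1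
  rw [← ofReal_integral_eq_lintegral_ofReal hi (.of_forall fun ω => by positivity),
    ← ENNReal.ofReal_add (by positivity) hv]
  refine ENNReal.ofReal_le_ofReal ?_
  simp_rw [h1]
  rw [integral_add (integrable_const _) hi1, integral_add hi2 h2i, integral_const_mul,
    integral_inner hint, hmean]
  simpa using h2

theorem lintegral_norm_sq_sum_le {E : Type*} [NormedAddCommGroup E] [InnerProductSpace ℝ E]
    [CompleteSpace E] [MeasurableSpace E] [BorelSpace E] [SecondCountableTopology E]
    {Ω ι : Type*} [MeasurableSpace Ω] {P : Measure Ω} [IsProbabilityMeasure P] {X : ι → Ω → E}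
    (hX : ∀ i, Measurable (X i)) (hind : iIndepFun X P)
    (hint : ∀ i, Integrable (X i) P) (hmean : ∀ i, ∫ ω, X i ω ∂P = 0)
    (h2i : ∀ i, Integrable (fun ω => ‖X i ω‖ ^ 2) P) {v : ℝ} (h2 : ∀ i, ∫ ω, ‖X i ω‖ ^ 2 ∂P ≤ v)
    (s : Finset ι) :
    ∫⁻ ω, ENNReal.ofReal (‖∑ i ∈ s, X i ω‖ ^ 2) ∂P ≤ ENNReal.ofReal (s.card * v) := by
  have := lintegral_comp_sum_le hX hind (f := fun y => ENNReal.ofReal (‖y‖ ^ 2)) (by fun_prop)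
    (a := 1) (b := ENNReal.ofReal v)
    (fun i y => by
      rw [one_mul]; exact lintegral_norm_sq_add_le (hint i) (hmean i) (h2i i) (h2 i) y) s
  refine this.trans (le_of_eq ?_)
  rw [ENNReal.ofReal_mul (Nat.cast_nonneg _)]
  simp [mul_comm]

variable {d : ℕ} {D : Measure (Vec d)} {k : ℝ}

theorem eLpNorm_coord_le (hk : kthMoment k D ≤ 1) (c : Fin d) :
    eLpNorm (fun x => (x - ∫ y, y ∂D) c) (ENNReal.ofReal k) D ≤ 1 := by
  have h1 : (EuclideanSpace.single c (1 : ℝ)) ∈ Metric.sphere (0 : Vec d) 1 := by simp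
  have h2 := (le_iSup₂ (f := fun (v : Vec d) (_ : v ∈ Metric.sphere (0 : Vec d) 1) =>
    eLpNorm (fun x => (inner ℝ (x - ∫ y, y ∂D) v : ℝ)) (ENNReal.ofReal k) D)
    (EuclideanSpace.single c (1 : ℝ)) h1).trans hk
  simpa [EuclideanSpace.inner_single_right] using h2

variable [IsProbabilityMeasure D]

/-- The power mean inequality over the coordinates bounds `‖x‖ ^ p` by `d ^ (p / 2 - 1)` times the
sum of `p`-th powers. Each coordinate has `p`-th moment at most `1`, by testing the moment condition
on a basis vector and comparing exponents. -/
theorem lintegral_enorm_rpow_le (hk : kthMoment k D ≤ 1) {p : ℝ} (hp : 2 ≤ p) (hpk : p ≤ k) :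
    ∫⁻ x, ‖x - ∫ y, y ∂D‖ₑ ^ p ∂D ≤ (d : ℝ≥0∞) ^ (p / 2) := by
  set μ := ∫ y, y ∂D
  have hp0 : 0 < p := by linarith
  have hcoord : ∀ c : Fin d, ∫⁻ x, ‖(x - μ) c‖ₑ ^ p ∂D ≤ 1 := fun c => by
    have h1 : eLpNorm (fun x => (x - μ) c) (ENNReal.ofReal p) D ≤ 1 :=
      (eLpNorm_le_eLpNorm_of_exponent_le (ENNReal.ofReal_le_ofReal hpk)
        (by fun_prop)).trans (eLpNorm_coord_le hk c)
    rw [eLpNorm_eq_lintegral_rpow_enorm_toReal (by simpa using hp0) ENNReal.ofReal_ne_top,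
      ENNReal.toReal_ofReal hp0.le] at h1
    have h2 := ENNReal.rpow_le_rpow h1 hp0.le
    rwa [← ENNReal.rpow_mul, one_div_mul_cancel hp0.ne', ENNReal.rpow_one, ENNReal.one_rpow] at h2
  have hpt : ∀ x : Vec d, ‖x - μ‖ₑ ^ p ≤ (d : ℝ≥0∞) ^ (p / 2 - 1) * ∑ c, ‖(x - μ) c‖ₑ ^ p := by
    intro x
    have h1 : ‖x - μ‖ₑ ^ p = (∑ c, ‖(x - μ) c‖ₑ ^ (2 : ℝ)) ^ (p / 2) := by
      have h2 : ‖x - μ‖ₑ ^ (2 : ℝ) = ∑ c, ‖(x - μ) c‖ₑ ^ (2 : ℝ) := by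
        simp only [← ofReal_norm, ENNReal.ofReal_rpow_of_nonneg (norm_nonneg _) zero_le_two]
        rw [← ENNReal.ofReal_sum_of_nonneg fun _ _ => by positivity]
        congr 1
        simp only [Real.rpow_two]
        exact EuclideanSpace.norm_sq_eq _
      rw [← h2, ← ENNReal.rpow_mul]; congr 1; ring
    rw [h1]
    refine (ENNReal.rpow_sum_le_const_mul_sum_rpow _ _ (by linarith)).trans (le_of_eq ?_)
    simp only [Finset.card_univ, Fintype.card_fin, ← ENNReal.rpow_mul]
    congr 2; ext c; congr 1; ring
  rcases Nat.eq_zero_or_pos d with hd | hd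
  · subst hd
    have : ∀ x : Vec 0, ‖x - μ‖ₑ ^ p = 0 := fun x => by
      rw [Subsingleton.elim (x - μ) 0]; simp [hp0]
    simp [this]
  calc _ ≤ ∫⁻ x, (d : ℝ≥0∞) ^ (p / 2 - 1) * ∑ c, ‖(x - μ) c‖ₑ ^ p ∂D := lintegral_mono hpt
    _ = (d : ℝ≥0∞) ^ (p / 2 - 1) * ∑ c, ∫⁻ x, ‖(x - μ) c‖ₑ ^ p ∂D := by
        rw [lintegral_const_mul _ (by fun_prop), lintegral_finsetSum _ fun c _ => by fun_prop]
    _ ≤ (d : ℝ≥0∞) ^ (p / 2 - 1) * ∑ c : Fin d, 1 := by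
        gcongr with c _; exact hcoord c
    _ = (d : ℝ≥0∞) ^ (p / 2 - 1) * (d : ℝ≥0∞) ^ (1 : ℝ) := by simp
    _ = _ := by
        rw [← ENNReal.rpow_add _ _ (by exact_mod_cast hd.ne') (ENNReal.natCast_ne_top d)]
        congr 1; ring

theorem norm_rpow_moment (hk : kthMoment k D ≤ 1) {p : ℝ} (hp : 2 ≤ p) (hpk : p ≤ k) :
    Integrable (fun x => ‖x - ∫ y, y ∂D‖ ^ p) D ∧ ∫ x, ‖x - ∫ y, y ∂D‖ ^ p ∂D ≤ (d : ℝ) ^ (p / 2) := by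
  have h := lintegral_enorm_rpow_le hk hp hpk
  set μ := ∫ y, y ∂D
  have heq : ∀ x : Vec d, ‖x - μ‖ₑ ^ p = ENNReal.ofReal (‖x - μ‖ ^ p) := fun x => by
    rw [← ofReal_norm, ENNReal.ofReal_rpow_of_nonneg (norm_nonneg _) (by linarith)]
  simp_rw [heq] at h
  have hd : (d : ℝ≥0∞) ^ (p / 2) = ENNReal.ofReal ((d : ℝ) ^ (p / 2)) := by
    rw [← ENNReal.ofReal_natCast, ENNReal.ofReal_rpow_of_nonneg (by positivity) (by linarith)]
  rw [hd] at h
  have hm : AEStronglyMeasurable (fun x : Vec d => ‖x - μ‖ ^ p) D :=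
    Measurable.aestronglyMeasurable (by fun_prop)
  have hi : Integrable (fun x => ‖x - μ‖ ^ p) D := by
    refine ⟨hm, ?_⟩
    rw [hasFiniteIntegral_iff_ofReal (.of_forall fun x => by positivity)]
    exact h.trans_lt ENNReal.ofReal_lt_top
  refine ⟨hi, ?_⟩
  rw [← ofReal_integral_eq_lintegral_ofReal hi (.of_forall fun x => by positivity)] at h
  exact (ENNReal.ofReal_le_ofReal_iff (by positivity)).1 h

end Moments

/-! ### Moments and tails of the sample mean of one person -/

section SampleMean

variable {m d : ℕ} {D : Measure (Vec d)} [IsProbabilityMeasure D] {k : ℝ}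

/-- The mean of the samples of one person. -/
noncomputable def sampleMean (x : Fin m → Vec d) : Vec d := (m : ℝ)⁻¹ • ∑ j, x j

theorem measurable_sampleMean : Measurable (sampleMean : (Fin m → Vec d) → Vec d) := by
  unfold sampleMean; fun_prop

theorem sampleMean_sub (hm : 1 ≤ m) (x : Fin m → Vec d) (μ : Vec d) :
    sampleMean x - μ = (m : ℝ)⁻¹ • ∑ j, (x j - μ) := by
  have : (m : ℝ) ≠ 0 := by positivity
  rw [Finset.sum_sub_distrib, smul_sub, sampleMean, Finset.sum_const, Finset.card_univ,
    Fintype.card_fin, ← Nat.cast_smul_eq_nsmul ℝ, inv_smul_smul₀ this]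

theorem iIndepFun_pi_comp {ι Ω F : Type*} [Fintype ι] [MeasurableSpace Ω] [MeasurableSpace F]
    (ν : Measure Ω) [IsProbabilityMeasure ν] {φ : Ω → F} (hφ : Measurable φ) :
    iIndepFun (fun (i : ι) (x : ι → Ω) => φ (x i)) (Measure.pi fun _ => ν) :=
  iIndepFun_pi (μ := fun _ : ι => ν) (X := fun _ => φ) fun _ => hφ.aemeasurable

theorem integrable_pi_eval_comp {ι Ω F : Type*} [Fintype ι] [MeasurableSpace Ω]
    [NormedAddCommGroup F] {ν : Measure Ω} [IsProbabilityMeasure ν] {φ : Ω → F}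
    (hφ : Integrable φ ν) (i : ι) :
    Integrable (fun x : ι → Ω => φ (x i)) (Measure.pi fun _ => ν) :=
  (measurePreserving_eval (fun _ : ι => ν) i).integrable_comp_of_integrable hφ

theorem integral_pi_eval_comp {ι Ω F : Type*} [Fintype ι] [MeasurableSpace Ω]
    [NormedAddCommGroup F] [NormedSpace ℝ F] {ν : Measure Ω}
    [IsProbabilityMeasure ν] {φ : Ω → F} (hφ : AEStronglyMeasurable φ ν) (i : ι) :
    ∫ x : ι → Ω, φ (x i) ∂(Measure.pi fun _ => ν) = ∫ ω, φ ω ∂ν := by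
  have h := measurePreserving_eval (fun _ : ι => ν) i
  conv_rhs => rw [← h.map_eq]
  rw [integral_map h.aemeasurable (by rwa [h.map_eq])]

theorem integral_sub_mean_eq_zero (hint : Integrable (fun x => x) D) :
    ∫ x, (x - ∫ y, y ∂D) ∂D = 0 := by
  rw [integral_sub hint (integrable_const _)]; simp

/-- The second moment of the error of a sample mean. -/
theorem lintegral_norm_sampleMean_sq_le (hm : 1 ≤ m) (hint : Integrable (fun x => x) D)
    (hk2 : 2 < k) (hk : kthMoment k D ≤ 1) :
    ∫⁻ x, ENNReal.ofReal (‖sampleMean x - ∫ y, y ∂D‖ ^ 2) ∂(Measure.pi fun _ : Fin m => D) ≤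
      ENNReal.ofReal (d / m) := by
  have hm0 : (0 : ℝ) < m := by exact_mod_cast hm
  obtain ⟨hi2, h2⟩ := norm_rpow_moment hk le_rfl hk2.le
  simp only [Real.rpow_two, div_self (two_ne_zero' ℝ), Real.rpow_one] at hi2 h2
  have h := lintegral_norm_sq_sum_le (P := Measure.pi fun _ : Fin m => D)
    (X := fun j x => x j - ∫ y, y ∂D) (fun j => by fun_prop)
    (iIndepFun_pi_comp D (φ := fun x => x - ∫ y, y ∂D) (by fun_prop))
    (fun j => integrable_pi_eval_comp (φ := fun x => x - ∫ y, y ∂D)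
      (hint.sub (integrable_const _)) j)
    (fun j => (integral_pi_eval_comp (φ := fun x => x - ∫ y, y ∂D) (by fun_prop) j).trans
      (integral_sub_mean_eq_zero hint))
    (fun j => integrable_pi_eval_comp (φ := fun x => ‖x - ∫ y, y ∂D‖ ^ 2) hi2 j) (v := d)
    (fun j => (integral_pi_eval_comp (φ := fun x => ‖x - ∫ y, y ∂D‖ ^ 2) (by fun_prop) j).trans_le
      h2) Finset.univ
  have h1 : ∀ x : Fin m → Vec d, ENNReal.ofReal (‖sampleMean x - ∫ y, y ∂D‖ ^ 2) =
      ENNReal.ofReal ((m : ℝ)⁻¹ ^ 2) * ENNReal.ofReal (‖∑ j, (x j - ∫ y, y ∂D)‖ ^ 2) := fun x => by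
    rw [sampleMean_sub hm, norm_smul, mul_pow, ENNReal.ofReal_mul (by positivity), norm_inv,
      Real.norm_of_nonneg hm0.le]
  simp_rw [h1]
  rw [lintegral_const_mul _ (by fun_prop)]
  calc _ ≤ ENNReal.ofReal ((m : ℝ)⁻¹ ^ 2) * ENNReal.ofReal ((Finset.univ : Finset (Fin m)).card * d) := by
        gcongr
    _ = _ := by
        rw [← ENNReal.ofReal_mul (by positivity), Finset.card_univ, Fintype.card_fin]
        congr 1; field_simp

/-- The constant in the tail bound for sample means. -/
noncomputable def tailConst (k : ℝ) : ℝ := 2 * Real.exp (3 + (2 * k) ^ k) + 2 ^ (k - 1)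

theorem tailConst_pos (k : ℝ) : 0 < tailConst k := by unfold tailConst; positivity

/-- The expected excess of the error of a sample mean over a radius `ρ`. -/
theorem lintegral_norm_sampleMean_sub_le (hm : 1 ≤ m) (hd : 1 ≤ d)
    (hint : Integrable (fun x => x) D) (hk2 : 2 < k) (hk : kthMoment k D ≤ 1) {ρ : ℝ}
    (hρ : 16 * k ^ 2 * Real.sqrt (d / m) * Real.log (2 + m * d) ≤ ρ) :
    ∫⁻ x, ENNReal.ofReal (‖sampleMean x - ∫ y, y ∂D‖ - ρ) ∂(Measure.pi fun _ : Fin m => D) ≤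
      ENNReal.ofReal (tailConst k * ((d : ℝ) ^ (k / 2) / (m * ρ) ^ (k - 1))) := by
  have hm0 : (0 : ℝ) < m := by exact_mod_cast hm
  have hd0 : (0 : ℝ) < d := by exact_mod_cast hd
  have hd1 : (1 : ℝ) ≤ d := by exact_mod_cast hd
  have hm1 : (1 : ℝ) ≤ m := by exact_mod_cast hm
  set μ := ∫ y, y ∂D with hμ
  have hsd : 0 < Real.sqrt d := Real.sqrt_pos.2 hd0
  have hlog : 0 < Real.log (2 + m * d) := Real.log_pos (by nlinarith)
  have hρ0 : 0 < ρ := lt_of_lt_of_le (by positivity) hρ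
  obtain ⟨hi2, h2⟩ := norm_rpow_moment hk le_rfl hk2.le
  obtain ⟨hik, hkk⟩ := norm_rpow_moment hk hk2.le le_rfl
  simp only [Real.rpow_two, div_self (two_ne_zero' ℝ), Real.rpow_one] at hi2 h2
  rw [← hμ] at hi2 h2 hik hkk
  -- Division by `√d` makes both the second and the `k`-th moment of the norm at most `1`; the
  -- radius `ρ` for the mean becomes the level `t = m ρ / √d` for the sum.
  set φ : Vec d → Vec d := fun x => (Real.sqrt d)⁻¹ • (x - μ) with hφ
  have hφm : Measurable φ := by fun_prop
  have hφn : ∀ x, ‖φ x‖ = (Real.sqrt d)⁻¹ * ‖x - μ‖ := fun x => by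
    rw [hφ, norm_smul, norm_inv, Real.norm_of_nonneg hsd.le]
  have hφ2 : ∀ x, ‖φ x‖ ^ 2 = (d : ℝ)⁻¹ * ‖x - μ‖ ^ 2 := fun x => by
    rw [hφn, mul_pow, inv_pow, Real.sq_sqrt hd0.le]
  have hφk : ∀ x, ‖φ x‖ ^ k = ((d : ℝ) ^ (k / 2))⁻¹ * ‖x - μ‖ ^ k := fun x => by
    rw [hφn, Real.mul_rpow (by positivity) (norm_nonneg _), Real.inv_rpow hsd.le,
      Real.sqrt_eq_rpow, ← Real.rpow_mul hd0.le]
    congr 3; ring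
  have hi2' : Integrable (fun x => ‖φ x‖ ^ 2) D := by simp_rw [hφ2]; exact hi2.const_mul _
  have hik' : Integrable (fun x => ‖φ x‖ ^ k) D := by simp_rw [hφk]; exact hik.const_mul _
  have h2' : ∫ x, ‖φ x‖ ^ 2 ∂D ≤ 1 := by
    simp_rw [hφ2]
    rw [integral_const_mul, inv_mul_le_iff₀ hd0, mul_one]; exact h2
  have hk' : ∫ x, ‖φ x‖ ^ k ∂D ≤ 1 := by
    simp_rw [hφk]
    rw [integral_const_mul, inv_mul_le_iff₀ (by positivity), mul_one]; exact hkk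
  have hφi : Integrable φ D := (hint.sub (integrable_const μ)).smul (Real.sqrt d)⁻¹
  have hφ0 : ∫ x, φ x ∂D = 0 := by
    rw [hφ, integral_smul, integral_sub_mean_eq_zero hint, smul_zero]
  set t := m * ρ / Real.sqrt d with ht
  have h := lintegral_norm_sum_sub_le (P := Measure.pi fun _ : Fin m => D)
    (Z := fun j x => φ (x j)) (fun j => by fun_prop) (iIndepFun_pi_comp D hφm)
    (fun j => integrable_pi_eval_comp hφi j)
    (fun j => (integral_pi_eval_comp (by fun_prop) j).trans hφ0) hk2
    (fun j => integrable_pi_eval_comp hi2' j)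
    (fun j => (integral_pi_eval_comp (φ := fun x => ‖φ x‖ ^ 2) (by fun_prop) j).trans_le h2')
    (fun j => integrable_pi_eval_comp hik' j)
    (fun j => (integral_pi_eval_comp (φ := fun x => ‖φ x‖ ^ k)
      (Measurable.aestronglyMeasurable (by fun_prop)) j).trans_le hk')
    Finset.univ ⟨⟨0, hm⟩, Finset.mem_univ _⟩ (t := t) (by
      rw [Finset.card_univ, Fintype.card_fin, ht, le_div_iff₀ hsd]
      have e1 : Real.log (2 + m) ≤ Real.log (2 + m * d) :=
        Real.log_le_log (by linarith) (by nlinarith)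
      have e2 : Real.sqrt m * Real.sqrt d = m * Real.sqrt (d / m) := by
        rw [Real.sqrt_div hd0.le]
        field_simp
        rw [Real.sq_sqrt hm0.le]
      calc 16 * k ^ 2 * Real.sqrt m * Real.log (2 + m) * Real.sqrt d
          = 16 * k ^ 2 * (Real.sqrt m * Real.sqrt d) * Real.log (2 + m) := by ring
        _ ≤ 16 * k ^ 2 * (Real.sqrt m * Real.sqrt d) * Real.log (2 + m * d) := by gcongr
        _ = m * (16 * k ^ 2 * Real.sqrt (d / m) * Real.log (2 + m * d)) := by rw [e2]; ring
        _ ≤ m * ρ := by gcongr)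
  rw [Finset.card_univ, Fintype.card_fin] at h
  have hpt : ∀ x : Fin m → Vec d, ENNReal.ofReal (‖sampleMean x - μ‖ - ρ) =
      ENNReal.ofReal (Real.sqrt d / m) * ENNReal.ofReal (‖∑ j, φ (x j)‖ - t) := fun x => by
    rw [← ENNReal.ofReal_mul (by positivity), sampleMean_sub hm, hφ]
    congr 1
    simp only [← Finset.smul_sum, norm_smul, norm_inv, Real.norm_of_nonneg hm0.le,
      Real.norm_of_nonneg hsd.le]
    rw [ht]; field_simp
  simp_rw [hpt]
  rw [lintegral_const_mul _ (by fun_prop)]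
  refine (mul_le_mul_right h _).trans ?_
  rw [← ENNReal.ofReal_mul (by positivity)]
  refine ENNReal.ofReal_le_ofReal (le_of_eq ?_)
  have e3 : (d : ℝ) ^ (k / 2) = Real.sqrt d * Real.sqrt d ^ (k - 1) := by
    rw [Real.sqrt_eq_rpow, ← Real.rpow_mul hd0.le, ← Real.rpow_add hd0]; congr 1; ring
  rw [ht, Real.div_rpow (by positivity) hsd.le, e3, tailConst]
  have : (m * ρ) ^ (k - 1) ≠ 0 := by positivity
  have : Real.sqrt d ^ (k - 1) ≠ 0 := by positivity
  field_simp

end SampleMean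

/-! ### Accuracy of the two stages -/

section NoiseMoments

theorem lintegral_sq_gaussPi_coord {ι : Type*} [Fintype ι] (i : ι) :
    ∫⁻ x, ENNReal.ofReal (x i ^ 2) ∂(gaussPi ι) = 1 := by
  have h1 : ∫⁻ x, ENNReal.ofReal (x ^ 2) ∂(gaussianReal 0 1) = 1 := by
    have hm : MemLp id 2 (gaussianReal 0 1) := memLp_id_gaussianReal' 2 (by simp)
    have hi : Integrable (fun x : ℝ => x ^ 2) (gaussianReal 0 1) := hm.integrable_sq
    rw [← ofReal_integral_eq_lintegral_ofReal hi (.of_forall fun x => sq_nonneg x)]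
    have hv := variance_id_gaussianReal (μ := 0) (v := 1)
    rw [variance_eq_sub hm] at hv
    simp only [id_eq, Pi.pow_apply, integral_id_gaussianReal, NNReal.coe_one] at hv
    have : ∫ x : ℝ, x ^ 2 ∂(gaussianReal 0 1) = 1 := by linarith
    rw [this, ENNReal.ofReal_one]
  rw [← h1]
  exact (measurePreserving_eval (fun _ : ι => gaussianReal 0 1) i).lintegral_comp
    (f := fun y => ENNReal.ofReal (y ^ 2)) (by fun_prop)

theorem lintegral_sum_sq_gaussPi {ι κ : Type*} [Fintype ι] [Fintype κ] (e : κ → ι) :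
    ∫⁻ x, ENNReal.ofReal (∑ c, x (e c) ^ 2) ∂(gaussPi ι) = Fintype.card κ := by
  simp_rw [ENNReal.ofReal_sum_of_nonneg fun c _ => sq_nonneg _]
  rw [lintegral_finsetSum _ fun c _ => by fun_prop]
  simp [lintegral_sq_gaussPi_coord]

/-- Chebyshev's inequality for a block of coordinates. -/
theorem gaussPi_sum_sq_ge_le {ι κ : Type*} [Fintype ι] [Fintype κ] (e : κ → ι) {b : ℝ}
    (hb : 0 < b) :
    gaussPi ι {x | b ≤ ∑ c, x (e c) ^ 2} ≤ ENNReal.ofReal (Fintype.card κ / b) := by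
  have hsub : {x : ι → ℝ | b ≤ ∑ c, x (e c) ^ 2} ⊆
      {x | ENNReal.ofReal b ≤ ENNReal.ofReal (∑ c, x (e c) ^ 2)} := fun x hx =>
    ENNReal.ofReal_le_ofReal hx
  refine (measure_mono hsub).trans ((meas_ge_le_lintegral_div
    (Measurable.aemeasurable (by fun_prop)) (by simpa using hb) ENNReal.ofReal_ne_top).trans ?_)
  rw [lintegral_sum_sq_gaussPi, ENNReal.ofReal_div_of_pos hb, ENNReal.ofReal_natCast]

theorem stdGaussian_norm_smul_ge_le {d : ℕ} {σ β : ℝ} (hσ : 0 < σ) (hβ : 0 < β) :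
    stdGaussian (Vec d) {g | β ≤ ‖σ • g‖} ≤ ENNReal.ofReal (σ ^ 2 * d / β ^ 2) := by
  rw [← map_pi_eq_stdGaussian, Measure.map_apply (by fun_prop)
    (measurableSet_le measurable_const (by fun_prop))]
  have hsub : (WithLp.toLp 2 : (Fin d → ℝ) → Vec d) ⁻¹' {g | β ≤ ‖σ • g‖} ⊆
      {x | (β / σ) ^ 2 ≤ ∑ c, x (id c) ^ 2} := fun x hx => by
    simp only [Set.mem_preimage, Set.mem_ofPred_eq, norm_smul, Real.norm_of_nonneg hσ.le] at hx
    have h1 : β / σ ≤ ‖(WithLp.toLp 2 x : Vec d)‖ := by rw [div_le_iff₀ hσ]; linarith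
    have h2 : (β / σ) ^ 2 ≤ ‖(WithLp.toLp 2 x : Vec d)‖ ^ 2 := by gcongr
    rwa [EuclideanSpace.real_norm_sq_eq] at h2
  refine (measure_mono hsub).trans ((gaussPi_sum_sq_ge_le id (by positivity)).trans (le_of_eq ?_))
  rw [Fintype.card_fin]
  congr 1
  field_simp

end NoiseMoments

/-! ### Bias and contraction of clipping -/

section ClipAccuracy

variable {n m d : ℕ}

theorem norm_clip_sub_self_le (ρ : ℝ) (hρ : 0 ≤ ρ) (u x : Vec d) :
    ‖clip ρ u x - x‖ ≤ max (‖x - u‖ - ρ) 0 := by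
  unfold clip; split_ifs with h
  · simp
  · push Not at h
    have h0 : 0 < ‖x - u‖ := hρ.trans_lt h
    have : u + (ρ / ‖x - u‖) • (x - u) - x = (ρ / ‖x - u‖ - 1) • (x - u) := by
      rw [sub_smul, one_smul]; abel
    refine le_max_of_le_left ?_
    have h2 : ρ / ‖x - u‖ - 1 ≤ 0 := by
      rw [sub_nonpos, div_le_one h0]; exact h.le
    rw [this, norm_smul, Real.norm_of_nonpos h2, neg_mul, sub_mul, div_mul_cancel₀ _ h0.ne']
    linarith

/-- Clipping is the projection onto a ball containing `μ`, so it brings points no farther from `μ`.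
Mean squared errors about `μ` thus survive clipping. -/
theorem norm_clip_sub_le_norm_sub {ρ : ℝ} (hρ : 0 ≤ ρ) {u μ : Vec d} (hu : ‖μ - u‖ ≤ ρ)
    (x : Vec d) : ‖clip ρ u x - μ‖ ≤ ‖x - μ‖ := by
  unfold clip; split_ifs with h
  · exact le_rfl
  · push Not at h
    have h0 : 0 < ‖x - u‖ := hρ.trans_lt h
    set w := x - u with hw
    set v := μ - u with hv
    have e1 : u + (ρ / ‖w‖) • w - μ = (ρ / ‖w‖) • w - v := by rw [hv]; abel
    have e2 : x - μ = w - v := by rw [hv, hw]; abel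
    rw [e1, e2]
    refine (sq_le_sq₀ (norm_nonneg _) (norm_nonneg _)).1 ?_
    set c := ρ / ‖w‖ with hc
    have hc1 : c ≤ 1 := by rw [hc, div_le_one h0]; exact h.le
    have hc0 : 0 ≤ c := by positivity
    have hcw : c * ‖w‖ = ρ := by rw [hc]; field_simp
    have hin : inner ℝ w v ≤ ‖w‖ * ρ := (real_inner_le_norm w v).trans (by gcongr)
    rw [norm_sub_sq_real (c • w) v, norm_sub_sq_real w v, real_inner_smul_left, norm_smul,
      Real.norm_of_nonneg hc0, hcw]
    -- Apart from twice this product, the difference of the two squared norms is `(‖w‖ - ρ) ^ 2`.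
    have h3 : 0 ≤ (1 - c) * (‖w‖ * ρ - inner ℝ w v) :=
      mul_nonneg (by linarith) (by linarith)
    nlinarith

theorem measurable_clip_comp {Ω : Type*} [MeasurableSpace Ω] {ρ : ℝ} {f g : Ω → Vec d}
    (hf : Measurable f) (hg : Measurable g) : Measurable fun ω => clip ρ (f ω) (g ω) := by
  unfold clip
  exact Measurable.ite (measurableSet_le (by fun_prop) measurable_const) (by fun_prop)
    (by fun_prop)

theorem clippedMean_eq (B : Finset (Fin n)) (ρ : ℝ) (u : Vec d) (X : Dataset n m d) :
    clippedMean B ρ u X = (B.card : ℝ)⁻¹ • ∑ i ∈ B, clip ρ u (sampleMean (X i)) := rfl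

variable {D : Measure (Vec d)} [IsProbabilityMeasure D] {k : ℝ}

instance : IsProbabilityMeasure (dataLaw n m D) := by unfold dataLaw; infer_instance

theorem integrable_clip_sampleMean {ρ : ℝ} (hρ : 0 ≤ ρ) (u : Vec d) :
    Integrable (fun x : Fin m → Vec d => clip ρ u (sampleMean x)) (Measure.pi fun _ => D) := by
  refine Integrable.of_bound (C := ‖u‖ + ρ)
    (measurable_clip_comp measurable_const measurable_sampleMean).aestronglyMeasurable
    (.of_forall fun x => ?_)
  calc _ = ‖u + (clip ρ u (sampleMean x) - u)‖ := by congr 1; abel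
    _ ≤ _ := (norm_add_le _ _).trans (by gcongr; exact norm_clip_sub_le hρ u _)

theorem integrable_sampleMean (hint : Integrable (fun x => x) D) :
    Integrable (fun x : Fin m → Vec d => sampleMean x) (Measure.pi fun _ => D) := by
  unfold sampleMean
  exact (integrable_finsetSum _ fun j _ => integrable_pi_eval_comp hint j).smul (m : ℝ)⁻¹

theorem integral_sampleMean (hm : 1 ≤ m) (hint : Integrable (fun x => x) D) :
    ∫ x : Fin m → Vec d, sampleMean x ∂(Measure.pi fun _ => D) = ∫ y, y ∂D := by
  unfold sampleMean
  have h0 : (m : ℝ) ≠ 0 := by positivity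
  rw [integral_smul, integral_finsetSum _ fun j _ => integrable_pi_eval_comp hint j]
  simp_rw [integral_pi_eval_comp (φ := fun x : Vec d => x) hint.aestronglyMeasurable]
  rw [Finset.sum_const, Finset.card_univ, Fintype.card_fin, ← Nat.cast_smul_eq_nsmul ℝ,
    inv_smul_smul₀ h0]

/-- The bias of the clipped sample mean. -/
theorem norm_integral_clip_sub_le (hm : 1 ≤ m) (hd : 1 ≤ d)
    (hint : Integrable (fun x => x) D) (hk2 : 2 < k) (hk : kthMoment k D ≤ 1) {ρ : ℝ} (hρ0 : 0 ≤ ρ)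
    (hρ : 16 * k ^ 2 * Real.sqrt (d / m) * Real.log (2 + m * d) ≤ ρ / 2) {u : Vec d}
    (hu : ‖u - ∫ y, y ∂D‖ ≤ ρ / 2) :
    ‖∫ x : Fin m → Vec d, clip ρ u (sampleMean x) ∂(Measure.pi fun _ => D) - ∫ y, y ∂D‖ ≤
      tailConst k * ((d : ℝ) ^ (k / 2) / (m * (ρ / 2)) ^ (k - 1)) := by
  set ν : Measure (Fin m → Vec d) := Measure.pi fun _ => D
  have h := lintegral_norm_sampleMean_sub_le hm hd hint hk2 hk hρ
  set μ := ∫ y, y ∂D with hμ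
  have hK := tailConst_pos k
  have h1 : ∫ x, clip ρ u (sampleMean x) ∂ν - μ =
      ∫ x, (clip ρ u (sampleMean x) - sampleMean x) ∂ν := by
    rw [integral_sub (integrable_clip_sampleMean hρ0 u) (integrable_sampleMean hint),
      integral_sampleMean hm hint]
  have h2 : ‖∫ x, clip ρ u (sampleMean x) ∂ν - μ‖ₑ ≤
      ENNReal.ofReal (tailConst k * ((d : ℝ) ^ (k / 2) / (m * (ρ / 2)) ^ (k - 1))) := by
    rw [h1]
    refine (enorm_integral_le_lintegral_enorm _).trans (le_trans (lintegral_mono fun x => ?_) h)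
    have h3 : ∀ a : ℝ, ENNReal.ofReal (max a 0) = ENNReal.ofReal a := fun a => by
      rw [ENNReal.ofReal_max, ENNReal.ofReal_zero, max_eq_left zero_le]
    rw [← ofReal_norm, ← h3 (‖sampleMean x - μ‖ - ρ / 2)]
    refine ENNReal.ofReal_le_ofReal ((norm_clip_sub_self_le ρ hρ0 u _).trans ?_)
    refine max_le_max ?_ le_rfl
    -- Half of the radius absorbs the offset of `u` from `μ`; the other half remains for the tail
    -- bound.
    have := norm_sub_le_norm_sub_add_norm_sub (sampleMean x) μ u
    rw [norm_sub_rev μ u] at this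
    linarith
  rw [← ofReal_norm] at h2
  exact (ENNReal.ofReal_le_ofReal_iff (by positivity)).1 h2

end ClipAccuracy

/-! ### Failure probabilities of the coarse and the final stage -/

section StageAccuracy

variable {n m d : ℕ} {D : Measure (Vec d)} [IsProbabilityMeasure D] {k : ℝ}

/-- Chebyshev's inequality for an average over people of independent copies of a random vector. -/
theorem dataLaw_average_ge_le {φ : (Fin m → Vec d) → Vec d} (hφm : Measurable φ)
    (hφ : Integrable φ (Measure.pi fun _ => D)) {v β : ℝ}
    {c : Vec d} (hc : ∫⁻ x, ENNReal.ofReal (‖φ x - c‖ ^ 2) ∂(Measure.pi fun _ => D) ≤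
      ENNReal.ofReal v) (hv : 0 ≤ v)
    (hβ : 0 < β) {B : Finset (Fin n)} (hB : B.Nonempty) :
    dataLaw n m D {X | β ≤ ‖(B.card : ℝ)⁻¹ • ∑ i ∈ B, φ (X i) -
      ∫ x, φ x ∂(Measure.pi fun _ => D)‖} ≤ ENNReal.ofReal (v / (B.card * β ^ 2)) := by
  have hB0 : 0 < (B.card : ℝ) := by exact_mod_cast hB.card_pos
  set ν : Measure (Fin m → Vec d) := Measure.pi fun _ => D with hν
  set b := ∫ x, φ x ∂ν with hb
  have hci : Integrable (fun x => ‖φ x - c‖ ^ 2) ν := by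
    refine ⟨Measurable.aestronglyMeasurable (by fun_prop), ?_⟩
    rw [hasFiniteIntegral_iff_ofReal (.of_forall fun x => by positivity)]
    exact hc.trans_lt ENNReal.ofReal_lt_top
  have hcv : ∫ x, ‖φ x - c‖ ^ 2 ∂ν ≤ v := by
    rw [← ofReal_integral_eq_lintegral_ofReal hci (.of_forall fun x => by positivity)] at hc
    exact (ENNReal.ofReal_le_ofReal_iff hv).1 hc
  have h0i : Integrable (fun x => φ x - b) ν := hφ.sub (integrable_const b)
  have h0 : ∫ x, (φ x - b) ∂ν = 0 := by
    rw [integral_sub hφ (integrable_const _)]; simp [hb]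
  -- The second moment about the expectation `b` is the smallest, so a bound about any `c` suffices.
  -- It is applied with `c = μ`, although the clipped mean is biased.
  have hexp : ∀ x, ‖φ x - b‖ ^ 2 = ‖φ x - c‖ ^ 2 - (2 * inner ℝ (b - c) (φ x - b) + ‖b - c‖ ^ 2) :=
    fun x => by
      have : φ x - c = (b - c) + (φ x - b) := by abel
      rw [this, norm_add_sq_real]; ring
  have hini : Integrable (fun x => 2 * inner ℝ (b - c) (φ x - b)) ν :=
    (h0i.const_inner (b - c)).const_mul 2
  have hini2 : Integrable (fun x => 2 * inner ℝ (b - c) (φ x - b) + ‖b - c‖ ^ 2) ν :=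
    hini.add (integrable_const _)
  have hbi : Integrable (fun x => ‖φ x - b‖ ^ 2) ν := by
    simp_rw [hexp]; exact hci.sub hini2
  have hbv : ∫ x, ‖φ x - b‖ ^ 2 ∂ν ≤ v := by
    simp_rw [hexp]
    rw [integral_sub hci hini2, integral_add hini (integrable_const _), integral_const_mul,
      integral_inner h0i, h0]
    simp only [inner_zero_right, mul_zero, zero_add, integral_const, probReal_univ, one_smul]
    nlinarith [sq_nonneg ‖b - c‖]
  have h := lintegral_norm_sq_sum_le (P := dataLaw n m D) (X := fun i X => φ (X i) - b)
    (fun i => by fun_prop) (iIndepFun_pi_comp ν (φ := fun x => φ x - b) (by fun_prop))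
    (fun i => integrable_pi_eval_comp h0i i)
    (fun i => (integral_pi_eval_comp (φ := fun x => φ x - b) h0i.aestronglyMeasurable i).trans h0)
    (fun i => integrable_pi_eval_comp hbi i)
    (fun i => (integral_pi_eval_comp (φ := fun x => ‖φ x - b‖ ^ 2)
      hbi.aestronglyMeasurable i).trans_le hbv) B
  have hsub : {X : Dataset n m d | β ≤ ‖(B.card : ℝ)⁻¹ • ∑ i ∈ B, φ (X i) - b‖} ⊆
      {X | ENNReal.ofReal ((B.card * β) ^ 2) ≤ ENNReal.ofReal (‖∑ i ∈ B, (φ (X i) - b)‖ ^ 2)} := by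
    intro X hX
    refine ENNReal.ofReal_le_ofReal ?_
    have e1 : (B.card : ℝ)⁻¹ • ∑ i ∈ B, φ (X i) - b = (B.card : ℝ)⁻¹ • ∑ i ∈ B, (φ (X i) - b) := by
      rw [Finset.sum_sub_distrib, smul_sub, Finset.sum_const, ← Nat.cast_smul_eq_nsmul ℝ,
        inv_smul_smul₀ hB0.ne']
    have hX' : β ≤ ‖(B.card : ℝ)⁻¹ • ∑ i ∈ B, φ (X i) - b‖ := hX
    rw [e1, norm_smul, norm_inv, Real.norm_of_nonneg hB0.le, le_inv_mul_iff₀ hB0] at hX'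
    gcongr
  have hpos : 0 < (B.card * β) ^ 2 := by positivity
  refine (measure_mono hsub).trans ((meas_ge_le_lintegral_div
    (Measurable.aemeasurable (by fun_prop)) (by simpa using hpos.ne') ENNReal.ofReal_ne_top).trans ?_)
  refine (ENNReal.div_le_div_right h _).trans ?_
  rw [← ENNReal.ofReal_div_of_pos hpos]
  refine ENNReal.ofReal_le_ofReal (le_of_eq ?_)
  field_simp

theorem lintegral_norm_clip_sampleMean_sq_le (hm : 1 ≤ m) (hint : Integrable (fun x => x) D)
    (hk2 : 2 < k) (hk : kthMoment k D ≤ 1) {ρ : ℝ} (hρ : 0 ≤ ρ) {u : Vec d}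
    (hu : ‖u - ∫ y, y ∂D‖ ≤ ρ) :
    ∫⁻ x, ENNReal.ofReal (‖clip ρ u (sampleMean x) - ∫ y, y ∂D‖ ^ 2)
      ∂(Measure.pi fun _ : Fin m => D) ≤ ENNReal.ofReal (d / m) := by
  refine le_trans (lintegral_mono fun x => ENNReal.ofReal_le_ofReal ?_)
    (lintegral_norm_sampleMean_sq_le hm hint hk2 hk)
  gcongr
  exact norm_clip_sub_le_norm_sub hρ (by rwa [norm_sub_rev]) _

/-- Failure probability of the clip-and-noise step around a good coarse estimate. -/
theorem lintegral_clipAndNoise_le (hm : 1 ≤ m) (hd : 1 ≤ d) (hint : Integrable (fun x => x) D)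
    (hk2 : 2 < k) (hk : kthMoment k D ≤ 1) {ρ σ α : ℝ} (hρ0 : 0 < ρ) (hσ : 0 < σ) (hα : 0 < α)
    (hρ : 16 * k ^ 2 * Real.sqrt (d / m) * Real.log (2 + m * d) ≤ ρ / 2) {u : Vec d}
    (hu : ‖u - ∫ y, y ∂D‖ ≤ ρ / 2)
    (hbias : tailConst k * ((d : ℝ) ^ (k / 2) / (m * (ρ / 2)) ^ (k - 1)) ≤ α / 3)
    {B : Finset (Fin n)} (hB : B.Nonempty) (hvar : d / m / (B.card * (α / 3) ^ 2) ≤ 1 / 20)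
    (hnoise : σ ^ 2 * d / (α / 3) ^ 2 ≤ 1 / 20) :
    ∫⁻ X, clipAndNoise B ρ σ u X {y | ‖y - ∫ x, x ∂D‖ ≤ α}ᶜ ∂(dataLaw n m D) ≤
      ENNReal.ofReal (1 / 10) := by
  set μ := ∫ x, x ∂D with hμ
  set c := ∫ x : Fin m → Vec d, clip ρ u (sampleMean x) ∂(Measure.pi fun _ => D) with hc
  have hcμ : ‖c - μ‖ ≤ α / 3 := (norm_integral_clip_sub_le hm hd hint hk2 hk hρ0.le hρ hu).trans hbias
  have hclipm : Measurable fun x : Fin m → Vec d => clip ρ u (sampleMean x) :=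
    measurable_clip_comp measurable_const measurable_sampleMean
  have hav := dataLaw_average_ge_le (n := n) hclipm (integrable_clip_sampleMean hρ0.le u)
    (lintegral_norm_clip_sampleMean_sq_le hm hint hk2 hk hρ0.le (hu.trans (by linarith)))
    (by positivity) (β := α / 3) (by positivity) hB
  rw [← hc] at hav
  set T : Set (Dataset n m d) := {X | α / 3 ≤ ‖(B.card : ℝ)⁻¹ • ∑ i ∈ B, clip ρ u (sampleMean (X i)) -
    c‖} with hT
  have hTm : MeasurableSet T := by
    refine measurableSet_le measurable_const ?_
    have : Measurable fun X : Dataset n m d => ∑ i ∈ B, clip ρ u (sampleMean (X i)) :=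
      Finset.measurable_sum _ fun i _ => hclipm.comp (measurable_pi_apply i)
    fun_prop
  -- Bias, sampling fluctuation and noise each get `α / 3`. The bias is deterministic; the other two
  -- fail with probability at most `1/20` each.
  have hpt : ∀ X : Dataset n m d, clipAndNoise B ρ σ u X {y | ‖y - μ‖ ≤ α}ᶜ ≤
      T.indicator 1 X + stdGaussian (Vec d) {g | α / 3 ≤ ‖σ • g‖} := fun X => by
    by_cases hX : X ∈ T
    · rw [Set.indicator_of_mem hX]
      have : IsProbabilityMeasure (clipAndNoise B ρ σ u X) :=
        Measure.isProbabilityMeasure_map (by fun_prop)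
      exact (prob_le_one).trans (le_add_right le_rfl)
    · refine le_add_left ?_
      unfold clipAndNoise
      rw [Measure.map_apply (by fun_prop)
        (measurableSet_le (by fun_prop) measurable_const).compl]
      refine measure_mono fun g hg => ?_
      simp only [Set.mem_preimage, Set.mem_compl_iff, Set.mem_ofPred_eq, not_le] at hg ⊢
      simp only [hT, Set.mem_ofPred_eq, not_le] at hX
      rw [clippedMean_eq] at hg
      set a := (B.card : ℝ)⁻¹ • ∑ i ∈ B, clip ρ u (sampleMean (X i))
      have : ‖a + σ • g - μ‖ ≤ ‖a - c‖ + ‖c - μ‖ + ‖σ • g‖ := by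
        have : a + σ • g - μ = (a - c) + (c - μ) + σ • g := by abel
        rw [this]
        exact (norm_add_le _ _).trans (by gcongr; exact norm_add_le _ _)
      linarith
  calc _ ≤ ∫⁻ X, (T.indicator 1 X + stdGaussian (Vec d) {g | α / 3 ≤ ‖σ • g‖}) ∂(dataLaw n m D) :=
        lintegral_mono hpt
    _ = dataLaw n m D T + stdGaussian (Vec d) {g | α / 3 ≤ ‖σ • g‖} := by
        rw [lintegral_add_right _ measurable_const, lintegral_indicator_one hTm]
        simp
    _ ≤ ENNReal.ofReal (1 / 20) + ENNReal.ofReal (1 / 20) :=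
        add_le_add (hav.trans (ENNReal.ofReal_le_ofReal hvar))
          ((stdGaussian_norm_smul_ge_le hσ (by positivity)).trans (ENNReal.ofReal_le_ofReal hnoise))
    _ = _ := by rw [← ENNReal.ofReal_add (by norm_num) (by norm_num)]; norm_num

/-- The radius used by the coarse estimator. -/
noncomputable def coarseRadius (m d : ℕ) : ℝ := 20 * Real.sqrt (d / m)

theorem coarseRadius_pos (hm : 1 ≤ m) (hd : 1 ≤ d) : 0 < coarseRadius m d := by
  have hm0 : (0 : ℝ) < m := by exact_mod_cast hm
  have hd0 : (0 : ℝ) < d := by exact_mod_cast hd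
  unfold coarseRadius; positivity

/-- The people whose sample mean is far from `μ`. -/
noncomputable def farPeople (A : Finset (Fin n)) (r : ℝ) (μ : Vec d) (X : Dataset n m d) :
    Finset (Fin n) :=
  open Classical in A.filter fun i => r ≤ ‖sampleMean (X i) - μ‖

/-- Markov's inequality for the sum of squared errors. A tenth of the people being far makes this
sum at least `A.card * 400 (d / m) / 10`, which is `40` times the bound on its mean. -/
theorem dataLaw_farPeople_le (hm : 1 ≤ m) (hd : 1 ≤ d) (hint : Integrable (fun x => x) D)
    (hk2 : 2 < k) (hk : kthMoment k D ≤ 1) {A : Finset (Fin n)} (hA : A.Nonempty) :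
    dataLaw n m D {X | A.card ≤ 10 * (farPeople A (coarseRadius m d) (∫ x, x ∂D) X).card} ≤
      ENNReal.ofReal (1 / 40) := by
  classical
  have hm0 : (0 : ℝ) < m := by exact_mod_cast hm
  have hd0 : (0 : ℝ) < d := by exact_mod_cast hd
  have hA0 : 0 < (A.card : ℝ) := by exact_mod_cast hA.card_pos
  set μ := ∫ x, x ∂D with hμ
  set r := coarseRadius m d with hr
  have hr0 : 0 < r := coarseRadius_pos hm hd
  have hr2 : r ^ 2 = 400 * (d / m) := by
    rw [hr, coarseRadius, mul_pow, Real.sq_sqrt (by positivity)]; norm_num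
  have hsub : {X : Dataset n m d | A.card ≤ 10 * (farPeople A r μ X).card} ⊆
      {X | ENNReal.ofReal (A.card * r ^ 2 / 10) ≤
        ∑ i ∈ A, ENNReal.ofReal (‖sampleMean (X i) - μ‖ ^ 2)} := by
    intro X hX
    rw [Set.mem_ofPred_eq, ← ENNReal.ofReal_sum_of_nonneg fun i _ => by positivity]
    refine ENNReal.ofReal_le_ofReal ?_
    have h1 : ∑ i ∈ farPeople A r μ X, r ^ 2 ≤ ∑ i ∈ A, ‖sampleMean (X i) - μ‖ ^ 2 := by
      refine le_trans (Finset.sum_le_sum fun i hi => ?_)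
        (Finset.sum_le_sum_of_subset_of_nonneg (Finset.filter_subset _ _) fun i _ _ => by positivity)
      have := (Finset.mem_filter.1 hi).2
      gcongr
    rw [Finset.sum_const, nsmul_eq_mul] at h1
    have hX' : (A.card : ℝ) ≤ 10 * (farPeople A r μ X).card := by exact_mod_cast hX
    refine le_trans ?_ h1
    rw [div_le_iff₀ (by norm_num)]
    nlinarith [sq_nonneg r]
  have hmeas : Measurable (sampleMean : (Fin m → Vec d) → Vec d) := measurable_sampleMean
  have hi : ∀ i : Fin n, ∫⁻ X : Dataset n m d, ENNReal.ofReal (‖sampleMean (X i) - μ‖ ^ 2)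
      ∂(dataLaw n m D) ≤ ENNReal.ofReal (d / m) := fun i => by
    refine le_trans (le_of_eq ?_) (lintegral_norm_sampleMean_sq_le hm hint hk2 hk)
    exact (measurePreserving_eval (fun _ : Fin n => Measure.pi fun _ : Fin m => D) i).lintegral_comp
      (f := fun x => ENNReal.ofReal (‖sampleMean x - μ‖ ^ 2)) (by fun_prop)
  have hpos : 0 < A.card * r ^ 2 / 10 := by positivity
  refine (measure_mono hsub).trans ((meas_ge_le_lintegral_div
    (Measurable.aemeasurable (by fun_prop)) (by simpa using hpos) ENNReal.ofReal_ne_top).trans ?_)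
  rw [lintegral_finsetSum _ fun i _ => by fun_prop]
  calc _ ≤ (∑ i ∈ A, ENNReal.ofReal (d / m)) / ENNReal.ofReal (A.card * r ^ 2 / 10) := by
        gcongr with i _; exact hi i
    _ = ENNReal.ofReal (1 / 40) := by
        rw [Finset.sum_const, nsmul_eq_mul, ← ENNReal.ofReal_natCast, ← ENNReal.ofReal_mul hA0.le,
          ← ENNReal.ofReal_div_of_pos hpos, hr2]
        congr 1; field_simp; norm_num

/-- The coarse estimate is accurate when few people are far away and the noise is typical. -/
theorem norm_coarseVal_sub_le {A : Finset (Fin n)} {r ε δ : ℝ} (hr : 0 < r) (hε : 0 < ε)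
    {μ : Vec d} {X : Dataset n m d} (hX : ¬ A.card ≤ 10 * (farPeople A r μ X).card)
    (h1 : 13 + 45 * noiseMult ε δ * (1 + Real.sqrt (Real.log (2 / δ))) ≤ A.card)
    (h2 : 560 * noiseMult ε δ * Real.sqrt d ≤ A.card) {x : Fin (d + 1) → ℝ}
    (hx0 : ¬ (25 : ℝ) ≤ ∑ c : Fin 1, x ((fun _ => 0) c) ^ 2)
    (hx : ¬ (25 * d : ℝ) ≤ ∑ c : Fin d, x c.succ ^ 2) :
    ‖coarseVal A ((2 * r) ^ 2) (coarseThreshold A.card ε δ) (3 * A.card * noiseMult ε δ)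
      (112 * (r / A.card) * noiseMult ε δ) (fun i => sampleMean (X i)) x - μ‖ ≤ 4 * r := by
  classical
  set s := noiseMult ε δ with hs
  have hs0 : 0 < s := noiseMult_pos hε
  set L := Real.sqrt (Real.log (2 / δ)) with hL
  have hL0 : 0 ≤ L := Real.sqrt_nonneg _
  set h : ℝ := (A.card : ℝ) with hh
  have hsL : 0 ≤ s * L := by positivity
  have hh13 : 13 ≤ h := by nlinarith
  set Y : Fin n → Vec d := fun i => sampleMean (X i) with hY
  set G := A.filter fun i => ‖Y i - μ‖ < r with hG
  have hGA : G ⊆ A := Finset.filter_subset _ _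
  have hGr : ∀ i ∈ G, ‖Y i - μ‖ < r := fun i hi => (Finset.mem_filter.1 hi).2
  have hcard : G.card + (farPeople A r μ X).card = A.card := by
    have := Finset.card_filter_add_card_filter_not (s := A) (fun i => ‖Y i - μ‖ < r)
    simp only [not_lt] at this
    rw [← this, hG]
    unfold farPeople
    congr!
  have hcard9 : 9 * A.card ≤ 10 * G.card := by omega
  have hWn := le_totalWeight hGA hGr hcard9
  set W := totalWeight A ((2 * r) ^ 2) Y with hW
  have hWr : 18 * h ^ 2 ≤ 25 * (W : ℝ) := by rw [hh]; exact_mod_cast hWn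
  have hW0 : 0 < W := by
    have : 0 < (W : ℝ) := by nlinarith
    exact_mod_cast this
  simp only [Finset.univ_unique, Finset.sum_const, Finset.card_singleton, one_smul, not_le] at hx0 hx
  have hx5 : -5 < x 0 := by nlinarith
  -- The margin `18/25 - 1/4 = 0.47` times `h²` must exceed `6h + 6hs(1 + L) + 15hs`. The constants
  -- in `h1` are chosen for this: `0.47 * 13 > 6` and `0.47 * 45 > 6 + 15`.
  have hpass : coarseThreshold h ε δ < W + 3 * h * s * x 0 := by
    have e1 : -(3 * h * s * 5) ≤ 3 * h * s * x 0 := by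
      have : 0 ≤ 3 * h * s := by positivity
      nlinarith
    have e2 : coarseThreshold h ε δ = h ^ 2 / 4 + 6 * h + 3 * h * s * (2 * (1 + L)) := rfl
    have e3 : h * (13 + 45 * s * (1 + L)) ≤ h * h := by gcongr
    have e4 : 0 ≤ h * s := by positivity
    have e5 : 0 ≤ h * s * L := by positivity
    rw [e2]
    nlinarith
  have hcv : coarseVal A ((2 * r) ^ 2) (coarseThreshold h ε δ) (3 * h * s) (112 * (r / h) * s) Y x =
      stableCenter A ((2 * r) ^ 2) Y + (112 * (r / h) * s) • WithLp.toLp 2 fun c : Fin d => x c.succ :=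
    if_pos hpass
  rw [hcv]
  have hcen := norm_stableCenter_sub_le_of_close hr.le hGA hGr hcard9 hW0
  have hnorm : ‖(WithLp.toLp 2 fun c : Fin d => x c.succ : Vec d)‖ ≤ 5 * Real.sqrt d := by
    refine (sq_le_sq₀ (norm_nonneg _) (by positivity)).1 ?_
    rw [EuclideanSpace.real_norm_sq_eq, mul_pow, Real.sq_sqrt (Nat.cast_nonneg _)]
    calc _ ≤ (25 * d : ℝ) := hx.le
      _ = _ := by norm_num
  have hnoise : ‖(112 * (r / h) * s) • (WithLp.toLp 2 fun c : Fin d => x c.succ : Vec d)‖ ≤ r := by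
    have hh0 : 0 < h := by linarith
    rw [norm_smul, Real.norm_of_nonneg (by positivity)]
    calc _ ≤ 112 * (r / h) * s * (5 * Real.sqrt d) := by gcongr
      _ = r * (560 * s * Real.sqrt d) / h := by ring
      _ ≤ r * h / h := by gcongr
      _ = r := by field_simp
  calc _ = ‖(stableCenter A ((2 * r) ^ 2) Y - μ) +
        (112 * (r / h) * s) • (WithLp.toLp 2 fun c : Fin d => x c.succ : Vec d)‖ := by congr 1; abel
    _ ≤ 3 * r + r := (norm_add_le _ _).trans (add_le_add hcen hnoise)
    _ = 4 * r := by ring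

end StageAccuracy

/-! ### The two-stage mechanism as a Markov kernel -/

section Kernels

/-- The kernel of a measurable function of the input and of independent randomness `P`. -/
noncomputable def lawKernel {α Ω β : Type*} [MeasurableSpace α] [MeasurableSpace Ω]
    [MeasurableSpace β] (P : Measure Ω) [SFinite P] (F : α → Ω → β)
    (hF : Measurable (Function.uncurry F)) : Kernel α β where
  toFun a := P.map (F a)
  measurable' := by
    refine Measure.measurable_of_measurable_coe _ fun s hs => ?_
    have h : ∀ a, P.map (F a) s = P (Prod.mk a ⁻¹' (Function.uncurry F ⁻¹' s)) := fun a => by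
      rw [Measure.map_apply hF.of_uncurry_left hs]; rfl
    simp_rw [h]
    exact measurable_measure_prodMk_left (hF hs)

instance {α Ω β : Type*} [MeasurableSpace α] [MeasurableSpace Ω]
    [MeasurableSpace β] (P : Measure Ω) [IsProbabilityMeasure P] (F : α → Ω → β)
    (hF : Measurable (Function.uncurry F)) : IsMarkovKernel (lawKernel P F hF) :=
  ⟨fun _ => Measure.isProbabilityMeasure_map hF.of_uncurry_left.aemeasurable⟩

/-- To show that a mechanism estimates the mean it suffices to bound its failure probability. -/
theorem estimatesMean_of_fail_le {n m d : ℕ} {M : Kernel (Dataset n m d) (Vec d)} [IsMarkovKernel M]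
    {k R α : ℝ} (h : ∀ D : Measure (Vec d), IsProbabilityMeasure D → Integrable (fun x => x) D →
      kthMoment k D ≤ 1 →
      ∫⁻ X, M X {y | ‖y - ∫ x, x ∂D‖ ≤ α}ᶜ ∂(dataLaw n m D) ≤ ENNReal.ofReal (1 / 3)) :
    EstimatesMean M k R α := by
  intro D hD hint _ hk
  have hS : MeasurableSet {y : Vec d | ‖y - ∫ x, x ∂D‖ ≤ α} :=
    measurableSet_le (by fun_prop) measurable_const
  have h1 := h D hD hint hk
  have hp : IsProbabilityMeasure ((dataLaw n m D).bind M) := inferInstance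
  have h2 : (dataLaw n m D).bind M {y | ‖y - ∫ x, x ∂D‖ ≤ α}ᶜ ≤ ENNReal.ofReal (1 / 3) := by
    rwa [Measure.bind_apply hS.compl M.measurable.aemeasurable]
  have h3 := prob_add_prob_compl (μ := (dataLaw n m D).bind M) hS
  have h4 : (2 / 3 : ℝ≥0∞) + ENNReal.ofReal (1 / 3) = 1 := by
    rw [show (2 / 3 : ℝ≥0∞) = ENNReal.ofReal (2 / 3) by
      rw [ENNReal.ofReal_div_of_pos (by norm_num)]; simp,
      ← ENNReal.ofReal_add (by norm_num) (by norm_num)]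
    norm_num
  by_contra hlt
  push Not at hlt
  have : (dataLaw n m D).bind M {y | ‖y - ∫ x, x ∂D‖ ≤ α} +
      (dataLaw n m D).bind M {y | ‖y - ∫ x, x ∂D‖ ≤ α}ᶜ < 1 := by
    rw [← h4]
    exact ENNReal.add_lt_add_of_lt_of_le (ne_top_of_le_ne_top ENNReal.ofReal_ne_top h2) hlt h2
  exact absurd h3 this.ne

theorem PersonLevelDP.mono {n m d : ℕ} {M : Dataset n m d → Measure (Vec d)} {ε ε' δ δ' : ℝ}
    (h : PersonLevelDP M ε δ) (hε : ε ≤ ε') (hδ : δ ≤ δ') : PersonLevelDP M ε' δ' := by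
  intro X X' hX S hS
  refine (h X X' hX S hS).trans ?_
  gcongr

end Kernels

theorem measurable_comp₂ {Ω α β γ : Type*} [MeasurableSpace Ω] [MeasurableSpace α]
    [MeasurableSpace β] [MeasurableSpace γ] {F : α → β → γ}
    (hF : Measurable fun p : α × β => F p.1 p.2) {f : Ω → α} {g : Ω → β} (hf : Measurable f)
    (hg : Measurable g) : Measurable fun ω => F (f ω) (g ω) :=
  hF.comp (hf.prodMk hg)

/-! ### Independence of the two halves of the people -/

section Split

theorem map_piecewise_pi {ι Ω : Type*} [Fintype ι] [DecidableEq ι] [MeasurableSpace Ω]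
    (ν : Measure Ω) [IsProbabilityMeasure ν] (A : Finset ι) :
    ((Measure.pi fun _ : ι => ν).prod (Measure.pi fun _ : ι => ν)).map
      (fun p => A.piecewise p.1 p.2) = Measure.pi fun _ => ν := by
  have hm : Measurable fun p : (ι → Ω) × (ι → Ω) => A.piecewise p.1 p.2 := by
    refine measurable_pi_lambda _ fun i => ?_
    by_cases hi : i ∈ A
    · simp only [Finset.piecewise_eq_of_mem _ _ _ hi]; fun_prop
    · simp only [Finset.piecewise_eq_of_notMem _ _ _ hi]; fun_prop
  refine (Measure.pi_eq fun s hs => ?_).symm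
  rw [Measure.map_apply hm (.univ_pi hs)]
  have h : (fun p : (ι → Ω) × (ι → Ω) => A.piecewise p.1 p.2) ⁻¹' Set.univ.pi s =
      (Set.univ.pi fun i => if i ∈ A then s i else Set.univ) ×ˢ
        (Set.univ.pi fun i => if i ∈ A then Set.univ else s i) := by
    ext p
    simp only [Set.mem_preimage, Set.mem_univ_pi, Set.mem_prod, ← forall_and]
    refine forall_congr' fun i => ?_
    by_cases hi : i ∈ A <;> simp [hi]
  rw [h, Measure.prod_prod, Measure.pi_pi, Measure.pi_pi, ← Finset.prod_mul_distrib]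
  refine Finset.prod_congr rfl fun i _ => ?_
  by_cases hi : i ∈ A <;> simp [hi]

/-- An expectation over independent people can be computed with the people in `A` and the others
taken from two independent datasets. -/
theorem lintegral_pi_piecewise {ι Ω : Type*} [Fintype ι] [DecidableEq ι] [MeasurableSpace Ω]
    (ν : Measure Ω) [IsProbabilityMeasure ν] (A : Finset ι) {f : (ι → Ω) → ℝ≥0∞}
    (hf : Measurable f) :
    ∫⁻ X, f X ∂(Measure.pi fun _ => ν) =
      ∫⁻ X, ∫⁻ X', f (A.piecewise X X') ∂(Measure.pi fun _ => ν) ∂(Measure.pi fun _ => ν) := by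
  have hm : Measurable fun p : (ι → Ω) × (ι → Ω) => A.piecewise p.1 p.2 := by
    refine measurable_pi_lambda _ fun i => ?_
    by_cases hi : i ∈ A
    · simp only [Finset.piecewise_eq_of_mem _ _ _ hi]; fun_prop
    · simp only [Finset.piecewise_eq_of_notMem _ _ _ hi]; fun_prop
  conv_lhs => rw [← map_piecewise_pi ν A]
  rw [lintegral_map hf hm]
  exact lintegral_prod (fun p => f (A.piecewise p.1 p.2)) (hf.comp hm).aemeasurable

end Split

/-! ### The two stages and their joint privacy -/

section Mechanism

variable {n m d : ℕ}

/-- The first half of the people, used by the coarse estimator. -/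
def firstHalf (n : ℕ) : Finset (Fin n) := Finset.univ.filter fun i => i.val < n / 2

theorem card_firstHalf (n : ℕ) : (firstHalf n).card = n / 2 := by
  rw [firstHalf, Fin.card_filter_val_lt]; omega

theorem card_firstHalf_compl (n : ℕ) : (firstHalf n)ᶜ.card = n - n / 2 := by
  rw [Finset.card_compl, card_firstHalf, Fintype.card_fin]

theorem firstHalf_compl_nonempty (hn : 1 ≤ n) : (firstHalf n)ᶜ.Nonempty := by
  rw [← Finset.card_pos, card_firstHalf_compl]; omega

theorem coarseVal_congr {A : Finset (Fin n)} {τ t σ₁ σ₂ : ℝ} {Y Y' : Fin n → Vec d}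
    (h : ∀ i ∈ A, Y i = Y' i) (x : Fin (d + 1) → ℝ) :
    coarseVal A τ t σ₁ σ₂ Y x = coarseVal A τ t σ₁ σ₂ Y' x := by
  classical
  have h1 : ∀ i ∈ A, stableWeight A τ Y i = stableWeight A τ Y' i := fun i hi => by
    unfold stableWeight closeCount
    rw [Finset.filter_congr fun j hj => by rw [h i hi, h j hj]]
  have h2 : totalWeight A τ Y = totalWeight A τ Y' := Finset.sum_congr rfl h1
  have h3 : stableCenter A τ Y = stableCenter A τ Y' := by
    unfold stableCenter
    rw [h2, Finset.sum_congr rfl fun i hi => by rw [h1 i hi, h i hi]]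
  unfold coarseVal
  rw [h2, h3]

theorem measurable_stableWeight (A : Finset (Fin n)) (τ : ℝ) (i : Fin n) :
    Measurable fun Y : Fin n → Vec d => stableWeight A τ Y i := by
  classical
  have h : Measurable fun Y : Fin n → Vec d => closeCount A τ Y i := by
    have : (fun Y : Fin n → Vec d => closeCount A τ Y i) =
        fun Y => ∑ j ∈ A, if ‖Y i - Y j‖ ^ 2 < τ then 1 else 0 := by
      ext Y
      unfold closeCount
      rw [Finset.card_filter]
    rw [this]
    exact Finset.measurable_sum _ fun j _ => Measurable.ite
      (measurableSet_lt (by fun_prop) measurable_const) measurable_const measurable_const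
  exact (measurable_of_countable fun c : ℕ => 2 * c - A.card).comp h

theorem measurable_coarseVal (A : Finset (Fin n)) (τ t σ₁ σ₂ : ℝ) :
    Measurable fun p : (Fin n → Vec d) × (Fin (d + 1) → ℝ) => coarseVal A τ t σ₁ σ₂ p.1 p.2 := by
  have hw : ∀ i, Measurable fun Y : Fin n → Vec d => (stableWeight A τ Y i : ℝ) := fun i =>
    (measurable_of_countable fun c : ℕ => (c : ℝ)).comp (measurable_stableWeight A τ i)
  have hW : Measurable fun Y : Fin n → Vec d => (totalWeight A τ Y : ℝ) := by
    unfold totalWeight; push_cast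
    exact Finset.measurable_sum _ fun i _ => hw i
  have hC : Measurable fun Y : Fin n → Vec d => stableCenter A τ Y := by
    unfold stableCenter
    exact hW.inv.smul (Finset.measurable_sum _ fun i _ => (hw i).smul (measurable_pi_apply i))
  unfold coarseVal
  have hW' : Measurable fun p : (Fin n → Vec d) × (Fin (d + 1) → ℝ) => (totalWeight A τ p.1 : ℝ) :=
    hW.comp measurable_fst
  have hC' : Measurable fun p : (Fin n → Vec d) × (Fin (d + 1) → ℝ) => stableCenter A τ p.1 :=
    hC.comp measurable_fst
  exact Measurable.ite (measurableSet_lt measurable_const (by fun_prop)) (by fun_prop)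
    measurable_const

/-- The coarse estimate from the first half of the people, as a function of its noise. -/
noncomputable def coarseFun (ε δ : ℝ) (X : Dataset n m d) (x : Fin (d + 1) → ℝ) : Vec d :=
  coarseVal (firstHalf n) ((2 * coarseRadius m d) ^ 2) (coarseThreshold (firstHalf n).card ε δ)
    (3 * (firstHalf n).card * noiseMult ε δ)
    (112 * (coarseRadius m d / (firstHalf n).card) * noiseMult ε δ) (fun i => sampleMean (X i)) x

theorem measurable_coarseFun (ε δ : ℝ) :
    Measurable fun p : Dataset n m d × (Fin (d + 1) → ℝ) => coarseFun ε δ p.1 p.2 := by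
  have h : Measurable fun p : Dataset n m d × (Fin (d + 1) → ℝ) =>
      (fun i => sampleMean (p.1 i) : Fin n → Vec d) :=
    measurable_pi_lambda _ fun i =>
      measurable_sampleMean.comp ((measurable_pi_apply i).comp measurable_fst)
  unfold coarseFun
  exact measurable_comp₂ (F := coarseVal _ _ _ _ _) (measurable_coarseVal _ _ _ _ _) h measurable_snd

theorem measurable_coarseFun_right (ε δ : ℝ) (X : Dataset n m d) : Measurable (coarseFun ε δ X) :=
  measurable_comp₂ (F := coarseFun (n := n) (m := m) (d := d) ε δ) (measurable_coarseFun ε δ)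
    measurable_const measurable_id

theorem coarseFun_congr {ε δ : ℝ} {X X' : Dataset n m d} (h : ∀ i ∈ firstHalf n, X i = X' i)
    (x : Fin (d + 1) → ℝ) : coarseFun ε δ X x = coarseFun ε δ X' x :=
  coarseVal_congr (fun i hi => by rw [h i hi]) x

/-- A changed person outside the first half has no influence; one inside also shows that this half
is nonempty, which fails for `n = 1`. -/
theorem gaussPi_coarseFun_le (hm : 1 ≤ m) (hd : 1 ≤ d) {ε δ : ℝ} (hε : 0 < ε) (hε1 : ε ≤ 1)
    (hδ : 0 < δ) (hδ1 : δ ≤ 1) {X X' : Dataset n m d} {i₀ : Fin n}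
    (hX : ∀ i, i ≠ i₀ → X i = X' i) {S : Set (Vec d)} (hS : MeasurableSet S) :
    gaussPi (Fin (d + 1)) {x | coarseFun ε δ X x ∈ S} ≤
      ENNReal.ofReal (Real.exp ε) * gaussPi (Fin (d + 1)) {x | coarseFun ε δ X' x ∈ S} +
        ENNReal.ofReal δ := by
  by_cases hi : i₀ ∈ firstHalf n
  · exact gaussPi_coarseVal_le ⟨i₀, hi⟩ (coarseRadius_pos hm hd) hε hε1 hδ hδ1
      (fun i hi => by rw [hX i hi]) hS
  · have : ∀ x, coarseFun ε δ X x = coarseFun ε δ X' x := coarseFun_congr fun i hiA =>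
      hX i fun h => hi (h ▸ hiA)
    simp_rw [this]
    refine le_add_right (le_mul_of_one_le_left zero_le ?_)
    rw [ENNReal.one_le_ofReal]
    exact Real.one_le_exp hε.le

theorem clippedMean_congr {B : Finset (Fin n)} {ρ : ℝ} {u : Vec d} {X X' : Dataset n m d}
    (h : ∀ i ∈ B, X i = X' i) : clippedMean B ρ u X = clippedMean B ρ u X' := by
  unfold clippedMean
  rw [Finset.sum_congr rfl fun i hi => by rw [h i hi]]

theorem measurable_clippedMean (B : Finset (Fin n)) (ρ : ℝ) :
    Measurable fun p : Vec d × Dataset n m d => clippedMean B ρ p.1 p.2 := by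
  simp_rw [clippedMean_eq]
  have h : Measurable fun p : Vec d × Dataset n m d => ∑ i ∈ B, clip ρ p.1 (sampleMean (p.2 i)) :=
    Finset.measurable_sum _ fun i _ => measurable_clip_comp measurable_fst
      (measurable_sampleMean.comp ((measurable_pi_apply i).comp measurable_snd))
  exact h.const_smul (B.card : ℝ)⁻¹

theorem measurable_clippedMean_add {Ω : Type*} [MeasurableSpace Ω] (B : Finset (Fin n)) (ρ σ : ℝ)
    {f g : Ω → Vec d} {Z : Ω → Dataset n m d} (hf : Measurable f) (hZ : Measurable Z)
    (hg : Measurable g) : Measurable fun ω => clippedMean B ρ (f ω) (Z ω) + σ • g ω := by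
  have h1 : Measurable fun ω => clippedMean B ρ (f ω) (Z ω) :=
    measurable_comp₂ (F := clippedMean B ρ) (measurable_clippedMean B ρ) hf hZ
  have h2 : Measurable fun ω => σ • g ω := by fun_prop
  exact Measurable.add h1 h2

/-- The noise level of the clip-and-noise step. -/
noncomputable def roundNoise (n : ℕ) (ε δ ρ : ℝ) : ℝ :=
  noiseMult ε δ * (2 * ρ / (firstHalf n)ᶜ.card)

theorem roundNoise_pos (hn : 1 ≤ n) {ε δ ρ : ℝ} (hε : 0 < ε) (hρ : 0 < ρ) :
    0 < roundNoise n ε δ ρ := by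
  have := noiseMult_pos (δ := δ) hε
  have hB : 0 < ((firstHalf n)ᶜ.card : ℝ) := by
    exact_mod_cast (firstHalf_compl_nonempty hn).card_pos
  unfold roundNoise; positivity

/-- The two-stage estimate as a function of the sequence of random draws. -/
noncomputable def twoStage (ε δ ρ : ℝ) (X : Dataset n m d) (ω : ℕ → ℝ) : Vec d :=
  clippedMean (firstHalf n)ᶜ ρ (coarseFun ε δ X fun i => ω i) X +
    roundNoise n ε δ ρ • WithLp.toLp 2 fun c : Fin d => ω (d + 1 + c)

theorem measurable_twoStage (ε δ ρ : ℝ) :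
    Measurable (Function.uncurry (twoStage ε δ ρ : Dataset n m d → (ℕ → ℝ) → Vec d)) := by
  have h1 : Measurable fun p : Dataset n m d × (ℕ → ℝ) => coarseFun ε δ p.1 fun i => p.2 i :=
    measurable_comp₂ (F := coarseFun (n := n) (m := m) (d := d) ε δ) (measurable_coarseFun ε δ)
      measurable_fst (measurable_pi_lambda _ fun i => (measurable_pi_apply _).comp measurable_snd)
  have h2 : Measurable fun p : Dataset n m d × (ℕ → ℝ) =>
      (WithLp.toLp 2 fun c : Fin d => p.2 (d + 1 + c) : Vec d) := by fun_prop
  exact measurable_clippedMean_add _ ρ _ h1 measurable_fst h2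

/-- The blocks of draws used by the two stages are independent. -/
theorem drawLaw_map_blocks (d : ℕ) :
    RealRAM.drawLaw.map (fun ω => ((fun i : Fin (d + 1) => ω i),
      (WithLp.toLp 2 fun c : Fin d => ω (d + 1 + c) : Vec d))) =
      (gaussPi (Fin (d + 1))).prod (stdGaussian (Vec d)) := by
  let e : Fin (d + 1) ⊕ Fin d → ℕ := Sum.elim (fun i => i) (fun c => d + 1 + c)
  have he : Function.Injective e := by
    rintro (i | i) (j | j) h <;> simp only [e, Sum.elim_inl, Sum.elim_inr] at h
    · rw [Fin.ext h]
    · omega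
    · omega
    · rw [Fin.ext (Nat.add_left_cancel h)]
  have h1 : RealRAM.drawLaw.map (fun ω i => ω (e i)) = gaussPi (Fin (d + 1) ⊕ Fin d) := by
    rw [RealRAM.drawLaw, Measure.map_infinitePi_infinitePi_of_inj he, Measure.infinitePi_eq_pi,
      gaussPi]
  have h2 := (measurePreserving_sumPiEquivProdPi fun _ : Fin (d + 1) ⊕ Fin d =>
    gaussianReal 0 1).map_eq
  have h3 : (gaussPi (Fin (d + 1))).prod (stdGaussian (Vec d)) =
      ((gaussPi (Fin (d + 1))).prod (gaussPi (Fin d))).map (Prod.map id (WithLp.toLp 2)) := by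
    rw [← Measure.map_prod_map _ _ measurable_id (by fun_prop), Measure.map_id,
      ← map_pi_eq_stdGaussian, gaussPi, gaussPi]
  change (gaussPi (Fin (d + 1) ⊕ Fin d)).map _ = (gaussPi (Fin (d + 1))).prod (gaussPi (Fin d)) at h2
  rw [h3, ← h2, ← h1, Measure.map_map (by fun_prop) (MeasurableEquiv.measurable _),
    Measure.map_map (by fun_prop) (by fun_prop)]
  rfl

/-- The mechanism computing the two-stage estimate. -/
noncomputable def twoStageKernel (n m d : ℕ) (ε δ ρ : ℝ) : Kernel (Dataset n m d) (Vec d) :=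
  have : IsProbabilityMeasure RealRAM.drawLaw := by unfold RealRAM.drawLaw; infer_instance
  lawKernel RealRAM.drawLaw (twoStage ε δ ρ) (measurable_twoStage ε δ ρ)

/-- The coarse estimator. -/
noncomputable def coarseKernel (n m d : ℕ) (ε δ : ℝ) : Kernel (Dataset n m d) (Vec d) :=
  lawKernel (gaussPi (Fin (d + 1))) (coarseFun ε δ) (measurable_coarseFun ε δ)

/-- The clip-and-noise step, jointly in the center and the dataset. -/
noncomputable def roundKernel (B : Finset (Fin n)) (ρ σ : ℝ) :
    Kernel (Vec d × Dataset n m d) (Vec d) :=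
  lawKernel (stdGaussian (Vec d)) (fun p g => clippedMean B ρ p.1 p.2 + σ • g)
    (measurable_clippedMean_add B ρ σ (measurable_fst.comp measurable_fst)
      (measurable_snd.comp measurable_fst) measurable_snd)

instance (ε δ ρ : ℝ) : IsMarkovKernel (twoStageKernel n m d ε δ ρ) := by
  have : IsProbabilityMeasure RealRAM.drawLaw := by unfold RealRAM.drawLaw; infer_instance
  unfold twoStageKernel; infer_instance

instance (ε δ : ℝ) : IsMarkovKernel (coarseKernel n m d ε δ) :=
  ⟨fun X => Measure.isProbabilityMeasure_map (measurable_coarseFun_right ε δ X).aemeasurable⟩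

theorem coarseKernel_apply (ε δ : ℝ) (X : Dataset n m d) :
    coarseKernel n m d ε δ X = (gaussPi (Fin (d + 1))).map (coarseFun ε δ X) := rfl

theorem measurable_clipAndNoise_apply (B : Finset (Fin n)) (ρ σ : ℝ) {S : Set (Vec d)}
    (hS : MeasurableSet S) :
    Measurable fun p : Vec d × Dataset n m d => clipAndNoise B ρ σ p.1 p.2 S :=
  (roundKernel B ρ σ).measurable_coe hS

theorem twoStageKernel_prod (ε δ ρ : ℝ) (X : Dataset n m d) {S : Set (Vec d)}
    (hS : MeasurableSet S) :
    twoStageKernel n m d ε δ ρ X S = ((gaussPi (Fin (d + 1))).prod (stdGaussian (Vec d)))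
      {p | clippedMean (firstHalf n)ᶜ ρ (coarseFun ε δ X p.1) X + roundNoise n ε δ ρ • p.2 ∈ S} := by
  have hm := measurable_clippedMean_add (firstHalf n)ᶜ ρ (roundNoise n ε δ ρ)
    (Z := fun _ : (Fin (d + 1) → ℝ) × Vec d => X)
    ((measurable_coarseFun_right ε δ X).comp measurable_fst) measurable_const measurable_snd
  have hmb : Measurable fun ω : ℕ → ℝ => ((fun i : Fin (d + 1) => ω i),
      (WithLp.toLp 2 fun c : Fin d => ω (d + 1 + c) : Vec d)) := by fun_prop
  rw [← drawLaw_map_blocks, Measure.map_apply hmb (by exact hm hS)]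
  change RealRAM.drawLaw.map (twoStage ε δ ρ X) S = _
  rw [Measure.map_apply (measurable_twoStage ε δ ρ).of_uncurry_left hS]
  rfl

theorem twoStageKernel_apply (ε δ ρ : ℝ) (X : Dataset n m d) {S : Set (Vec d)}
    (hS : MeasurableSet S) :
    twoStageKernel n m d ε δ ρ X S = ∫⁻ x, clipAndNoise (firstHalf n)ᶜ ρ (roundNoise n ε δ ρ)
      (coarseFun ε δ X x) X S ∂(gaussPi (Fin (d + 1))) := by
  rw [twoStageKernel_prod ε δ ρ X hS, Measure.prod_apply]
  · refine lintegral_congr fun x => ?_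
    unfold clipAndNoise
    rw [Measure.map_apply (by fun_prop) hS]
    rfl
  · exact measurable_clippedMean_add (firstHalf n)ᶜ ρ (roundNoise n ε δ ρ)
      (Z := fun _ : (Fin (d + 1) → ℝ) × Vec d => X)
      ((measurable_coarseFun_right ε δ X).comp measurable_fst) measurable_const measurable_snd hS

theorem twoStageKernel_eq_bind (ε δ ρ : ℝ) (X : Dataset n m d) :
    twoStageKernel n m d ε δ ρ X = (coarseKernel n m d ε δ X).bind fun u =>
      clipAndNoise (firstHalf n)ᶜ ρ (roundNoise n ε δ ρ) u X := by
  have hmS : ∀ S, MeasurableSet S → Measurable fun u : Vec d =>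
      clipAndNoise (firstHalf n)ᶜ ρ (roundNoise n ε δ ρ) u X S := fun S hS =>
    measurable_comp₂ (F := fun u X => clipAndNoise (firstHalf n)ᶜ ρ (roundNoise n ε δ ρ) u X S)
      (measurable_clipAndNoise_apply (firstHalf n)ᶜ ρ (roundNoise n ε δ ρ) hS) measurable_id
      measurable_const
  have hm : Measurable fun u : Vec d => clipAndNoise (firstHalf n)ᶜ ρ (roundNoise n ε δ ρ) u X :=
    Measure.measurable_of_measurable_coe _ hmS
  ext S hS
  rw [Measure.bind_apply hS hm.aemeasurable, coarseKernel_apply,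
    lintegral_map (hmS S hS) (measurable_coarseFun_right ε δ X), twoStageKernel_apply ε δ ρ X hS]

theorem personLevelDP_coarseKernel (hn : 1 ≤ n) (hm : 1 ≤ m) (hd : 1 ≤ d) {ε δ : ℝ} (hε : 0 < ε)
    (hε1 : ε ≤ 1) (hδ : 0 < δ) (hδ1 : δ ≤ 1) : PersonLevelDP (coarseKernel n m d ε δ) ε δ := by
  intro X X' hX S hS
  obtain ⟨i₀, hi₀⟩ := exists_forall_ne_eq hn hX
  rw [coarseKernel_apply, coarseKernel_apply, Measure.map_apply (measurable_coarseFun_right ε δ X) hS,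
    Measure.map_apply (measurable_coarseFun_right ε δ X') hS]
  exact gaussPi_coarseFun_le hm hd hε hε1 hδ hδ1 hi₀ hS

/-- The stages read disjoint sets of people, so nothing is lost by composition. If the changed
person is in the first half, the final stage with its noise held fixed is post-processing of the
private center. If not, the center has the same value on both datasets for each coarse noise, and
the privacy of the final step is integrated over that noise. -/
theorem personLevelDP_twoStageKernel (hn : 1 ≤ n) (hm : 1 ≤ m) (hd : 1 ≤ d) {ε δ ρ : ℝ}
    (hε : 0 < ε) (hε1 : ε ≤ 1) (hδ : 0 < δ) (hδ1 : δ ≤ 1) (hρ : 0 < ρ) :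
    PersonLevelDP (twoStageKernel n m d ε δ ρ) ε δ := by
  intro X X' hX S hS
  obtain ⟨i₀, hi₀⟩ := exists_forall_ne_eq hn hX
  by_cases hi : i₀ ∈ firstHalf n
  · have hcl : ∀ u, clippedMean (firstHalf n)ᶜ ρ u X = clippedMean (firstHalf n)ᶜ ρ u X' := fun u =>
      clippedMean_congr fun i hiB => hi₀ i fun h => (Finset.mem_compl.1 hiB) (h ▸ hi)
    have hms : ∀ Z : Dataset n m d, MeasurableSet {p : (Fin (d + 1) → ℝ) × Vec d |
        clippedMean (firstHalf n)ᶜ ρ (coarseFun ε δ Z p.1) X' + roundNoise n ε δ ρ • p.2 ∈ S} := by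
      intro Z
      exact measurable_clippedMean_add (firstHalf n)ᶜ ρ (roundNoise n ε δ ρ)
        (Z := fun _ : (Fin (d + 1) → ℝ) × Vec d => X')
        ((measurable_coarseFun_right ε δ Z).comp measurable_fst) measurable_const measurable_snd hS
    have hSg : ∀ g : Vec d, MeasurableSet {u : Vec d |
        clippedMean (firstHalf n)ᶜ ρ u X' + roundNoise n ε δ ρ • g ∈ S} := fun g =>
      measurable_clippedMean_add (firstHalf n)ᶜ ρ (roundNoise n ε δ ρ) (Z := fun _ => X')
        measurable_id measurable_const measurable_const hS
    rw [twoStageKernel_prod ε δ ρ X hS, twoStageKernel_prod ε δ ρ X' hS]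
    simp_rw [hcl]
    rw [Measure.prod_apply_symm (hms X), Measure.prod_apply_symm (hms X')]
    calc _ ≤ ∫⁻ g, (ENNReal.ofReal (Real.exp ε) * gaussPi (Fin (d + 1))
          ((fun x => (x, g)) ⁻¹' {p : (Fin (d + 1) → ℝ) × Vec d | clippedMean (firstHalf n)ᶜ ρ
            (coarseFun ε δ X' p.1) X' + roundNoise n ε δ ρ • p.2 ∈ S}) +
            ENNReal.ofReal δ) ∂(stdGaussian (Vec d)) :=
          lintegral_mono fun g => gaussPi_coarseFun_le hm hd hε hε1 hδ hδ1 hi₀ (hSg g)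
      _ = _ := by
          rw [lintegral_add_right _ measurable_const, lintegral_const_mul _
            (measurable_measure_prodMk_right (hms X'))]
          simp
  · have hco : ∀ x, coarseFun ε δ X x = coarseFun ε δ X' x := coarseFun_congr fun i hiA =>
      hi₀ i fun h => hi (h ▸ hiA)
    rw [twoStageKernel_apply ε δ ρ X hS, twoStageKernel_apply ε δ ρ X' hS]
    simp_rw [hco]
    have hmx : Measurable fun x => clipAndNoise (firstHalf n)ᶜ ρ (roundNoise n ε δ ρ)
        (coarseFun ε δ X' x) X' S :=
      measurable_comp₂ (F := fun u X => clipAndNoise (firstHalf n)ᶜ ρ (roundNoise n ε δ ρ) u X S)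
        (measurable_clipAndNoise_apply (firstHalf n)ᶜ ρ (roundNoise n ε δ ρ) hS)
        (measurable_coarseFun_right ε δ X') measurable_const
    calc _ ≤ ∫⁻ x, (ENNReal.ofReal (Real.exp ε) * clipAndNoise (firstHalf n)ᶜ ρ
          (roundNoise n ε δ ρ) (coarseFun ε δ X' x) X' S + ENNReal.ofReal δ)
            ∂(gaussPi (Fin (d + 1))) :=
          lintegral_mono fun x => personLevelDP_clipAndNoise hn (firstHalf_compl_nonempty hn) hρ hε
            hε1 hδ hδ1 _ X X' hX S hS
      _ = _ := by
          rw [lintegral_add_right _ measurable_const, lintegral_const_mul _ hmx]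
          simp

end Mechanism

/-! ### Accuracy of the two-stage mechanism -/

section Accuracy

variable {n m d : ℕ} {k : ℝ} {D : Measure (Vec d)} [IsProbabilityMeasure D]

/-- The union bound `1/40 + 1/25 + 1/25 = 21/200`: too many far people, an atypical noise in the
test, an atypical noise in the average. -/
theorem lintegral_coarseFun_fail_le (hm : 1 ≤ m) (hd : 1 ≤ d) (hint : Integrable (fun x => x) D)
    (hk2 : 2 < k) (hk : kthMoment k D ≤ 1) {ε δ : ℝ} (hε : 0 < ε)
    (h1 : 13 + 45 * noiseMult ε δ * (1 + Real.sqrt (Real.log (2 / δ))) ≤ (firstHalf n).card)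
    (h2 : 560 * noiseMult ε δ * Real.sqrt d ≤ (firstHalf n).card) :
    ∫⁻ X : Dataset n m d, gaussPi (Fin (d + 1))
      {x | ¬ ‖coarseFun ε δ X x - ∫ y, y ∂D‖ ≤ 4 * coarseRadius m d} ∂(dataLaw n m D) ≤
      ENNReal.ofReal (21 / 200) := by
  have hd0 : (0 : ℝ) < d := by exact_mod_cast hd
  set μ := ∫ y, y ∂D with hμ
  have hA : (firstHalf n).Nonempty := by
    rw [← Finset.card_pos, ← Nat.cast_pos (α := ℝ)]
    have := (noiseMult_pos (δ := δ) hε).le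
    have : 0 ≤ 45 * noiseMult ε δ * (1 + Real.sqrt (Real.log (2 / δ))) := by positivity
    linarith
  set T : Set (Dataset n m d) := {X | (firstHalf n).card ≤
    10 * (farPeople (firstHalf n) (coarseRadius m d) μ X).card} with hT
  have hn1 : gaussPi (Fin (d + 1)) {x | (25 : ℝ) ≤ ∑ c : Fin 1, x ((fun _ => 0) c) ^ 2} ≤
      ENNReal.ofReal (1 / 25) := by
    refine (gaussPi_sum_sq_ge_le _ (by norm_num)).trans (le_of_eq ?_)
    simp
  have hn2 : gaussPi (Fin (d + 1)) {x | (25 * d : ℝ) ≤ ∑ c : Fin d, x c.succ ^ 2} ≤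
      ENNReal.ofReal (1 / 25) := by
    refine (gaussPi_sum_sq_ge_le Fin.succ (by positivity)).trans (le_of_eq ?_)
    rw [Fintype.card_fin]
    congr 1
    field_simp
  have hpt : ∀ X : Dataset n m d, gaussPi (Fin (d + 1))
      {x | ¬ ‖coarseFun ε δ X x - μ‖ ≤ 4 * coarseRadius m d} ≤
      T.indicator 1 X + (ENNReal.ofReal (1 / 25) + ENNReal.ofReal (1 / 25)) := by
    intro X
    by_cases hX : X ∈ T
    · rw [Set.indicator_of_mem hX]
      exact prob_le_one.trans le_self_add
    · rw [Set.indicator_of_notMem hX, zero_add]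
      refine (measure_mono fun x hx => ?_).trans ((measure_union_le _ _).trans (add_le_add hn1 hn2))
      by_contra hcon
      rw [Set.mem_union, not_or] at hcon
      exact hx (norm_coarseVal_sub_le (coarseRadius_pos hm hd) hε hX h1 h2 hcon.1 hcon.2)
  calc _ ≤ ∫⁻ X, (T.indicator 1 X + (ENNReal.ofReal (1 / 25) + ENNReal.ofReal (1 / 25)))
        ∂(dataLaw n m D) := lintegral_mono hpt
    _ ≤ ENNReal.ofReal (1 / 40) + (ENNReal.ofReal (1 / 25) + ENNReal.ofReal (1 / 25)) := by
        rw [lintegral_add_right _ measurable_const, lintegral_const, measure_univ, mul_one]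
        gcongr
        exact (lintegral_indicator_one_le _).trans (dataLaw_farPeople_le hm hd hint hk2 hk hA)
    _ = ENNReal.ofReal (21 / 200) := by
        rw [← ENNReal.ofReal_add (by norm_num) (by norm_num),
          ← ENNReal.ofReal_add (by norm_num) (by norm_num)]
        norm_num

/-- As the halves are independent, the center may be treated as fixed while the second half is
averaged out. The failure probability is at most `1/10` for the round plus `21/200` for a bad
center. -/
theorem lintegral_twoStageKernel_fail_le (hn : 1 ≤ n) (hm : 1 ≤ m) (hd : 1 ≤ d)
    (hint : Integrable (fun x => x) D)
    (hk2 : 2 < k) (hk : kthMoment k D ≤ 1) {ε δ ρ α : ℝ} (hε : 0 < ε) (hρ0 : 0 < ρ) (hα : 0 < α)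
    (h1 : 13 + 45 * noiseMult ε δ * (1 + Real.sqrt (Real.log (2 / δ))) ≤ (firstHalf n).card)
    (h2 : 560 * noiseMult ε δ * Real.sqrt d ≤ (firstHalf n).card)
    (hρ : 16 * k ^ 2 * Real.sqrt (d / m) * Real.log (2 + m * d) ≤ ρ / 2)
    (hu : 4 * coarseRadius m d ≤ ρ / 2)
    (hbias : tailConst k * ((d : ℝ) ^ (k / 2) / (m * (ρ / 2)) ^ (k - 1)) ≤ α / 3)
    (hvar : d / m / ((firstHalf n)ᶜ.card * (α / 3) ^ 2) ≤ 1 / 20)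
    (hnoise : roundNoise n ε δ ρ ^ 2 * d / (α / 3) ^ 2 ≤ 1 / 20) :
    ∫⁻ X, twoStageKernel n m d ε δ ρ X {y | ‖y - ∫ x, x ∂D‖ ≤ α}ᶜ ∂(dataLaw n m D) ≤
      ENNReal.ofReal (1 / 3) := by
  set μ := ∫ y, y ∂D with hμ
  have hS : MeasurableSet {y : Vec d | ‖y - μ‖ ≤ α}ᶜ :=
    (measurableSet_le (by fun_prop) measurable_const).compl
  set S := {y : Vec d | ‖y - μ‖ ≤ α}ᶜ with hSdef
  set B := (firstHalf n)ᶜ with hB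
  set σ := roundNoise n ε δ ρ with hσ
  have hσ0 : 0 < σ := roundNoise_pos hn hε hρ0
  have hbad : ∀ X : Dataset n m d, MeasurableSet
      {x | ¬ ‖coarseFun ε δ X x - μ‖ ≤ 4 * coarseRadius m d} := fun X =>
    (measurableSet_le (((measurable_coarseFun_right ε δ X).sub_const μ).norm)
      measurable_const).compl
  -- In the spliced dataset the center depends on `X` only and the clipped mean on `X'` only.
  have hkey : ∀ X X' : Dataset n m d, twoStageKernel n m d ε δ ρ ((firstHalf n).piecewise X X') S =
      ∫⁻ x, clipAndNoise B ρ σ (coarseFun ε δ X x) X' S ∂(gaussPi (Fin (d + 1))) := by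
    intro X X'
    rw [twoStageKernel_apply ε δ ρ _ hS]
    refine lintegral_congr fun x => ?_
    rw [coarseFun_congr (X' := X) (fun i hi => Finset.piecewise_eq_of_mem _ _ _ hi)]
    unfold clipAndNoise
    rw [clippedMean_congr (X' := X')
      (fun i hi => Finset.piecewise_eq_of_notMem _ _ _ (Finset.mem_compl.1 hi))]
  have hround : ∀ (X : Dataset n m d) (x : Fin (d + 1) → ℝ),
      ∫⁻ X', clipAndNoise B ρ σ (coarseFun ε δ X x) X' S ∂(dataLaw n m D) ≤
        ENNReal.ofReal (1 / 10) +
          {x | ¬ ‖coarseFun ε δ X x - μ‖ ≤ 4 * coarseRadius m d}.indicator 1 x := by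
    intro X x
    by_cases hx : ‖coarseFun ε δ X x - μ‖ ≤ 4 * coarseRadius m d
    · exact (lintegral_clipAndNoise_le hm hd hint hk2 hk hρ0 hσ0 hα hρ (hx.trans hu) hbias
        (firstHalf_compl_nonempty hn) hvar hnoise).trans le_self_add
    · rw [Set.indicator_of_mem (by exact hx)]
      refine le_trans ?_ le_add_self
      calc _ ≤ ∫⁻ _ : Dataset n m d, 1 ∂(dataLaw n m D) := lintegral_mono fun X' => by
            have : IsProbabilityMeasure (clipAndNoise B ρ σ (coarseFun ε δ X x) X') :=
              Measure.isProbabilityMeasure_map (by fun_prop)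
            exact prob_le_one
        _ = _ := by simp
  have hswap : ∀ X : Dataset n m d, ∫⁻ X', twoStageKernel n m d ε δ ρ
      ((firstHalf n).piecewise X X') S ∂(dataLaw n m D) ≤ ENNReal.ofReal (1 / 10) +
        gaussPi (Fin (d + 1)) {x | ¬ ‖coarseFun ε δ X x - μ‖ ≤ 4 * coarseRadius m d} := by
    intro X
    simp_rw [hkey]
    have hmj : Measurable fun p : Dataset n m d × (Fin (d + 1) → ℝ) =>
        clipAndNoise B ρ σ (coarseFun ε δ X p.2) p.1 S :=
      measurable_comp₂ (F := fun u X => clipAndNoise B ρ σ u X S)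
        (measurable_clipAndNoise_apply B ρ σ hS)
        ((measurable_coarseFun_right ε δ X).comp measurable_snd) measurable_fst
    rw [lintegral_lintegral_swap hmj.aemeasurable]
    refine (lintegral_mono (hround X)).trans (le_of_eq ?_)
    rw [lintegral_add_left measurable_const, lintegral_indicator_one (hbad X)]
    simp
  have hM : Measurable fun X => twoStageKernel n m d ε δ ρ X S :=
    (twoStageKernel n m d ε δ ρ).measurable_coe hS
  calc _ = ∫⁻ X, ∫⁻ X', twoStageKernel n m d ε δ ρ ((firstHalf n).piecewise X X') S
          ∂(dataLaw n m D) ∂(dataLaw n m D) :=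
        lintegral_pi_piecewise (Measure.pi fun _ : Fin m => D) (firstHalf n) hM
    _ ≤ ∫⁻ X, (ENNReal.ofReal (1 / 10) + gaussPi (Fin (d + 1))
          {x | ¬ ‖coarseFun ε δ X x - μ‖ ≤ 4 * coarseRadius m d}) ∂(dataLaw n m D) :=
        lintegral_mono hswap
    _ ≤ ENNReal.ofReal (1 / 10) + ENNReal.ofReal (21 / 200) := by
        rw [lintegral_add_left measurable_const, lintegral_const, measure_univ, mul_one]
        gcongr
        exact lintegral_coarseFun_fail_le hm hd hint hk2 hk hε h1 h2
    _ ≤ ENNReal.ofReal (1 / 3) := by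
        rw [← ENNReal.ofReal_add (by norm_num) (by norm_num)]
        exact ENNReal.ofReal_le_ofReal (by norm_num)

theorem estimatesMean_twoStageKernel (hn : 1 ≤ n) (hm : 1 ≤ m) (hd : 1 ≤ d)
    (hk2 : 2 < k) {ε δ ρ α : ℝ} (hε : 0 < ε) (hρ0 : 0 < ρ) (hα : 0 < α)
    (h1 : 13 + 45 * noiseMult ε δ * (1 + Real.sqrt (Real.log (2 / δ))) ≤ (firstHalf n).card)
    (h2 : 560 * noiseMult ε δ * Real.sqrt d ≤ (firstHalf n).card)
    (hρ : 16 * k ^ 2 * Real.sqrt (d / m) * Real.log (2 + m * d) ≤ ρ / 2)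
    (hu : 4 * coarseRadius m d ≤ ρ / 2)
    (hbias : tailConst k * ((d : ℝ) ^ (k / 2) / (m * (ρ / 2)) ^ (k - 1)) ≤ α / 3)
    (hvar : d / m / ((firstHalf n)ᶜ.card * (α / 3) ^ 2) ≤ 1 / 20)
    (hnoise : roundNoise n ε δ ρ ^ 2 * d / (α / 3) ^ 2 ≤ 1 / 20) (R : ℝ) :
    EstimatesMean (twoStageKernel n m d ε δ ρ) k R α :=
  estimatesMean_of_fail_le fun _ _ hint hk =>
    lintegral_twoStageKernel_fail_le hn hm hd hint hk2 hk hε hρ0 hα h1 h2 hρ hu hbias hvar hnoise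

theorem estimatesMean_coarseKernel (hm : 1 ≤ m) (hd : 1 ≤ d)
    (hk2 : 2 < k) {ε δ : ℝ} (hε : 0 < ε)
    (h1 : 13 + 45 * noiseMult ε δ * (1 + Real.sqrt (Real.log (2 / δ))) ≤ (firstHalf n).card)
    (h2 : 560 * noiseMult ε δ * Real.sqrt d ≤ (firstHalf n).card) {β : ℝ}
    (hβ : 4 * coarseRadius m d ≤ β) (R : ℝ) :
    EstimatesMean (coarseKernel n m d ε δ) k R β := by
  refine estimatesMean_of_fail_le fun D hD hint hk => ?_
  refine le_trans (lintegral_mono fun X => ?_)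
    ((lintegral_coarseFun_fail_le (n := n) hm hd hint hk2 hk hε h1 h2).trans
      (ENNReal.ofReal_le_ofReal (by norm_num)))
  rw [coarseKernel_apply, Measure.map_apply (measurable_coarseFun_right ε δ X)
    (measurableSet_le (by fun_prop) measurable_const).compl]
  exact measure_mono fun x hx hle => hx (hle.trans hβ)

end Accuracy

/-! ### The mechanism for large `δ` -/

section Trivial

variable {n m d : ℕ}

/-- For `δ ≥ 3/4` one may release the empirical mean with probability `3/4`. -/
noncomputable def releaseFun (X : Dataset n m d) (ω : ℕ → ℝ) : Vec d :=
  if 0 < ω 0 ∨ 0 < ω 1 then (n : ℝ)⁻¹ • ∑ i, sampleMean (X i) else 0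

theorem measurable_releaseFun :
    Measurable (Function.uncurry (releaseFun : Dataset n m d → (ℕ → ℝ) → Vec d)) := by
  have h : Measurable fun p : Dataset n m d × (ℕ → ℝ) =>
      (n : ℝ)⁻¹ • ∑ i, sampleMean (p.1 i) := by
    have h' : Measurable fun p : Dataset n m d × (ℕ → ℝ) => ∑ i, sampleMean (p.1 i) :=
      Finset.measurable_sum _ fun i _ =>
        measurable_sampleMean.comp ((measurable_pi_apply i).comp measurable_fst)
    exact h'.const_smul (n : ℝ)⁻¹
  refine Measurable.ite ?_ h measurable_const
  have h0 : ∀ i, MeasurableSet {p : Dataset n m d × (ℕ → ℝ) | 0 < p.2 i} := fun i =>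
    measurableSet_lt measurable_const (by fun_prop)
  exact (h0 0).union (h0 1)

noncomputable def releaseKernel (n m d : ℕ) : Kernel (Dataset n m d) (Vec d) :=
  have : IsProbabilityMeasure RealRAM.drawLaw := by unfold RealRAM.drawLaw; infer_instance
  lawKernel RealRAM.drawLaw releaseFun measurable_releaseFun

instance : IsMarkovKernel (releaseKernel n m d) := by
  have : IsProbabilityMeasure RealRAM.drawLaw := by unfold RealRAM.drawLaw; infer_instance
  unfold releaseKernel; infer_instance

theorem releaseKernel_apply (X : Dataset n m d) {S : Set (Vec d)} (hS : MeasurableSet S) :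
    releaseKernel n m d X S = RealRAM.drawLaw {ω | releaseFun X ω ∈ S} := by
  change RealRAM.drawLaw.map (releaseFun X) S = _
  rw [Measure.map_apply measurable_releaseFun.of_uncurry_left hS]
  rfl

theorem gaussianReal_Ioi_zero : gaussianReal 0 1 (Set.Ioi 0) = ENNReal.ofReal (1 / 2) := by
  have hsym : gaussianReal 0 1 (Set.Iio 0) = gaussianReal 0 1 (Set.Ioi 0) := by
    have h := gaussianReal_map_neg (μ := 0) (v := 1)
    rw [neg_zero] at h
    conv_lhs => rw [← h]
    rw [Measure.map_apply measurable_neg measurableSet_Iio]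
    congr 1
    ext x
    simp
  have hna : NullSingletonClass (gaussianReal 0 1) :=
    nullSingletonClass_gaussianReal one_ne_zero
  have hu : gaussianReal 0 1 (Set.Ioi 0) + gaussianReal 0 1 (Set.Iio 0) = 1 := by
    have := prob_add_prob_compl (μ := gaussianReal 0 1) (measurableSet_Ioi (a := (0 : ℝ)))
    rwa [Set.compl_Ioi, ← measure_congr Iio_ae_eq_Iic] at this
  rw [hsym, ← two_mul] at hu
  have : gaussianReal 0 1 (Set.Ioi 0) = 2⁻¹ := ENNReal.eq_inv_of_mul_eq_one_left
    (by rw [mul_comm]; exact hu)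
  rw [this]
  rw [ENNReal.ofReal_div_of_pos (by norm_num)]
  simp

/-- The signs of two Gaussian draws are two fair coins. -/
theorem drawLaw_not_pos : RealRAM.drawLaw {ω | ¬ (0 < ω 0 ∨ 0 < ω 1)} = ENNReal.ofReal (1 / 4) := by
  have hset : {ω : ℕ → ℝ | ¬ (0 < ω 0 ∨ 0 < ω 1)} =
      Set.pi (↑({0, 1} : Finset ℕ)) fun _ => Set.Iic (0 : ℝ) := by
    ext ω
    simp [not_or]
  have hI : gaussianReal 0 1 (Set.Iic 0) = ENNReal.ofReal (1 / 2) := by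
    have h := prob_compl_eq_one_sub (μ := gaussianReal 0 1) (measurableSet_Ioi (a := (0 : ℝ)))
    rw [Set.compl_Ioi, gaussianReal_Ioi_zero] at h
    rw [h, ← ENNReal.ofReal_one, ← ENNReal.ofReal_sub _ (by norm_num)]
    norm_num
  rw [hset, RealRAM.drawLaw, Measure.infinitePi_pi _ fun _ _ => measurableSet_Iic]
  simp only [hI, Finset.prod_const]
  rw [Finset.card_pair (by norm_num), ← ENNReal.ofReal_pow (by norm_num)]
  norm_num

/-- Off an event of probability `3/4 ≤ δ` the output is `0` whatever the data. -/
theorem personLevelDP_releaseKernel {ε δ : ℝ} (hε : 0 < ε) (hδ : 3 / 4 ≤ δ) :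
    PersonLevelDP (releaseKernel n m d) ε δ := by
  intro X X' _ S hS
  rw [releaseKernel_apply X hS, releaseKernel_apply X' hS]
  have hp : IsProbabilityMeasure RealRAM.drawLaw := by unfold RealRAM.drawLaw; infer_instance
  have h34 : RealRAM.drawLaw {ω | 0 < ω 0 ∨ 0 < ω 1} = ENNReal.ofReal (3 / 4) := by
    have h0 : ∀ i, MeasurableSet {ω : ℕ → ℝ | 0 < ω i} := fun i =>
      measurableSet_lt measurable_const (by fun_prop)
    have hm : MeasurableSet {ω : ℕ → ℝ | ¬ (0 < ω 0 ∨ 0 < ω 1)} := ((h0 0).union (h0 1)).compl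
    have h := prob_compl_eq_one_sub (μ := RealRAM.drawLaw) hm
    rw [drawLaw_not_pos, ← ENNReal.ofReal_one, ← ENNReal.ofReal_sub _ (by norm_num)] at h
    have h2 : {ω : ℕ → ℝ | ¬ (0 < ω 0 ∨ 0 < ω 1)}ᶜ = {ω | 0 < ω 0 ∨ 0 < ω 1} := by
      ext ω; exact not_not
    rw [h2] at h
    rw [h]; norm_num
  calc RealRAM.drawLaw {ω | releaseFun X ω ∈ S}
      ≤ RealRAM.drawLaw ({ω | releaseFun X' ω ∈ S} ∪ {ω | 0 < ω 0 ∨ 0 < ω 1}) := by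
        refine measure_mono fun ω hω => ?_
        by_cases h : 0 < ω 0 ∨ 0 < ω 1
        · exact Or.inr h
        · refine Or.inl ?_
          rw [Set.mem_ofPred_eq, releaseFun, if_neg h] at hω ⊢
          exact hω
    _ ≤ RealRAM.drawLaw {ω | releaseFun X' ω ∈ S} + ENNReal.ofReal (3 / 4) :=
        (measure_union_le _ _).trans (by rw [h34])
    _ ≤ _ := by
        gcongr
        refine le_mul_of_one_le_left zero_le ?_
        rw [ENNReal.one_le_ofReal]
        exact Real.one_le_exp hε.le

/-- Nothing is released with probability `1/4`. Chebyshev's inequality for the empirical mean may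
take the remaining `1/12` of the allowed `1/3`. -/
theorem estimatesMean_releaseKernel (hn : 1 ≤ n) (hm : 1 ≤ m) {k α : ℝ} (hk2 : 2 < k) (hα : 0 < α)
    (h : d / m / (n * α ^ 2) ≤ (1 : ℝ) / 12) (R : ℝ) :
    EstimatesMean (releaseKernel n m d) k R α := by
  refine estimatesMean_of_fail_le fun D hD hint hk => ?_
  have hB : (Finset.univ : Finset (Fin n)).Nonempty := ⟨⟨0, hn⟩, Finset.mem_univ _⟩
  have hav := dataLaw_average_ge_le (n := n) (m := m) (D := D) measurable_sampleMean
    (integrable_sampleMean hint)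
    (lintegral_norm_sampleMean_sq_le hm hint hk2 hk) (by positivity) hα hB
  rw [integral_sampleMean hm hint, Finset.card_univ, Fintype.card_fin] at hav
  set μ := ∫ x, x ∂D with hμ
  set T : Set (Dataset n m d) := {X | α ≤ ‖(n : ℝ)⁻¹ • ∑ i, sampleMean (X i) - μ‖} with hT
  have hp : IsProbabilityMeasure RealRAM.drawLaw := by unfold RealRAM.drawLaw; infer_instance
  have hpt : ∀ X : Dataset n m d, releaseKernel n m d X {y | ‖y - μ‖ ≤ α}ᶜ ≤
      T.indicator 1 X + ENNReal.ofReal (1 / 4) := by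
    intro X
    by_cases hX : X ∈ T
    · rw [Set.indicator_of_mem hX]
      exact prob_le_one.trans le_self_add
    · rw [Set.indicator_of_notMem hX, zero_add, ← drawLaw_not_pos,
        releaseKernel_apply X (measurableSet_le (by fun_prop) measurable_const).compl]
      refine measure_mono fun ω hω hpos => hω ?_
      rw [Set.mem_ofPred_eq, releaseFun, if_pos hpos]
      exact (not_le.1 hX).le
  calc _ ≤ ∫⁻ X, (T.indicator 1 X + ENNReal.ofReal (1 / 4)) ∂(dataLaw n m D) := lintegral_mono hpt
    _ ≤ ENNReal.ofReal (1 / 12) + ENNReal.ofReal (1 / 4) := by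
        rw [lintegral_add_right _ measurable_const, lintegral_const, measure_univ, mul_one]
        gcongr
        exact (lintegral_indicator_one_le _).trans (hav.trans (ENNReal.ofReal_le_ofReal h))
    _ = ENNReal.ofReal (1 / 3) := by
        rw [← ENNReal.ofReal_add (by norm_num) (by norm_num)]
        norm_num

end Trivial

/-! ### The choice of parameters -/

section Parameters

/-- The clipping radius, with a constant factor `K`. -/
noncomputable def clipRadius (K : ℕ) (k : ℝ) (m d : ℕ) (α : ℝ) : ℝ :=
  K * (Real.sqrt (d / m) * Real.log (2 + m * d) +
    Real.exp (k / (2 * (k - 1)) * Real.log d - Real.log α / (k - 1)) / m)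

theorem one_le_log_two_add {m d : ℕ} (hm : 1 ≤ m) (hd : 1 ≤ d) : 1 ≤ Real.log (2 + m * d) := by
  have hm1 : (1 : ℝ) ≤ m := by exact_mod_cast hm
  have hd1 : (1 : ℝ) ≤ d := by exact_mod_cast hd
  rw [Real.le_log_iff_exp_le (by positivity)]
  have := Real.exp_one_lt_three
  nlinarith

variable {K m d : ℕ} {k α : ℝ}

theorem sqrt_mul_le_clipRadius : K * (Real.sqrt (d / m) * Real.log (2 + m * d)) ≤
    clipRadius K k m d α := by
  unfold clipRadius
  gcongr
  have : 0 ≤ Real.exp (k / (2 * (k - 1)) * Real.log d - Real.log α / (k - 1)) / m := by positivity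
  linarith

theorem clipRadius_pos (hK : 1 ≤ K) (hm : 1 ≤ m) : 0 < clipRadius K k m d α := by
  have hm0 : (0 : ℝ) < m := by exact_mod_cast hm
  have hK0 : (0 : ℝ) < K := by exact_mod_cast hK
  have hL : 0 ≤ Real.log (2 + m * d) := Real.log_nonneg (by
    have : (0 : ℝ) ≤ m * d := by positivity
    linarith)
  unfold clipRadius
  positivity

/-- The machine has exponentials and logarithms but no real powers, hence the left-hand form in
`clipRadius`. -/
theorem exp_log_eq_rpow (hd : 1 ≤ d) (hα : 0 < α) :
    Real.exp (k / (2 * (k - 1)) * Real.log d - Real.log α / (k - 1)) =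
      (d : ℝ) ^ (k / (2 * (k - 1))) * α ^ (-(1 / (k - 1))) := by
  have hd0 : (0 : ℝ) < d := by exact_mod_cast hd
  rw [Real.rpow_def_of_pos hd0, Real.rpow_def_of_pos hα, ← Real.exp_add]
  congr 1
  ring

/-- The second summand `E / m` of the radius is tuned so that `E ^ (k - 1) = d ^ (k / 2) / α`, which
turns the tail bound into a multiple of `α`. Since `k - 1 ≥ 1` and `K / 2 ≥ 1`, the power of `K / 2`
is at least `K / 2` and makes the multiple at most `1/3`. -/
theorem clipRadius_bias (hk2 : 2 < k) (hm : 1 ≤ m) (hd : 1 ≤ d) (hα : 0 < α)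
    (hK : 6 * tailConst k ≤ K) (hK2 : 2 ≤ K) :
    tailConst k * ((d : ℝ) ^ (k / 2) / (m * (clipRadius K k m d α / 2)) ^ (k - 1)) ≤ α / 3 := by
  have hd0 : (0 : ℝ) < d := by exact_mod_cast hd
  have hm0 : (0 : ℝ) < m := by exact_mod_cast hm
  have hK2' : (2 : ℝ) ≤ K := by exact_mod_cast hK2
  have ht := tailConst_pos (k := k)
  set E := Real.exp (k / (2 * (k - 1)) * Real.log d - Real.log α / (k - 1)) with hE
  have hE0 : 0 < E := Real.exp_pos _
  have hEk : E ^ (k - 1) = (d : ℝ) ^ (k / 2) * α⁻¹ := by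
    rw [hE, exp_log_eq_rpow hd hα, Real.mul_rpow (by positivity) (by positivity),
      ← Real.rpow_mul hd0.le, ← Real.rpow_mul hα.le, ← Real.rpow_neg_one α]
    have hk1 : k - 1 ≠ 0 := by linarith
    congr 2
    · field_simp
    · field_simp
  have hlow : (K : ℝ) / 2 * E ≤ m * (clipRadius K k m d α / 2) := by
    have hL : 0 ≤ Real.sqrt (d / m) * Real.log (2 + m * d) :=
      mul_nonneg (Real.sqrt_nonneg _) (zero_le_one.trans (one_le_log_two_add hm hd))
    unfold clipRadius
    rw [← hE]
    calc (K : ℝ) / 2 * E = m * (K * (0 + E / m) / 2) := by field_simp; ring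
      _ ≤ _ := by gcongr
  have hKp : (K : ℝ) / 2 ≤ (K / 2 : ℝ) ^ (k - 1) := by
    conv_lhs => rw [← Real.rpow_one (K / 2 : ℝ)]
    exact Real.rpow_le_rpow_of_exponent_le (by linarith) (by linarith)
  have hpow : (K : ℝ) / 2 * ((d : ℝ) ^ (k / 2) * α⁻¹) ≤
      (m * (clipRadius K k m d α / 2)) ^ (k - 1) := by
    calc _ ≤ (K / 2 : ℝ) ^ (k - 1) * E ^ (k - 1) := by rw [hEk]; gcongr
      _ = (K / 2 * E : ℝ) ^ (k - 1) := (Real.mul_rpow (by positivity) hE0.le).symm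
      _ ≤ _ := Real.rpow_le_rpow (by positivity) hlow (by linarith)
  have hdk : 0 < (d : ℝ) ^ (k / 2) := by positivity
  have hden : 0 < (K : ℝ) / 2 * ((d : ℝ) ^ (k / 2) * α⁻¹) := by positivity
  calc _ ≤ tailConst k * ((d : ℝ) ^ (k / 2) / ((K : ℝ) / 2 * ((d : ℝ) ^ (k / 2) * α⁻¹))) := by
        gcongr
    _ = 2 * tailConst k / K * α := by field_simp
    _ ≤ 1 / 3 * α := by
        refine mul_le_mul_of_nonneg_right ?_ hα.le
        rw [div_le_iff₀ (by linarith)]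
        linarith
    _ = α / 3 := by ring

/-- Away from `δ = 1` the number `log (1/δ)` is bounded below, so it absorbs the additive constants
in the noise multiplier and the halving and capping of `δ`. -/
theorem sqrt_log_le {δ : ℝ} (hδ : 0 < δ) (hδ1 : δ < 3 / 4) :
    1 / 4 ≤ Real.log (1 / δ) ∧
    1 + Real.sqrt (Real.log (2 / (min δ (1 / 2) / 2))) ≤ 5 * Real.sqrt (Real.log (1 / δ)) := by
  have hΛ : 1 / 4 ≤ Real.log (1 / δ) := by
    have h1 := Real.one_sub_inv_le_log_of_pos (x := 1 / δ) (by positivity)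
    rw [one_div, inv_inv, ← one_div] at h1
    linarith
  refine ⟨hΛ, ?_⟩
  have hl2 := Real.log_two_lt_d9
  have hsplit : Real.log (2 / (min δ (1 / 2) / 2)) = 2 * Real.log 2 + Real.log (1 / min δ (1 / 2)) := by
    have h0 : 0 < min δ (1 / 2) := lt_min hδ (by norm_num)
    rw [show 2 / (min δ (1 / 2) / 2) = 2 * (2 * (1 / min δ (1 / 2))) by field_simp,
      Real.log_mul (by norm_num) (by positivity), Real.log_mul (by norm_num) (by positivity)]
    ring
  -- The factor `9` is decided by `δ` in `[1/2, 3/4)`, where the left side is `3 log 2 < 9/4`.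
  have hle : Real.log (2 / (min δ (1 / 2) / 2)) ≤ 9 * Real.log (1 / δ) := by
    rw [hsplit]
    rcases le_total δ (1 / 2) with h | h
    · rw [min_eq_left h]; linarith
    · rw [min_eq_right h, show (1 : ℝ) / (1 / 2) = 2 by norm_num]; linarith
  have h1 : Real.sqrt (Real.log (2 / (min δ (1 / 2) / 2))) ≤ 3 * Real.sqrt (Real.log (1 / δ)) := by
    rw [show (3 : ℝ) * Real.sqrt (Real.log (1 / δ)) = Real.sqrt (9 * Real.log (1 / δ)) by
      rw [Real.sqrt_mul (by norm_num), show (9 : ℝ) = 3 ^ 2 by norm_num, Real.sqrt_sq (by norm_num)]]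
    exact Real.sqrt_le_sqrt hle
  have h2 : 1 / 2 ≤ Real.sqrt (Real.log (1 / δ)) := Real.le_sqrt_of_sq_le (by linarith)
  linarith

theorem sampleBound_term_nonneg {ε δ : ℝ} (hε : 0 < ε) (hα : 0 < α) (hδ : δ ≤ 1) (hδ0 : 0 < δ) :
    0 ≤ (d : ℝ) / (α ^ 2 * m) ∧
    0 ≤ d * Real.log (1 / δ) ^ (1 / 2 : ℝ) / (α * (m : ℝ) ^ (1 / 2 : ℝ) * ε) ∧
    0 ≤ (d : ℝ) ^ (1 + 1 / (2 * k - 2)) * Real.log (1 / δ) ^ (1 / 2 : ℝ)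
        / (α ^ (k / (k - 1)) * m * ε) ∧
    0 ≤ (d : ℝ) ^ (1 / 2 : ℝ) * Real.log (1 / δ) ^ (3 / 2 : ℝ) / ε := by
  have hΛ : 0 ≤ Real.log (1 / δ) := Real.log_nonneg (by rw [le_div_iff₀ hδ0]; linarith)
  refine ⟨?_, ?_, ?_, ?_⟩ <;> positivity

set_option maxHeartbeats 1000000 in
/-- For `n` above the sample complexity, the parameters of both stages satisfy the conditions that
their analysis needs. -/
theorem twoStage_conditions {n : ℕ} {ε δ : ℝ} (hm : 1 ≤ m) (hd : 1 ≤ d) (hk2 : 2 < k) (hα : 0 < α)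
    (hε : 0 < ε) (hε1 : ε ≤ 1) (hδ : 0 < δ) (hδ1 : δ < 3 / 4) (hK : 1 ≤ K)
    (hn : 200000 * K * Real.log (2 + m * d) ^ 1 * sampleBound k m d ε δ α ≤ n) :
    (13 + 45 * noiseMult (min ε 1 / 2) (min δ (1 / 2) / 2) *
      (1 + Real.sqrt (Real.log (2 / (min δ (1 / 2) / 2)))) ≤ (firstHalf n).card) ∧
    (560 * noiseMult (min ε 1 / 2) (min δ (1 / 2) / 2) * Real.sqrt d ≤ (firstHalf n).card) ∧
    (d / m / ((firstHalf n)ᶜ.card * (α / 3) ^ 2) ≤ (1 : ℝ) / 20) ∧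
    (roundNoise n (min ε 1 / 2) (min δ (1 / 2) / 2) (clipRadius K k m d α) ^ 2 * d / (α / 3) ^ 2 ≤
      1 / 20) := by
  have hd0 : (1 : ℝ) ≤ d := by exact_mod_cast hd
  have hm0 : (0 : ℝ) < m := by exact_mod_cast hm
  have hK1 : (1 : ℝ) ≤ K := by exact_mod_cast hK
  have hL := one_le_log_two_add hm hd
  obtain ⟨hΛ, hq⟩ := sqrt_log_le hδ hδ1
  obtain ⟨hT1, hT2, hT3, hT4⟩ := sampleBound_term_nonneg (k := k) (d := d) (m := m) hε hα
    (show δ ≤ 1 by linarith) hδ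
  unfold sampleBound at hn
  set T1 := (d : ℝ) / (α ^ 2 * m) with hT1d
  set T2 := d * Real.log (1 / δ) ^ (1 / 2 : ℝ) / (α * (m : ℝ) ^ (1 / 2 : ℝ) * ε) with hT2d
  set T3 := (d : ℝ) ^ (1 + 1 / (2 * k - 2)) * Real.log (1 / δ) ^ (1 / 2 : ℝ)
        / (α ^ (k / (k - 1)) * m * ε) with hT3d
  set T4 := (d : ℝ) ^ (1 / 2 : ℝ) * Real.log (1 / δ) ^ (3 / 2 : ℝ) / ε with hT4d
  set L := Real.log (2 + m * d) with hLd
  set Λ := Real.log (1 / δ) with hΛd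
  rw [pow_one] at hn
  have hs : noiseMult (min ε 1 / 2) (min δ (1 / 2) / 2) =
      8 * (1 + Real.sqrt (Real.log (2 / (min δ (1 / 2) / 2)))) / ε := by
    unfold noiseMult
    rw [min_eq_left hε1]; field_simp; ring
  set q := 1 + Real.sqrt (Real.log (2 / (min δ (1 / 2) / 2))) with hqd
  have hq0 : 0 < q := by positivity
  -- All terms of `sampleBound` are nonnegative, so `n` dominates a large multiple of each of them
  -- separately.
  have hbnd : ∀ c T : ℝ, 0 ≤ T → 0 ≤ c → c ≤ 200000 * K * L →
      T ≤ T1 + T2 + T3 + T4 → c * T ≤ n := fun c T hT hc hcK hTT =>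
    (mul_le_mul hcK hTT hT (by positivity)).trans hn
  have hKL : 1 ≤ K * L := one_le_mul_of_one_le_of_one_le hK1 hL
  have hn4 := hbnd 200000 T4 hT4 (by norm_num) (by linarith) (by linarith)
  have hn1 := hbnd 200000 T1 hT1 (by norm_num) (by linarith) (by linarith)
  have hΛ0 : 0 < Λ := by linarith
  have hr2 : 1 / 2 ≤ Real.sqrt Λ := Real.le_sqrt_of_sq_le (by linarith)
  have hΛ32 : Λ ^ (3 / 2 : ℝ) = Λ * Real.sqrt Λ := by
    rw [Real.sqrt_eq_rpow, show (3 / 2 : ℝ) = 1 + 1 / 2 by norm_num, Real.rpow_add hΛ0,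
      Real.rpow_one]
  have hsq : Real.sqrt Λ ^ 2 = Λ := Real.sq_sqrt hΛ0.le
  have hT4' : T4 = Real.sqrt d * (Λ * Real.sqrt Λ) / ε := by
    rw [hT4d, hΛ32, ← Real.sqrt_eq_rpow]
  have hd1 : 1 ≤ Real.sqrt d := Real.one_le_sqrt.2 hd0
  -- The coarse stage needs `n` above multiples of `log (1/δ) / ε` and `√(d log (1/δ)) / ε`. The
  -- last term of the sample bound covers both, because `log (1/δ) ≥ 1/4`.
  have hΛT : Λ / ε ≤ 2 * T4 := by
    rw [hT4', ← mul_div_assoc]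
    gcongr
    have h1 : 1 * (1 / 2) ≤ Real.sqrt d * Real.sqrt Λ :=
      mul_le_mul hd1 hr2 (by norm_num) (by positivity)
    calc Λ = 2 * ((1 * (1 / 2)) * Λ) := by ring
      _ ≤ 2 * (Real.sqrt d * Real.sqrt Λ * Λ) := by gcongr
      _ = _ := by ring
  have hrT : Real.sqrt d * Real.sqrt Λ / ε ≤ 4 * T4 := by
    rw [hT4', ← mul_div_assoc]
    refine div_le_div_of_nonneg_right ?_ hε.le
    calc Real.sqrt d * Real.sqrt Λ = Real.sqrt d * Real.sqrt Λ * 1 := (mul_one _).symm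
      _ ≤ Real.sqrt d * Real.sqrt Λ * (4 * Λ) := by gcongr; linarith
      _ = _ := by ring
  have hT41 : 1 ≤ 8 * T4 := by
    have : Λ ≤ Λ / ε := le_div_self hΛ0.le hε hε1
    linarith
  -- The first half has `n / 2` people rounded down.
  have hcA : (n : ℝ) / 2 - 1 / 2 ≤ (firstHalf n).card := by
    rw [card_firstHalf]
    have : n ≤ 2 * (n / 2) + 1 := by omega
    have : (n : ℝ) ≤ 2 * (n / 2 : ℕ) + 1 := by exact_mod_cast this
    linarith
  have hcB : (n : ℝ) / 2 ≤ (firstHalf n)ᶜ.card := by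
    rw [card_firstHalf_compl]
    have : n ≤ 2 * (n - n / 2) := by omega
    have : (n : ℝ) ≤ 2 * (n - n / 2 : ℕ) := by exact_mod_cast this
    linarith
  have hn0 : (0 : ℝ) < n := by linarith
  refine ⟨?_, ?_, ?_, ?_⟩
  · refine le_trans ?_ hcA
    have : 45 * noiseMult (min ε 1 / 2) (min δ (1 / 2) / 2) * q ≤ 9000 * (Λ / ε) := by
      rw [hs, show 45 * (8 * q / ε) * q = 360 * q ^ 2 / ε by ring,
        show 9000 * (Λ / ε) = 360 * (5 * Real.sqrt Λ) ^ 2 / ε by rw [mul_pow, hsq]; ring]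
      gcongr
    linarith
  · refine le_trans ?_ hcA
    have : 560 * noiseMult (min ε 1 / 2) (min δ (1 / 2) / 2) * Real.sqrt d ≤
        22400 * (Real.sqrt d * Real.sqrt Λ / ε) := by
      rw [hs, show 560 * (8 * q / ε) * Real.sqrt d = 4480 * (q * Real.sqrt d) / ε by ring,
        show 22400 * (Real.sqrt d * Real.sqrt Λ / ε) =
          4480 * ((5 * Real.sqrt Λ) * Real.sqrt d) / ε by ring]
      gcongr
    linarith
  · have hTd : (d : ℝ) / m = T1 * α ^ 2 := by rw [hT1d]; field_simp
    have hcB0 : (0 : ℝ) < (firstHalf n)ᶜ.card := by linarith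
    rw [hTd, div_le_iff₀ (by positivity)]
    have : T1 * 360 ≤ 2 * (firstHalf n)ᶜ.card := by linarith
    calc T1 * α ^ 2 = T1 * 360 * (α ^ 2 / 360) := by ring
      _ ≤ 2 * (firstHalf n)ᶜ.card * (α ^ 2 / 360) := by gcongr
      _ = _ := by ring
  · have hT23 := hbnd (200000 * K * L) (T2 + T3) (by linarith) (by positivity) le_rfl (by linarith)
    set ρ := clipRadius K k m d α with hρd
    have hρ0 : 0 < ρ := clipRadius_pos hK hm
    -- The two middle terms of the sample bound are exactly the noise costs of the two summands of
    -- the radius; the first one carries the logarithm.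
    have hρT : ρ * Real.sqrt d * Real.sqrt Λ / ε = K * (L * T2 + T3) * α := by
      have e2 : Real.sqrt (d / m) * Real.sqrt d * Real.sqrt Λ / ε = T2 * α := by
        rw [hT2d, ← Real.sqrt_eq_rpow, ← Real.sqrt_eq_rpow, Real.sqrt_div (by positivity)]
        have : Real.sqrt d * Real.sqrt d = d := Real.mul_self_sqrt (by positivity)
        have hm' : Real.sqrt m ≠ 0 := by positivity
        field_simp
        linear_combination this
      have e3 : Real.exp (k / (2 * (k - 1)) * Real.log d - Real.log α / (k - 1)) / m * Real.sqrt d *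
          Real.sqrt Λ / ε = T3 * α := by
        have hk1 : k - 1 ≠ 0 := by linarith
        have h2k : 2 * k - 2 ≠ 0 := by linarith
        rw [exp_log_eq_rpow hd hα, hT3d, ← Real.sqrt_eq_rpow]
        have ed : (d : ℝ) ^ (1 + 1 / (2 * k - 2)) = (d : ℝ) ^ (k / (2 * (k - 1))) * Real.sqrt d := by
          rw [Real.sqrt_eq_rpow, ← Real.rpow_add (by linarith)]
          congr 1
          rw [show 2 * k - 2 = 2 * (k - 1) by ring]
          field_simp
          ring
        have ea : α ^ (-(1 / (k - 1))) = α / α ^ (k / (k - 1)) := by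
          rw [eq_div_iff (by positivity), ← Real.rpow_add hα]
          conv_rhs => rw [← Real.rpow_one α]
          congr 1
          field_simp
          ring
        rw [ed, ea]
        field_simp
      calc _ = K * (Real.sqrt (d / m) * Real.sqrt d * Real.sqrt Λ / ε * L +
            Real.exp (k / (2 * (k - 1)) * Real.log d - Real.log α / (k - 1)) / m * Real.sqrt d *
          Real.sqrt Λ / ε) := by rw [hρd, clipRadius]; ring
        _ = _ := by rw [e2, e3]; ring
    have hcB0 : (0 : ℝ) < (firstHalf n)ᶜ.card := by linarith
    -- Squared, the required bound on the noise has the constant `9 * 20 = 180`, and `14² = 196`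
    -- exceeds it.
    have hmain : 14 * (roundNoise n (min ε 1 / 2) (min δ (1 / 2) / 2) ρ * Real.sqrt d) ≤ α := by
      calc _ = 224 * (q * ρ * Real.sqrt d / ε) / (firstHalf n)ᶜ.card := by
            rw [roundNoise, hs]; ring
        _ ≤ 224 * (5 * Real.sqrt Λ * ρ * Real.sqrt d / ε) / (firstHalf n)ᶜ.card := by gcongr
        _ = 1120 * (K * (L * T2 + T3) * α) / (firstHalf n)ᶜ.card := by rw [← hρT]; ring
        _ ≤ α := by
            rw [div_le_iff₀ hcB0]
            have h3 : T3 ≤ L * T3 := le_mul_of_one_le_left hT3 hL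
            have h4 : K * (L * T2 + T3) ≤ K * (L * T2 + L * T3) := by gcongr
            have h5 : 1120 * (K * (L * T2 + T3)) ≤ (firstHalf n)ᶜ.card := by
              have : K * (L * T2 + L * T3) = K * L * (T2 + T3) := by ring
              linarith
            calc _ = 1120 * (K * (L * T2 + T3)) * α := by ring
              _ ≤ (firstHalf n)ᶜ.card * α := by gcongr
              _ = _ := mul_comm _ _
    have hrn : 0 ≤ roundNoise n (min ε 1 / 2) (min δ (1 / 2) / 2) ρ * Real.sqrt d := by
      have : 0 ≤ noiseMult (min ε 1 / 2) (min δ (1 / 2) / 2) := by rw [hs]; positivity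
      unfold roundNoise; positivity
    have hsqd : Real.sqrt (d : ℝ) ^ 2 = d := Real.sq_sqrt (by linarith)
    rw [div_le_iff₀ (by positivity)]
    calc _ = (roundNoise n (min ε 1 / 2) (min δ (1 / 2) / 2) ρ * Real.sqrt d) ^ 2 := by
          rw [mul_pow, hsqd]
      _ ≤ (α / 14) ^ 2 := by gcongr; linarith
      _ = 1 / 196 * α ^ 2 := by ring
      _ ≤ 1 / 180 * α ^ 2 := by gcongr; norm_num
      _ = _ := by ring

end Parameters

/-! ### Reasoning about real-RAM programs -/

namespace RealRAM

/-- Whether the program contains an assignment to the register. -/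
def Program.writesNat : Program → ℕ → Bool
  | .skip, _ => false
  | .setNat x _, z => x == z
  | .setReal _ _ _, _ => false
  | .gaussian _ _, _ => false
  | .seq p q, z => p.writesNat z || q.writesNat z
  | .branch _ p q, z => p.writesNat z || q.writesNat z
  | .loop _ p, z => p.writesNat z

/-- Whether the program contains an assignment to a cell of the array. -/
def Program.writesReal : Program → ℕ → Bool
  | .skip, _ => false
  | .setNat _ _, _ => false
  | .setReal a _ _, z => a == z
  | .gaussian a _, z => a == z
  | .seq p q, z => p.writesReal z || q.writesReal z
  | .branch _ p q, z => p.writesReal z || q.writesReal z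
  | .loop _ p, z => p.writesReal z

/-- The two states agree on all registers and arrays which the program does not assign to. -/
structure Agree (p : Program) (s s' : State) : Prop where
  nat : ∀ z, p.writesNat z = false → s'.nat z = s.nat z
  real : ∀ a, p.writesReal a = false → s'.real a = s.real a

theorem Agree.refl (p : Program) (s : State) : Agree p s s := ⟨fun _ _ => rfl, fun _ _ => rfl⟩

theorem Agree.trans {p : Program} {s s' s'' : State} (h : Agree p s s') (h' : Agree p s' s'') :
    Agree p s s'' :=
  ⟨fun z hz => (h'.nat z hz).trans (h.nat z hz), fun a ha => (h'.real a ha).trans (h.real a ha)⟩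

theorem Agree.mono {p q : Program} {s s' : State} (h : Agree p s s')
    (hn : ∀ z, q.writesNat z = false → p.writesNat z = false)
    (hr : ∀ a, q.writesReal a = false → p.writesReal a = false) : Agree q s s' :=
  ⟨fun z hz => h.nat z (hn z hz), fun a ha => h.real a (hr a ha)⟩

variable {ω : ℕ → ℝ}

/-- The frame rule. What a program may assign to can be read off its text, so for a concrete program
preservation of a register or an array is settled by `rfl`. -/
theorem Exec.agree {p : Program} {s s' : State} {t : ℕ} (h : Exec ω p s s' t) : Agree p s s' := by
  induction h with
  | skip s => exact Agree.refl _ _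
  | setNat s x e =>
    refine ⟨fun z hz => ?_, fun _ _ => rfl⟩
    have : z ≠ x := fun h => by simp [Program.writesNat, h] at hz
    exact Function.update_of_ne this _ _
  | setReal s a i e =>
    refine ⟨fun _ _ => rfl, fun z hz => ?_⟩
    have : z ≠ a := fun h => by simp [Program.writesReal, h] at hz
    exact Function.update_of_ne this _ _
  | gaussian s a i =>
    refine ⟨fun _ _ => rfl, fun z hz => ?_⟩
    have : z ≠ a := fun h => by simp [Program.writesReal, h] at hz
    exact Function.update_of_ne this _ _
  | seq _ _ h1 h2 =>
    refine Agree.trans (h1.mono ?_ ?_) (h2.mono ?_ ?_)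
    · exact fun z hz => (Bool.or_eq_false_iff.1 hz).1
    · exact fun z hz => (Bool.or_eq_false_iff.1 hz).1
    · exact fun z hz => (Bool.or_eq_false_iff.1 hz).2
    · exact fun z hz => (Bool.or_eq_false_iff.1 hz).2
  | branch_true _ _ h =>
    exact h.mono (fun z hz => (Bool.or_eq_false_iff.1 hz).1)
      (fun z hz => (Bool.or_eq_false_iff.1 hz).1)
  | branch_false _ _ h =>
    exact h.mono (fun z hz => (Bool.or_eq_false_iff.1 hz).2)
      (fun z hz => (Bool.or_eq_false_iff.1 hz).2)
  | loop_done _ => exact Agree.refl _ _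
  | loop_step _ _ _ h1 h2 => exact Agree.trans (h1.mono (fun _ h => h) (fun _ h => h)) h2

/-- Started in `s`, the program halts within `T` steps in a state with property `Q`. -/
def Runs (ω : ℕ → ℝ) (p : Program) (s : State) (T : ℕ) (Q : State → Prop) : Prop :=
  ∃ s' t, Exec ω p s s' t ∧ t ≤ T ∧ Q s'

namespace Runs

variable {p q : Program} {s : State} {T T' : ℕ} {Q Q' : State → Prop}

theorem weaken (h : Runs ω p s T Q) (hT : T ≤ T') (hQ : ∀ s', Agree p s s' → Q s' → Q' s') :
    Runs ω p s T' Q' :=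
  let ⟨s', t, he, ht, hq⟩ := h
  ⟨s', t, he, ht.trans hT, hQ s' he.agree hq⟩

theorem skip (hQ : Q s) (hT : 1 ≤ T) : Runs ω .skip s T Q := ⟨s, 1, .skip s, hT, hQ⟩

/-- The time bound is stated with the Boolean `Nat.ble`, so that for concrete expressions `rfl`
proves it by evaluation. -/
theorem setNat {x : ℕ} {e : NatExpr} (v : ℕ) (hv : e.eval s = v)
    (hQ : Q { s with nat := Function.update s.nat x v }) (hT : Nat.ble (e.cost + 1) T = true) :
    Runs ω (.setNat x e) s T Q :=
  ⟨_, _, .setNat s x e, Nat.le_of_ble_eq_true hT, by rw [hv]; exact hQ⟩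

theorem setReal {a : ℕ} {i : NatExpr} {e : RealExpr} (p : ℕ) (v : ℝ) (hp : i.eval s = p)
    (hv : e.eval s = v) (hQ : Q (s.write a p v)) (hT : Nat.ble (i.cost + e.cost + 1) T = true) :
    Runs ω (.setReal a i e) s T Q :=
  ⟨_, _, .setReal s a i e, Nat.le_of_ble_eq_true hT, by rw [hp, hv]; exact hQ⟩

theorem gaussian {a : ℕ} {i : NatExpr} (p : ℕ) (hp : i.eval s = p)
    (hQ : Q { s.write a p (ω s.pos) with pos := s.pos + 1 })
    (hT : Nat.ble (i.cost + 1) T = true) : Runs ω (.gaussian a i) s T Q :=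
  ⟨_, _, .gaussian s a i, Nat.le_of_ble_eq_true hT, by rw [hp]; exact hQ⟩

theorem seq {R : State → Prop} (h : Runs ω p s T R)
    (h' : ∀ s', Agree p s s' → R s' → Runs ω q s' T' Q) : Runs ω (.seq p q) s (T + T') Q :=
  let ⟨s', _, he, ht, hr⟩ := h
  let ⟨s'', _, he', ht', hq⟩ := h' s' he.agree hr
  ⟨s'', _, .seq he he', add_le_add ht ht', hq⟩

theorem branch {b : Test} {c : ℕ} (hc : Nat.ble b.cost c = true) (h : b.Holds s → Runs ω p s T Q)
    (h' : ¬ b.Holds s → Runs ω q s T Q) : Runs ω (.branch b p q) s (c + T) Q := by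
  by_cases hb : b.Holds s
  · obtain ⟨s', t, he, ht, hq⟩ := h hb
    exact ⟨s', _, .branch_true hb he, add_le_add (Nat.le_of_ble_eq_true hc) ht, hq⟩
  · obtain ⟨s', t, he, ht, hq⟩ := h' hb
    exact ⟨s', _, .branch_false hb he, add_le_add (Nat.le_of_ble_eq_true hc) ht, hq⟩

end Runs

/-- Run `p` with register `x` ranging over the natural numbers below register `y`. -/
def forLoop (x y : ℕ) (p : Program) : Program :=
  .seq (.setNat x (.const 0))
    (.loop (.natLT (.reg x) (.reg y)) (.seq p (.setNat x (.add (.reg x) (.const 1)))))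

/-- The invariant must not depend on the loop register (`hI`). One round costs `T` plus `3` for the
test and `4` for the increment; `5` pays for the initialization and the last test. Using `B` instead
of `N` lets loops over half of the people be charged as loops over all of them. -/
theorem Runs.forLoop {x y : ℕ} {p : Program} {s : State} {T N B : ℕ} (I : ℕ → State → Prop)
    (hxy : x ≠ y) (hx : p.writesNat x = false) (hy : p.writesNat y = false) (hN : s.nat y = N)
    (hNB : N ≤ B) (hI : ∀ i s v, I i s → I i { s with nat := Function.update s.nat x v })
    (h0 : I 0 s)
    (hstep : ∀ i < N, ∀ s', Agree (RealRAM.forLoop x y p) s s' → s'.nat x = i → I i s' →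
      Runs ω p s' T (I (i + 1))) :
    Runs ω (RealRAM.forLoop x y p) s (B * (T + 7) + 5) (I N) := by
  have hyf : (RealRAM.forLoop x y p).writesNat y = false := by
    simp [RealRAM.forLoop, Program.writesNat, hxy, hy]
  have hwp : ∀ z, (RealRAM.forLoop x y p).writesNat z = false → p.writesNat z = false := by
    intro z hz
    simp [RealRAM.forLoop, Program.writesNat] at hz
    exact hz.2.1
  have hwr : ∀ z, (RealRAM.forLoop x y p).writesReal z = false → p.writesReal z = false := by
    intro z hz
    simp [RealRAM.forLoop, Program.writesReal] at hz
    exact hz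
  have hag : ∀ (s : State) v, Agree (RealRAM.forLoop x y p) s
      { s with nat := Function.update s.nat x v } := by
    refine fun s v => ⟨fun z hz => ?_, fun _ _ => rfl⟩
    have : z ≠ x := fun h => by simp [RealRAM.forLoop, Program.writesNat, h] at hz
    exact Function.update_of_ne this _ _
  have key : ∀ r i (s' : State), i + r = N → Agree (RealRAM.forLoop x y p) s s' → s'.nat x = i →
      I i s' → Runs ω (.loop (.natLT (.reg x) (.reg y))
        (.seq p (.setNat x (.add (.reg x) (.const 1))))) s' (r * (T + 7) + 3) (I N) := by
    intro r
    induction r with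
    | zero =>
      intro i s' hi ha hxi hinv
      refine ⟨s', _, .loop_done ?_, ?_, ?_⟩
      · change ¬ s'.nat x < s'.nat y
        rw [hxi, ha.nat y hyf, hN]; omega
      · simp [Test.cost, NatExpr.cost]
      · rwa [← hi, add_zero]
    | succ r ih =>
      intro i s' hi ha hxi hinv
      obtain ⟨s₁, t₁, he, ht, hq⟩ := hstep i (by omega) s' ha hxi hinv
      have hx1 : s₁.nat x = i := (he.agree.nat x hx).trans hxi
      obtain ⟨s₂, t₂, he2, ht2, hq2⟩ := ih (i + 1)
        { s₁ with nat := Function.update s₁.nat x (i + 1) } (by omega)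
        ((ha.trans (he.agree.mono hwp hwr)).trans (hag _ _)) (Function.update_self ..)
        (hI _ _ _ hq)
      have heq : NatExpr.eval s₁ (.add (.reg x) (.const 1)) = i + 1 := by
        simp [NatExpr.eval, hx1]
      refine ⟨s₂, _, .loop_step ?_ (.seq he (.setNat s₁ x _)) (by rw [heq]; exact he2), ?_, hq2⟩
      · change s'.nat x < s'.nat y
        rw [hxi, ha.nat y hyf, hN]; omega
      · simp only [Test.cost, NatExpr.cost]
        rw [Nat.succ_mul]
        omega
  obtain ⟨s₂, t₂, he2, ht2, hq2⟩ := key N 0 { s with nat := Function.update s.nat x 0 } (by omega)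
    (hag _ _) (Function.update_self ..) (hI _ _ _ h0)
  refine ⟨s₂, _, .seq (.setNat s x _) he2, ?_, hq2⟩
  have := Nat.mul_le_mul_right (T + 7) hNB
  simp only [NatExpr.cost]
  omega

/-- Fill cells of an array by a loop. -/
theorem Runs.fillLoop {x y a : ℕ} {p : Program} {s : State} {T N B : ℕ} (idx : ℕ → ℕ)
    (hidx : Function.Injective idx) (g : ℕ → ℝ)
    (hxy : x ≠ y) (hx : p.writesNat x = false) (hy : p.writesNat y = false) (hN : s.nat y = N)
    (hNB : N ≤ B)
    (hstep : ∀ i < N, ∀ s', Agree (RealRAM.forLoop x y p) s s' → s'.nat x = i →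
      Runs ω p s' T fun s'' => s''.real a = Function.update (s'.real a) (idx i) (g i)) :
    Runs ω (RealRAM.forLoop x y p) s (B * (T + 7) + 5) fun s' =>
      (∀ i < N, s'.real a (idx i) = g i) ∧
      ∀ z, (∀ i < N, z ≠ idx i) → s'.real a z = s.real a z := by
  refine Runs.forLoop (fun i s' => (∀ j < i, s'.real a (idx j) = g j) ∧
    ∀ z, (∀ j < i, z ≠ idx j) → s'.real a z = s.real a z) hxy hx hy hN hNB
    (fun _ _ _ h => h) ⟨fun _ h => absurd h (Nat.not_lt_zero _), fun _ _ => rfl⟩ ?_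
  intro i hi s' ha hxi hinv
  refine (hstep i hi s' ha hxi).weaken le_rfl fun s'' _ h => ⟨fun j hj => ?_, fun z hz => ?_⟩
  · rw [h]
    rcases eq_or_ne j i with rfl | hji
    · exact Function.update_self ..
    · rw [Function.update_of_ne (hidx.ne hji)]
      exact hinv.1 j (by omega)
  · rw [h, Function.update_of_ne (hz i (Nat.lt_succ_self i))]
    exact hinv.2 z fun j hj => hz j (by omega)

/-- Compute in cell `0` of array `9` the sum of `e` with register `x` ranging below register `y`. -/
def sumLoop (x y : ℕ) (e : RealExpr) : Program :=
  .seq (.setReal 9 (.const 0) (.ofNat (.const 0)))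
    (forLoop x y (.setReal 9 (.const 0) (.add (.cell 9 (.const 0)) e)))

/-- `he` asks for the value of `e` in every state agreeing with `s` off the loop register and the
accumulator, which lets the summand be evaluated once and for all. -/
theorem Runs.sumLoop {x y : ℕ} {e : RealExpr} {s : State} {N B c : ℕ} (f : ℕ → ℝ) (hxy : x ≠ y)
    (hN : s.nat y = N) (hNB : N ≤ B) (hc : Nat.ble (e.cost + 5) c = true)
    (he : ∀ i < N, ∀ s', Agree (RealRAM.sumLoop x y e) s s' → s'.nat x = i → e.eval s' = f i) :
    Runs ω (RealRAM.sumLoop x y e) s (4 + (B * (c + 7) + 5)) fun s' =>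
      s'.real 9 0 = ∑ i ∈ Finset.range N, f i := by
  refine Runs.seq (R := fun s' => s'.real 9 0 = 0) (Runs.setReal 0 0 rfl (by simp
    [RealExpr.eval, NatExpr.eval]) (by simp [State.write]) rfl) fun s₁ ha₁ h₁ => ?_
  refine Runs.forLoop (fun i s' => s'.real 9 0 = ∑ i ∈ Finset.range i, f i) hxy rfl rfl
    ((ha₁.nat y rfl).trans hN) hNB (fun _ _ _ h => h) (by simpa using h₁) ?_
  intro i hi s' ha hxi hinv
  refine Runs.setReal 0 (∑ i ∈ Finset.range (i + 1), f i) rfl ?_ (by simp [State.write]) ?_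
  · rw [Finset.sum_range_succ, ← hinv, ← he i hi s' ?_ hxi]
    · rfl
    · refine (ha₁.mono ?_ ?_).trans (ha.mono ?_ ?_) <;>
        simp +contextual [RealRAM.sumLoop, RealRAM.forLoop, Program.writesNat, Program.writesReal]
  · refine Nat.ble_eq_true_of_le (le_trans ?_ (Nat.le_of_ble_eq_true hc))
    simp only [NatExpr.cost, RealExpr.cost]; omega

/-- The input cell of coordinate `c` of sample `j` of person `i`. -/
theorem input_sample {n m d : ℕ} (ε δ α R k : ℝ) (X : Dataset n m d) (i : Fin n) (j : Fin m)
    (c : Fin d) : (input ε δ α R k X).real 1 ((i * m + j) * d + c) = X i j c := by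
  have hval : (finProdFinEquiv (finProdFinEquiv (i, j), c) : ℕ) = (i * m + j) * d + c := by
    simp only [finProdFinEquiv_apply_val]
    ring
  have hlt : (i * m + j) * d + c < n * m * d := hval ▸ Fin.isLt _
  have hq : finProdFinEquiv (finProdFinEquiv (i, j), c) = ⟨(i * m + j) * d + c, hlt⟩ :=
    Fin.ext hval
  simp only [input, one_ne_zero, if_false, if_true]
  rw [dif_pos hlt, ← hq, Equiv.symm_apply_apply]
  simp

end RealRAM

/-! ### The program -/

namespace RealRAM

section Notation

instance : Add NatExpr := ⟨.add⟩
instance : Sub NatExpr := ⟨.sub⟩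
instance : Mul NatExpr := ⟨.mul⟩
instance (c : ℕ) : OfNat NatExpr c := ⟨.const c⟩
instance : Add RealExpr := ⟨.add⟩
instance : Sub RealExpr := ⟨.sub⟩
instance : Mul RealExpr := ⟨.mul⟩
instance : Div RealExpr := ⟨.div⟩
instance (c : ℕ) : OfNat RealExpr c := ⟨.ofNat (.const c)⟩

variable (s : State)

@[simp] theorem NatExpr.eval_reg (x : ℕ) : (NatExpr.reg x).eval s = s.nat x := rfl
@[simp] theorem NatExpr.eval_add (e f : NatExpr) : (e + f).eval s = e.eval s + f.eval s := rfl
@[simp] theorem NatExpr.eval_sub (e f : NatExpr) : (e - f).eval s = e.eval s - f.eval s := rfl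
@[simp] theorem NatExpr.eval_mul (e f : NatExpr) : (e * f).eval s = e.eval s * f.eval s := rfl
@[simp] theorem NatExpr.eval_const (c : ℕ) : (NatExpr.const c).eval s = c := rfl
@[simp] theorem NatExpr.eval_numeral (c : ℕ) : (no_index (OfNat.ofNat c) : NatExpr).eval s = c := rfl
@[simp] theorem RealExpr.eval_add (e f : RealExpr) : (e + f).eval s = e.eval s + f.eval s := rfl
@[simp] theorem RealExpr.eval_sub (e f : RealExpr) : (e - f).eval s = e.eval s - f.eval s := rfl
@[simp] theorem RealExpr.eval_mul (e f : RealExpr) : (e * f).eval s = e.eval s * f.eval s := rfl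
@[simp] theorem RealExpr.eval_div (e f : RealExpr) : (e / f).eval s = e.eval s / f.eval s := rfl
@[simp] theorem RealExpr.eval_numeral (c : ℕ) :
    (no_index (OfNat.ofNat c) : RealExpr).eval s = (c : ℝ) := rfl
@[simp] theorem RealExpr.eval_ofNat (e : NatExpr) : (RealExpr.ofNat e).eval s = (e.eval s : ℝ) := rfl
@[simp] theorem RealExpr.eval_cell (a : ℕ) (i : NatExpr) :
    (RealExpr.cell a i).eval s = s.real a (i.eval s) := rfl
@[simp] theorem RealExpr.eval_sqrt (e : RealExpr) : (RealExpr.sqrt e).eval s = Real.sqrt (e.eval s) := rfl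
@[simp] theorem RealExpr.eval_exp (e : RealExpr) : (RealExpr.exp e).eval s = Real.exp (e.eval s) := rfl
@[simp] theorem RealExpr.eval_log (e : RealExpr) : (RealExpr.log e).eval s = Real.log (e.eval s) := rfl

@[simp] theorem State.write_real (a i : ℕ) (v : ℝ) (a' i' : ℕ) :
    (s.write a i v).real a' i' = if a' = a ∧ i' = i then v else s.real a' i' := by
  unfold State.write
  by_cases ha : a' = a
  · subst ha
    by_cases hi : i' = i
    · subst hi; simp
    · simp [hi]
  · simp [ha]

theorem State.write_real_self (a i : ℕ) (v : ℝ) :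
    (s.write a i v).real a = Function.update (s.real a) i v := Function.update_self ..

@[simp] theorem State.write_nat (a i : ℕ) (v : ℝ) : (s.write a i v).nat = s.nat := rfl

end Notation

/-- For straight-line code the intermediate state is kept as an explicit write, so that later reads
are computed by `simp`. -/
theorem Runs.setReal_seq {ω : ℕ → ℝ} {q : Program} {s : State} {a T T' : ℕ} {i : NatExpr}
    {e : RealExpr} {Q : State → Prop} (p : ℕ) (v : ℝ) (hp : i.eval s = p) (hv : e.eval s = v)
    (hT : Nat.ble (i.cost + e.cost + 1) T = true) (h : Runs ω q (s.write a p v) T' Q) :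
    Runs ω (.seq (.setReal a i e) q) s (T + T') Q :=
  Runs.seq (R := fun s' => s' = s.write a p v) (.setReal p v hp hv rfl hT) fun _ _ h' => h' ▸ h

/-- Draw the noise: `2 d + 1` Gaussians in array `5`. -/
def drawProgram : Program :=
  .seq (.setNat 11 (2 * .reg 2 + 1)) (forLoop 6 11 (.gaussian 5 (.reg 6)))

/-- Compute `n / 2` in register `3` and `n - n / 2` in register `10`. -/
def halfProgram : Program :=
  .seq (forLoop 4 0 (.branch (.natLT (2 * .reg 3 + 1) (.reg 0)) (.setNat 3 (.reg 3 + 1)) .skip))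
    (.setNat 10 (.reg 0 - .reg 3))

/-- Compute in array `3` the sample means of all people. -/
def meanProgram : Program :=
  forLoop 4 0 (forLoop 6 2 (.seq
    (sumLoop 5 1 (.cell 1 ((.reg 4 * .reg 1 + .reg 5) * .reg 2 + .reg 6)))
    (.setReal 3 (.reg 4 * .reg 2 + .reg 6) (.cell 9 0 / .ofNat (.reg 1)))))

def setupProgram : Program := .seq drawProgram (.seq halfProgram meanProgram)

/-- The output for large `δ`: the mean, released with probability `3/4`. -/
def releaseProgram : Program :=
  .seq (.setReal 10 1 0) (.seq
    (.branch (.realLT 0 (.cell 5 0)) (.setReal 10 1 1) .skip) (.seq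
    (.branch (.realLT 0 (.cell 5 1)) (.setReal 10 1 1) .skip)
    (forLoop 6 2 (.seq (sumLoop 4 0 (.cell 3 (.reg 4 * .reg 2 + .reg 6)))
      (.setReal 2 (.reg 6) (.cell 10 1 * (.cell 9 0 / .ofNat (.reg 0))))))))

/-- Compute the parameters of the two stages in array `4`. -/
def parameterProgram (K : ℕ) : Program :=
  .seq (.branch (.realLT 1 (.cell 0 0)) (.setReal 4 1 (1 / 2)) (.setReal 4 1 (.cell 0 0 / 2))) (.seq
    (.branch (.realLT (1 / 2) (.cell 0 1)) (.setReal 4 2 (1 / 2 / 2)) (.setReal 4 2 (.cell 0 1 / 2)))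
    (.seq (.setReal 4 3 (1 + .sqrt (.log (2 / .cell 4 2))))
    (.seq (.setReal 4 10 (4 * .cell 4 3 / .cell 4 1))
    (.seq (.setReal 4 11 (20 * .sqrt (.ofNat (.reg 2) / .ofNat (.reg 1))))
    (.seq (.setReal 4 4 (.ofNat (.const K) * (.sqrt (.ofNat (.reg 2) / .ofNat (.reg 1)) *
        .log (2 + .ofNat (.reg 1) * .ofNat (.reg 2)) +
      .exp (.cell 0 4 / (2 * (.cell 0 4 - 1)) * .log (.ofNat (.reg 2)) -
        .log (.cell 0 2) / (.cell 0 4 - 1)) / .ofNat (.reg 1))))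
    (.seq (.setReal 4 5 (2 * .cell 4 11 * (2 * .cell 4 11)))
    (.seq (.setReal 4 6 (.ofNat (.reg 3) * .ofNat (.reg 3) / 4 + 6 * .ofNat (.reg 3) +
      3 * .ofNat (.reg 3) * .cell 4 10 * (2 * .cell 4 3)))
    (.seq (.setReal 4 7 (3 * .ofNat (.reg 3) * .cell 4 10))
    (.seq (.setReal 4 8 (112 * (.cell 4 11 / .ofNat (.reg 3)) * .cell 4 10))
      (.setReal 4 9 (.cell 4 10 * (2 * .cell 4 4 / .ofNat (.reg 10)))))))))))))

/-- Compute in register `7` the number of people in the first half close to the person in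
register `4`. -/
def countProgram : Program :=
  .seq (.setNat 7 0) (forLoop 5 3 (.seq
    (sumLoop 6 2 ((.cell 3 (.reg 4 * .reg 2 + .reg 6) - .cell 3 (.reg 5 * .reg 2 + .reg 6)) *
      (.cell 3 (.reg 4 * .reg 2 + .reg 6) - .cell 3 (.reg 5 * .reg 2 + .reg 6))))
    (.branch (.realLT (.cell 9 0) (.cell 4 5)) (.setNat 7 (.reg 7 + 1)) .skip)))

/-- Compute the weights in array `6`, and in array `10` the total weight and the test. -/
def weightProgram : Program :=
  .seq (forLoop 4 3 (.seq countProgram (.setReal 6 (.reg 4) (.ofNat (2 * .reg 7 - .reg 3)))))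
    (.seq (sumLoop 4 3 (.cell 6 (.reg 4))) (.seq (.setReal 10 0 (.cell 9 0)) (.seq
      (.setReal 10 1 0)
      (.branch (.realLT (.cell 4 6) (.cell 10 0 + .cell 4 7 * .cell 5 0)) (.setReal 10 1 1) .skip))))

/-- Compute the coarse estimate in array `8`. -/
def centerProgram : Program :=
  forLoop 6 2 (.seq (sumLoop 4 3 (.cell 6 (.reg 4) * .cell 3 (.reg 4 * .reg 2 + .reg 6)))
    (.setReal 8 (.reg 6) (.cell 10 1 * (.cell 9 0 / .cell 10 0 + .cell 4 8 * .cell 5 (.reg 6 + 1)))))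

/-- Compute the factors of the clipping in array `7`. -/
def factorProgram : Program :=
  forLoop 4 10 (.seq
    (sumLoop 6 2 ((.cell 3 ((.reg 3 + .reg 4) * .reg 2 + .reg 6) - .cell 8 (.reg 6)) *
      (.cell 3 ((.reg 3 + .reg 4) * .reg 2 + .reg 6) - .cell 8 (.reg 6))))
    (.branch (.realLT (.cell 4 4) (.sqrt (.cell 9 0)))
      (.setReal 7 (.reg 4) (.cell 4 4 / .sqrt (.cell 9 0))) (.setReal 7 (.reg 4) 1)))

/-- Compute the output from the coarse estimate and the factors. -/
def roundProgram : Program :=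
  forLoop 6 2 (.seq
    (sumLoop 4 10 (.cell 8 (.reg 6) + .cell 7 (.reg 4) *
      (.cell 3 ((.reg 3 + .reg 4) * .reg 2 + .reg 6) - .cell 8 (.reg 6))))
    (.setReal 2 (.reg 6) (.cell 9 0 / .ofNat (.reg 10) + .cell 4 9 * .cell 5 (.reg 2 + 1 + .reg 6))))

/-- The program. -/
def meanEstimationProgram (K : ℕ) : Program :=
  .seq setupProgram (.branch (.realLT (.cell 0 1) (3 / 4))
    (.seq (parameterProgram K)
      (.seq weightProgram (.seq centerProgram (.seq factorProgram roundProgram))))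
    releaseProgram)

/-! ### Preparations: draws, halving, sample means -/

section Setup

variable {n m d : ℕ} {ω : ℕ → ℝ} {X : Dataset n m d} {p : ℕ → ℝ}

/-- Coordinate `c` of the sample mean of person `i`. -/
noncomputable def meanCoord (X : Dataset n m d) (i c : ℕ) : ℝ :=
  if h : i < n ∧ c < d then sampleMean (X ⟨i, h.1⟩) ⟨c, h.2⟩ else 0

/-- The state after the preparations, where `p` is the array of parameters. -/
structure Ready (X : Dataset n m d) (p ω : ℕ → ℝ) (s : State) : Prop where
  people : s.nat 0 = n
  samples : s.nat 1 = m
  dim : s.nat 2 = d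
  half : s.nat 3 = n / 2
  rest : s.nat 10 = n - n / 2
  param : s.real 0 = p
  mean : ∀ i < n, ∀ c < d, s.real 3 (i * d + c) = meanCoord X i c
  draw : ∀ c < 2 * d + 1, s.real 5 c = ω c

/-- The program does not touch what is prepared. -/
def keepsReady (q : Program) : Bool :=
  !(q.writesNat 0 || q.writesNat 1 || q.writesNat 2 || q.writesNat 3 || q.writesNat 10 ||
    q.writesReal 0 || q.writesReal 3 || q.writesReal 5)

theorem Ready.agree {q : Program} {s s' : State} (h : Ready X p ω s) (ha : Agree q s s')
    (hq : keepsReady q = true) : Ready X p ω s' := by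
  simp only [keepsReady, Bool.not_eq_true', Bool.or_eq_false_iff] at hq
  obtain ⟨⟨⟨⟨⟨⟨⟨h0, h1⟩, h2⟩, h3⟩, h10⟩, r0⟩, r3⟩, r5⟩ := hq
  constructor
  · rw [ha.nat 0 h0, h.people]
  · rw [ha.nat 1 h1, h.samples]
  · rw [ha.nat 2 h2, h.dim]
  · rw [ha.nat 3 h3, h.half]
  · rw [ha.nat 10 h10, h.rest]
  · rw [ha.real 0 r0, h.param]
  · rw [ha.real 3 r3]; exact h.mean
  · rw [ha.real 5 r5]; exact h.draw

theorem runs_drawProgram {s : State} (hd : s.nat 2 = d) (hp : s.pos = 0) :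
    Runs ω drawProgram s (6 + ((2 * d + 1) * (2 + 7) + 5))
      fun s' => ∀ c < 2 * d + 1, s'.real 5 c = ω c := by
  -- There are `2 * d + 1` draws: one for the test, `d` for the coarse average, `d` for the final
  -- noise.
  refine Runs.seq (R := fun s' => s'.nat 11 = 2 * d + 1 ∧ s'.pos = 0)
    (Runs.setNat (2 * d + 1) (by simp [hd]) ⟨rfl, hp⟩ rfl) fun s₁ _ h₁ => ?_
  refine (Runs.forLoop (fun i s' => s'.pos = i ∧ ∀ c < i, s'.real 5 c = ω c) (T := 2)
    (by decide) rfl rfl h₁.1 le_rfl (fun _ _ _ h => h)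
    ⟨h₁.2, fun _ h => absurd h (Nat.not_lt_zero _)⟩ ?_).weaken le_rfl fun _ _ h => h.2
  intro i hi s' _ hx hinv
  refine Runs.gaussian i hx ⟨by simp [hinv.1], fun c hc => ?_⟩ rfl
  change (s'.write 5 i (ω s'.pos)).real 5 c = ω c
  rw [State.write_real, hinv.1]
  rcases eq_or_ne c i with rfl | hci
  · simp
  · rw [if_neg (by simp [hci])]
    exact hinv.2 c (by omega)

theorem runs_halfProgram {s : State} (hn : s.nat 0 = n) (h3 : s.nat 3 = 0) :
    Runs ω halfProgram s (n * (11 + 7) + 5 + 4)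
      fun s' => s'.nat 3 = n / 2 ∧ s'.nat 10 = n - n / 2 := by
  -- There is no integer division: a counter, initially `0`, is increased while `2c + 1 < n`, which
  -- means `c < n / 2`.
  refine Runs.seq (R := fun s' => s'.nat 3 = min n (n / 2)) (Runs.forLoop
    (fun i s' => s'.nat 3 = min i (n / 2)) (T := 11) (by decide) rfl rfl hn le_rfl
    (fun _ _ _ h => h) (by simp [h3]) ?_) fun s₁ ha h₁ => ?_
  · intro i hi s' ha hx hinv
    have h0 : s'.nat 0 = n := (ha.nat 0 rfl).trans hn
    refine Runs.branch (c := 7) (T := 4) rfl (fun hb => ?_) fun hb => ?_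
    · refine Runs.setNat (s'.nat 3 + 1) rfl ?_ rfl
      change s'.nat 3 + 1 = _
      simp only [Test.Holds, NatExpr.eval_add, NatExpr.eval_mul, NatExpr.eval_numeral,
        NatExpr.eval_reg, h0] at hb
      omega
    · refine Runs.skip ?_ (by norm_num)
      simp only [Test.Holds, NatExpr.eval_add, NatExpr.eval_mul, NatExpr.eval_numeral,
        NatExpr.eval_reg, h0] at hb
      omega
  · have h0 : s₁.nat 0 = n := (ha.nat 0 rfl).trans hn
    have h3 : s₁.nat 3 = n / 2 := by omega
    exact Runs.setNat (n - n / 2) (by simp [h0, h3]) ⟨h3, rfl⟩ rfl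

theorem meanCoord_eq {ε δ α R k : ℝ} {i c : ℕ} (hi : i < n) (hc : c < d) :
    (∑ j ∈ Finset.range m, (input ε δ α R k X).real 1 ((i * m + j) * d + c)) / m =
      meanCoord X i c := by
  rw [meanCoord, dif_pos ⟨hi, hc⟩, Finset.sum_range, sampleMean]
  simp only [PiLp.smul_apply, WithLp.ofLp_sum, Finset.sum_apply, smul_eq_mul]
  rw [div_eq_inv_mul]
  congr 1
  exact Finset.sum_congr rfl fun j _ => input_sample ε δ α R k X ⟨i, hi⟩ j ⟨c, hc⟩

theorem runs_meanProgram {s : State} {ε δ α R k : ℝ} (hn : s.nat 0 = n) (hm : s.nat 1 = m)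
    (hd : s.nat 2 = d) (h1 : s.real 1 = (input ε δ α R k X).real 1) :
    Runs ω meanProgram s (n * (d * (4 + (m * (15 + 7) + 5) + 11 + 7) + 5 + 7) + 5)
      fun s' => ∀ i < n, ∀ c < d, s'.real 3 (i * d + c) = meanCoord X i c := by
  refine Runs.forLoop (fun i s' => ∀ i' < i, ∀ c < d, s'.real 3 (i' * d + c) = meanCoord X i' c)
    (by decide) rfl rfl hn le_rfl (fun _ _ _ h => h) (fun _ h => absurd h (Nat.not_lt_zero _)) ?_
  intro i hi s₁ ha₁ hi₁ hinv
  refine (Runs.fillLoop (a := 3) (fun c => i * d + c) (fun a b h => Nat.add_left_cancel h)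
    (fun c => meanCoord X i c)
    (by decide) rfl rfl ((ha₁.nat 2 rfl).trans hd) le_rfl ?_).weaken le_rfl fun s₂ _ h₂ => ?_
  · intro c hc s₂ ha₂ hc₂
    have hi₂ : s₂.nat 4 = i := (ha₂.nat 4 rfl).trans hi₁
    refine Runs.seq (Runs.sumLoop (c := 15)
      (fun j => (input ε δ α R k X).real 1 ((i * m + j) * d + c)) (by decide)
      (((ha₂.nat 1 rfl).trans (ha₁.nat 1 rfl)).trans hm) le_rfl rfl ?_) fun s₃ ha₃ h₃ => ?_
    · intro j hj s₃ ha₃ hj₃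
      simp only [RealExpr.eval_cell, NatExpr.eval_add, NatExpr.eval_mul, NatExpr.eval_reg]
      rw [ha₃.real 1 rfl, ha₂.real 1 rfl, ha₁.real 1 rfl, h1, ha₃.nat 4 rfl, hi₂, hj₃,
        ha₃.nat 1 rfl, ha₂.nat 1 rfl, ha₁.nat 1 rfl, hm, ha₃.nat 2 rfl, ha₂.nat 2 rfl,
        ha₁.nat 2 rfl, hd, ha₃.nat 6 rfl, hc₂]
    · refine Runs.setReal (i * d + c) (meanCoord X i c) ?_ ?_ ?_ rfl
      · simp only [NatExpr.eval_add, NatExpr.eval_mul, NatExpr.eval_reg]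
        rw [ha₃.nat 4 rfl, hi₂, ha₃.nat 2 rfl, ha₂.nat 2 rfl,
          ha₁.nat 2 rfl, hd, ha₃.nat 6 rfl, hc₂]
      · simp only [RealExpr.eval_div, RealExpr.eval_cell, NatExpr.eval_numeral, RealExpr.eval_ofNat,
          NatExpr.eval_reg]
        rw [h₃, ha₃.nat 1 rfl, ha₂.nat 1 rfl, ha₁.nat 1 rfl, hm]
        exact meanCoord_eq hi hc
      · rw [State.write_real_self, ha₃.real 3 rfl]
  · intro i' hi' c hc
    rcases eq_or_ne i' i with rfl | hne
    · exact h₂.1 c hc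
    · rw [h₂.2]
      · exact hinv i' (by omega) c hc
      -- Rows of different people occupy disjoint cells, so filling row `i` preserves the earlier
      -- rows.
      · intro c' hc' heq
        have : i' + 1 ≤ i := by omega
        have := Nat.mul_le_mul_right d this
        rw [Nat.add_mul] at this
        omega

theorem runs_setupProgram (ε δ α R k : ℝ) (X : Dataset n m d) :
    Runs ω setupProgram (input ε δ α R k X) (6 + ((2 * d + 1) * (2 + 7) + 5) +
      (n * (11 + 7) + 5 + 4 + (n * (d * (4 + (m * (15 + 7) + 5) + 11 + 7) + 5 + 7) + 5)))
      (Ready X ((input ε δ α R k X).real 0) ω) := by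
  refine Runs.seq (runs_drawProgram (d := d) rfl rfl) fun s₁ ha₁ h₁ => ?_
  refine Runs.seq (runs_halfProgram (n := n) (ha₁.nat 0 rfl) (ha₁.nat 3 rfl)) fun s₂ ha₂ h₂ => ?_
  refine (runs_meanProgram (X := X) (ε := ε) (δ := δ) (α := α) (R := R) (k := k)
    ((ha₂.nat 0 rfl).trans (ha₁.nat 0 rfl))
    ((ha₂.nat 1 rfl).trans (ha₁.nat 1 rfl)) ((ha₂.nat 2 rfl).trans (ha₁.nat 2 rfl))
    ((ha₂.real 1 rfl).trans (ha₁.real 1 rfl))).weaken le_rfl fun s₃ ha₃ h₃ => ?_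
  constructor
  · rw [ha₃.nat 0 rfl, ha₂.nat 0 rfl, ha₁.nat 0 rfl]; rfl
  · rw [ha₃.nat 1 rfl, ha₂.nat 1 rfl, ha₁.nat 1 rfl]; rfl
  · rw [ha₃.nat 2 rfl, ha₂.nat 2 rfl, ha₁.nat 2 rfl]; rfl
  · rw [ha₃.nat 3 rfl, h₂.1]
  · rw [ha₃.nat 10 rfl, h₂.2]
  · rw [ha₃.real 0 rfl, ha₂.real 0 rfl, ha₁.real 0 rfl]
  · exact h₃
  · rw [ha₃.real 5 rfl, ha₂.real 5 rfl]; exact h₁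

end Setup

end RealRAM

namespace RealRAM

/-! ### The release branch and the parameters -/

section Phases

variable {n m d : ℕ} {ω : ℕ → ℝ} {X : Dataset n m d} {p : ℕ → ℝ}

open Classical in
theorem runs_flag {b : Test} {c : ℕ} {s : State} (hc : Nat.ble b.cost c = true) :
    Runs ω (.branch b (.setReal 10 1 1) .skip) s (c + 4) fun s' =>
      s'.real 10 1 = (if b.Holds s then 1 else s.real 10 1) ∧ s'.real 10 0 = s.real 10 0 :=
  Runs.branch hc
    (fun hb => Runs.setReal 1 1 rfl (by simp) ⟨by rw [if_pos hb]; simp, by simp⟩ rfl)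
    (fun hb => Runs.skip ⟨by rw [if_neg hb], rfl⟩ (by norm_num))

/-- A loop which fills cell `i` of the array `a` with the value `g i`. -/
theorem Runs.tabulate {x y a : ℕ} {q : Program} {s : State} {T N B : ℕ} (g : ℕ → ℝ)
    (hxy : x ≠ y) (hx : q.writesNat x = false) (hy : q.writesNat y = false) (hN : s.nat y = N)
    (hNB : N ≤ B)
    (hstep : ∀ i < N, ∀ s', Agree (RealRAM.forLoop x y q) s s' → s'.nat x = i →
      Runs ω q s' T fun s'' => s''.real a = Function.update (s'.real a) i (g i)) :
    Runs ω (RealRAM.forLoop x y q) s (B * (T + 7) + 5) fun s' => ∀ i < N, s'.real a i = g i :=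
  (Runs.fillLoop id Function.injective_id g hxy hx hy hN hNB hstep).weaken le_rfl
    fun _ _ h => h.1

theorem runs_releaseProgram {s : State} (h : Ready X p ω s) (hd : 1 ≤ d) :
    Runs ω releaseProgram s (4 + (9 + (9 + (d * (4 + (n * (11 + 7) + 5) + 10 + 7) + 5))))
      fun s' => ∀ c < d, s'.real 2 c = (if 0 < ω 0 ∨ 0 < ω 1 then 1 else 0) *
        ((∑ i ∈ Finset.range n, meanCoord X i c) / n) := by
  classical
  refine Runs.setReal_seq 1 0 rfl (by simp) rfl ?_
  have h : Ready X p ω (s.write 10 1 0) := ⟨h.people, h.samples, h.dim, h.half, h.rest,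
    h.param, h.mean, h.draw⟩
  refine Runs.seq (runs_flag (c := 5) rfl) fun s₁ ha₁ h₁ => ?_
  have hr₁ := h.agree ha₁ rfl
  refine Runs.seq (runs_flag (c := 5) rfl) fun s₂ ha₂ h₂ => ?_
  have hr₂ := hr₁.agree ha₂ rfl
  have hflag : s₂.real 10 1 = if 0 < ω 0 ∨ 0 < ω 1 then 1 else 0 := by
    rw [h₂.1, h₁.1]
    have e0 := h.draw 0 (by omega)
    -- Draw `1` is available because `d ≥ 1` gives at least three draws.
    have e1 := hr₁.draw 1 (by omega)
    simp only [Test.Holds, RealExpr.eval_cell, RealExpr.eval_numeral, NatExpr.eval_numeral,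
      Nat.cast_zero, e0, e1]
    by_cases h0 : 0 < ω 0 <;> by_cases h1 : 0 < ω 1 <;> simp [h0, h1]
  refine Runs.tabulate _ (by decide) rfl rfl hr₂.dim le_rfl fun c hc s₃ ha₃ hc₃ => ?_
  have hr₃ := hr₂.agree ha₃ rfl
  refine Runs.seq (Runs.sumLoop (c := 11) (fun i => meanCoord X i c) (by decide) hr₃.people le_rfl
    rfl fun i hi s₄ ha₄ hi₄ => ?_) fun s₄ ha₄ h₄ => ?_
  · have hr₄ := hr₃.agree ha₄ rfl
    simp only [RealExpr.eval_cell, NatExpr.eval_add, NatExpr.eval_mul, NatExpr.eval_reg]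
    rw [hi₄, hr₄.dim, ha₄.nat 6 rfl, hc₃, hr₄.mean i hi c hc]
  · have hr₄ := hr₃.agree ha₄ rfl
    refine Runs.setReal c ((if 0 < ω 0 ∨ 0 < ω 1 then 1 else 0) *
      ((∑ i ∈ Finset.range n, meanCoord X i c) / n)) ?_ ?_ ?_ rfl
    · simp only [NatExpr.eval_reg]
      rw [ha₄.nat 6 rfl, hc₃]
    · simp only [RealExpr.eval_cell, NatExpr.eval_numeral, RealExpr.eval_mul, RealExpr.eval_div,
        RealExpr.eval_ofNat, NatExpr.eval_reg]
      rw [h₄, hr₄.people, ha₄.real 10 rfl, ha₃.real 10 rfl, hflag]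
    · rw [State.write_real_self, ha₄.real 2 rfl]

/-- The parameters of the two stages are computed. -/
structure HasParameters (n m d : ℕ) (ε δ ρ : ℝ) (s : State) : Prop where
  radius : s.real 4 4 = ρ
  closeness : s.real 4 5 = (2 * coarseRadius m d) ^ 2
  threshold : s.real 4 6 = coarseThreshold (n / 2 : ℕ) ε δ
  weightNoise : s.real 4 7 = 3 * (n / 2 : ℕ) * noiseMult ε δ
  centerNoise : s.real 4 8 = 112 * (coarseRadius m d / (n / 2 : ℕ)) * noiseMult ε δ
  roundNoise : s.real 4 9 = noiseMult ε δ * (2 * ρ / (n - n / 2 : ℕ))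

theorem HasParameters.agree {ε δ ρ : ℝ} {q : Program} {s s' : State}
    (h : HasParameters n m d ε δ ρ s) (ha : Agree q s s') (hq : q.writesReal 4 = false) :
    HasParameters n m d ε δ ρ s' := by
  have := ha.real 4 hq
  constructor
  · rw [this, h.radius]
  · rw [this, h.closeness]
  · rw [this, h.threshold]
  · rw [this, h.weightNoise]
  · rw [this, h.centerNoise]
  · rw [this, h.roundNoise]

theorem runs_parameterProgram {s : State} (h : Ready X p ω s) (K : ℕ) :
    Runs ω (parameterProgram K) s 300 (HasParameters n m d (min (p 0) 1 / 2) (min (p 1) (1 / 2) / 2)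
      (clipRadius K (p 4) m d (p 2))) := by
  -- The total budget `300` is handed out to the assignments one by one, with slack.
  refine (Runs.seq (T := 7 + 8) (T' := 280) (R := fun s' => s'.real 4 1 = min (p 0) 1 / 2)
    (Runs.branch rfl (fun hb => ?_) fun hb => ?_) fun s₁ ha₁ h₁ => ?_).weaken (by norm_num)
    fun _ _ h => h
  · refine Runs.setReal 1 (1 / 2) rfl (by simp) ?_ rfl
    simp only [Test.Holds, RealExpr.eval_cell, RealExpr.eval_numeral, NatExpr.eval_numeral,
      Nat.cast_one, h.param] at hb
    simp [min_eq_right hb.le]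
  · refine Runs.setReal 1 (p 0 / 2) rfl (by simp [h.param]) ?_ rfl
    simp only [Test.Holds, RealExpr.eval_cell, RealExpr.eval_numeral, NatExpr.eval_numeral,
      Nat.cast_one, h.param, not_lt] at hb
    simp [min_eq_left hb]
  have hr₁ := h.agree ha₁ rfl
  refine (Runs.seq (T := 8 + 14) (T' := 258) (R := fun s' => s'.real 4 1 = min (p 0) 1 / 2 ∧
    s'.real 4 2 = min (p 1) (1 / 2) / 2)
    (Runs.branch rfl (fun hb => ?_) fun hb => ?_) fun s₂ ha₂ h₂ => ?_)
  · refine Runs.setReal 2 (1 / 2 / 2) rfl (by simp) ⟨by simp [h₁], ?_⟩ rfl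
    simp only [Test.Holds, RealExpr.eval_cell, RealExpr.eval_numeral, NatExpr.eval_numeral,
      RealExpr.eval_div, Nat.cast_one, Nat.cast_ofNat, hr₁.param] at hb
    rw [min_eq_right hb.le]; simp
  · refine Runs.setReal 2 (p 1 / 2) rfl (by simp [hr₁.param]) ⟨by simp [h₁], ?_⟩ rfl
    simp only [Test.Holds, RealExpr.eval_cell, RealExpr.eval_numeral, NatExpr.eval_numeral,
      RealExpr.eval_div, Nat.cast_one, Nat.cast_ofNat, hr₁.param, not_lt] at hb
    rw [min_eq_left hb]; simp
  have hr := hr₁.agree ha₂ rfl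
  set ε := min (p 0) 1 / 2
  set δ := min (p 1) (1 / 2) / 2
  have e1 := hr.samples
  have e2 := hr.dim
  have e3 := hr.half
  have e10 := hr.rest
  have e0 := hr.param
  refine (Runs.setReal_seq (T := 12) (T' := 200) 3 (1 + Real.sqrt (Real.log (2 / δ))) rfl
    (by simp [h₂.2]) rfl ?_).weaken (by norm_num) fun _ _ h => h
  refine (Runs.setReal_seq (T := 20) (T' := 180) 10 (noiseMult ε δ) rfl
    (by simp [h₂.1, noiseMult]) rfl ?_)
  refine (Runs.setReal_seq (T := 20) (T' := 160) 11 (coarseRadius m d) rfl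
    (by simp [e1, e2, coarseRadius]) rfl ?_)
  refine (Runs.setReal_seq (T := 60) (T' := 100) 4 (clipRadius K (p 4) m d (p 2)) rfl
    (by simp [e1, e2, e0, clipRadius]) rfl ?_)
  refine (Runs.setReal_seq (T := 15) (T' := 85) 5 ((2 * coarseRadius m d) ^ 2) rfl
    (by simp [pow_two]) rfl ?_)
  refine (Runs.setReal_seq (T := 33) (T' := 52) 6 (coarseThreshold (n / 2 : ℕ) ε δ) rfl
    (by simp [e3, coarseThreshold, pow_two]) rfl ?_)
  refine (Runs.setReal_seq (T := 12) (T' := 40) 7 (3 * (n / 2 : ℕ) * noiseMult ε δ) rfl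
    (by simp [e3]) rfl ?_)
  refine (Runs.setReal_seq (T := 15) (T' := 25) 8
    (112 * (coarseRadius m d / (n / 2 : ℕ)) * noiseMult ε δ) rfl (by simp [e3]) rfl ?_)
  refine Runs.setReal 9 (noiseMult ε δ * (2 * clipRadius K (p 4) m d (p 2) / (n - n / 2 : ℕ))) rfl
    (by simp [e10]) ?_ rfl
  constructor <;> simp

end Phases

end RealRAM

namespace RealRAM

/-! ### Running the coarse stage and the clipping round -/

section TwoStage

variable {n m d : ℕ} {ω : ℕ → ℝ} {X : Dataset n m d} {p : ℕ → ℝ} {ε δ ρ : ℝ}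

/-- The squared distance of two vectors given by their first `d` coordinates. -/
def distSq (d : ℕ) (f g : ℕ → ℝ) : ℝ := ∑ c ∈ Finset.range d, (f c - g c) * (f c - g c)

/-- The weight of person `i` among the first `h` people. -/
noncomputable def weightAt (h d : ℕ) (τ : ℝ) (Y : ℕ → ℕ → ℝ) (i : ℕ) : ℕ :=
  2 * (∑ j ∈ Finset.range h, if distSq d (Y i) (Y j) < τ then 1 else 0) - h

/-- The test of the coarse estimator. -/
noncomputable def flagAt (t W σ x : ℝ) : ℝ := if t < W + σ * x then 1 else 0

theorem runs_countProgram {s : State} {i : ℕ} (h : Ready X p ω s)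
    (hp : HasParameters n m d ε δ ρ s) (hi : i < n / 2) (h4 : s.nat 4 = i) :
    Runs ω countProgram s (2 + (n * (4 + (d * (32 + 7) + 5) + (5 + 4) + 7) + 5))
      fun s' => 2 * s'.nat 7 - n / 2 =
        weightAt (n / 2) d ((2 * coarseRadius m d) ^ 2) (meanCoord X) i := by
  refine Runs.seq (R := fun s' => s'.nat 7 = 0) (Runs.setNat 0 rfl rfl rfl) fun s₁ ha₁ h₁ => ?_
  have hr₁ := h.agree ha₁ rfl
  have hp₁ := hp.agree ha₁ rfl
  refine (Runs.forLoop (x := 5) (fun j s' => s'.nat 7 = ∑ j ∈ Finset.range j,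
    if distSq d (meanCoord X i) (meanCoord X j) < (2 * coarseRadius m d) ^ 2 then 1 else 0)
    (by decide) rfl rfl hr₁.half (Nat.div_le_self n 2) (fun _ _ _ h => h) (by simpa using h₁)
    ?_).weaken le_rfl fun s₂ _ h₂ => by rw [h₂, weightAt]
  intro j hj s₂ ha₂ hj₂ hinv
  have hr₂ := hr₁.agree ha₂ rfl
  have hi₂ : s₂.nat 4 = i := ((ha₂.nat 4 rfl).trans (ha₁.nat 4 rfl)).trans h4
  refine Runs.seq (Runs.sumLoop (c := 32) (fun c => (meanCoord X i c - meanCoord X j c) *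
    (meanCoord X i c - meanCoord X j c)) (by decide) hr₂.dim le_rfl rfl fun c hc s₃ ha₃ hc₃ => ?_)
    fun s₃ ha₃ h₃ => ?_
  · have hr₃ := hr₂.agree ha₃ rfl
    simp only [RealExpr.eval_mul, RealExpr.eval_sub, RealExpr.eval_cell, NatExpr.eval_add,
      NatExpr.eval_mul, NatExpr.eval_reg]
    rw [hr₃.dim, hc₃, ha₃.nat 4 rfl, hi₂, ha₃.nat 5 rfl, hj₂, hr₃.mean i (by omega) c hc,
      hr₃.mean j (by omega) c hc]
  · have h7 : s₃.nat 7 = s₂.nat 7 := ha₃.nat 7 rfl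
    have hp₃ := (hp₁.agree ha₂ rfl).agree ha₃ rfl
    have hiff : Test.Holds s₃ (.realLT (.cell 9 0) (.cell 4 5)) ↔
        distSq d (meanCoord X i) (meanCoord X j) < (2 * coarseRadius m d) ^ 2 := by
      simp only [Test.Holds, RealExpr.eval_cell, NatExpr.eval_numeral]
      rw [h₃, hp₃.closeness]; rfl
    refine Runs.branch (c := 5) (T := 4) rfl (fun hb => ?_) fun hb => ?_
    · refine Runs.setNat (s₃.nat 7 + 1) rfl ?_ rfl
      change s₃.nat 7 + 1 = _
      rw [Finset.sum_range_succ, if_pos (hiff.1 hb), h7, hinv]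
    · refine Runs.skip ?_ (by norm_num)
      rw [Finset.sum_range_succ, if_neg (mt hiff.2 hb), h7, hinv, add_zero]

theorem runs_weightProgram {s : State} (h : Ready X p ω s) (hp : HasParameters n m d ε δ ρ s) :
    Runs ω weightProgram s (n * (2 + (n * (4 + (d * (32 + 7) + 5) + (5 + 4) + 7) + 5) + 8 + 7) + 5 +
      (4 + (n * (9 + 7) + 5) + (4 + (4 + (11 + 4)))))
      fun s' =>
        (∀ i < n / 2, s'.real 6 i =
          weightAt (n / 2) d ((2 * coarseRadius m d) ^ 2) (meanCoord X) i) ∧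
        s'.real 10 0 = ∑ i ∈ Finset.range (n / 2),
          (weightAt (n / 2) d ((2 * coarseRadius m d) ^ 2) (meanCoord X) i : ℝ) ∧
        s'.real 10 1 = flagAt (coarseThreshold (n / 2 : ℕ) ε δ) (∑ i ∈ Finset.range (n / 2),
          (weightAt (n / 2) d ((2 * coarseRadius m d) ^ 2) (meanCoord X) i : ℝ))
          (3 * (n / 2 : ℕ) * noiseMult ε δ) (ω 0) := by
  classical
  set w : ℕ → ℕ := weightAt (n / 2) d ((2 * coarseRadius m d) ^ 2) (meanCoord X) with hw
  refine Runs.seq (Runs.tabulate (a := 6) (fun i => (w i : ℝ)) (by decide) rfl rfl h.half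
    (Nat.div_le_self n 2) fun i hi s₁ ha₁ hi₁ => ?_) fun s₁ ha₁ h₁ => ?_
  · refine Runs.seq (runs_countProgram (h.agree ha₁ rfl) (hp.agree ha₁ rfl) hi hi₁)
      fun s₂ ha₂ h₂ => ?_
    have hr₂ := (h.agree ha₁ rfl).agree ha₂ rfl
    refine Runs.setReal i (w i) ?_ ?_ ?_ rfl
    · exact (ha₂.nat 4 rfl).trans hi₁
    · simp only [RealExpr.eval_ofNat, NatExpr.eval_sub, NatExpr.eval_mul, NatExpr.eval_numeral,
        NatExpr.eval_reg]
      rw [hr₂.half, h₂]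
    · rw [State.write_real_self, ha₂.real 6 rfl]
  have hr₁ := h.agree ha₁ rfl
  refine Runs.seq (Runs.sumLoop (c := 9) (fun i => (w i : ℝ)) (by decide) hr₁.half
    (Nat.div_le_self n 2) rfl fun i hi s₂ ha₂ hi₂ => ?_) fun s₂ ha₂ h₂ => ?_
  · simp only [RealExpr.eval_cell, NatExpr.eval_reg]
    rw [ha₂.real 6 rfl, hi₂, h₁ i hi]
  have hr₂ := hr₁.agree ha₂ rfl
  have hp₂ := (hp.agree ha₁ rfl).agree ha₂ rfl
  refine Runs.setReal_seq 0 (∑ i ∈ Finset.range (n / 2), (w i : ℝ)) rfl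
    (by simpa using h₂) rfl ?_
  refine Runs.setReal_seq 1 0 rfl (by simp) rfl ?_
  refine (runs_flag (c := 11) rfl).weaken le_rfl fun s₃ ha₃ h₃ => ⟨fun i hi => ?_, ?_, ?_⟩
  · rw [ha₃.real 6 rfl]
    simp [ha₂.real 6 rfl, h₁ i hi]
  · rw [h₃.2]; simp
  · rw [h₃.1, flagAt]
    simp [Test.Holds, hr₂.draw 0 (by omega), hp₂.threshold, hp₂.weightNoise]

/-- Multiplication by the flag `b` replaces a branch. Division by `W = 0` yields `0` in the machine,
in agreement with the inverse in `stableCenter`. -/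
theorem runs_centerProgram {s : State} {w : ℕ → ℕ} {W b : ℝ} (h : Ready X p ω s)
    (hp : HasParameters n m d ε δ ρ s) (hw : ∀ i < n / 2, s.real 6 i = w i) (hW : s.real 10 0 = W)
    (hb : s.real 10 1 = b) :
    Runs ω centerProgram s (d * (4 + (n * (14 + 7) + 5) + 20 + 7) + 5)
      fun s' => ∀ c < d, s'.real 8 c = b * ((∑ i ∈ Finset.range (n / 2), w i * meanCoord X i c) / W +
        112 * (coarseRadius m d / (n / 2 : ℕ)) * noiseMult ε δ * ω (c + 1)) := by
  refine Runs.tabulate _ (by decide) rfl rfl h.dim le_rfl fun c hc s₁ ha₁ hc₁ => ?_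
  have hr₁ := h.agree ha₁ rfl
  refine Runs.seq (Runs.sumLoop (c := 14) (fun i => w i * meanCoord X i c) (by decide) hr₁.half
    (Nat.div_le_self n 2) rfl fun i hi s₂ ha₂ hi₂ => ?_) fun s₂ ha₂ h₂ => ?_
  · have hr₂ := hr₁.agree ha₂ rfl
    simp only [RealExpr.eval_cell, RealExpr.eval_mul, NatExpr.eval_add, NatExpr.eval_mul,
      NatExpr.eval_reg]
    rw [hi₂, hr₂.dim, ha₂.nat 6 rfl, hc₁, hr₂.mean i (by omega) c hc, ha₂.real 6 rfl,
      ha₁.real 6 rfl, hw i hi]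
  · have hr₂ := hr₁.agree ha₂ rfl
    have hp₂ := (hp.agree ha₁ rfl).agree ha₂ rfl
    refine Runs.setReal c (b * ((∑ i ∈ Finset.range (n / 2), w i * meanCoord X i c) / W +
        112 * (coarseRadius m d / (n / 2 : ℕ)) * noiseMult ε δ * ω (c + 1))) ?_ ?_ ?_ rfl
    · exact (ha₂.nat 6 rfl).trans hc₁
    · simp only [RealExpr.eval_cell, NatExpr.eval_numeral, RealExpr.eval_mul, RealExpr.eval_div,
        RealExpr.eval_add, NatExpr.eval_reg, NatExpr.eval_add]
      rw [h₂, ha₂.nat 6 rfl, hc₁, ha₂.real 10 rfl, ha₁.real 10 rfl, hW, hb, hp₂.centerNoise,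
        hr₂.draw (c + 1) (by omega)]
    · rw [State.write_real_self, ha₂.real 8 rfl]

/-- The factor by which clipping scales the displacement from the center. -/
noncomputable def clipFactor (d : ℕ) (ρ : ℝ) (y u : ℕ → ℝ) : ℝ :=
  if ρ < Real.sqrt (distSq d y u) then ρ / Real.sqrt (distSq d y u) else 1

theorem runs_factorProgram {s : State} {u : ℕ → ℝ} (h : Ready X p ω s)
    (hp : HasParameters n m d ε δ ρ s) (hu : ∀ c < d, s.real 8 c = u c) :
    Runs ω factorProgram s (n * (4 + (d * (32 + 7) + 5) + (6 + 8) + 7) + 5)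
      fun s' => ∀ i < n - n / 2, s'.real 7 i = clipFactor d ρ (meanCoord X (n / 2 + i)) u := by
  refine Runs.tabulate _ (by decide) rfl rfl h.rest (Nat.sub_le _ _) fun i hi s₁ ha₁ hi₁ => ?_
  have hr₁ := h.agree ha₁ rfl
  refine Runs.seq (Runs.sumLoop (c := 32) (fun c => (meanCoord X (n / 2 + i) c - u c) *
    (meanCoord X (n / 2 + i) c - u c)) (by decide) hr₁.dim le_rfl rfl fun c hc s₂ ha₂ hc₂ => ?_)
    fun s₂ ha₂ h₂ => ?_
  · have hr₂ := hr₁.agree ha₂ rfl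
    simp only [RealExpr.eval_mul, RealExpr.eval_sub, RealExpr.eval_cell, NatExpr.eval_add,
      NatExpr.eval_mul, NatExpr.eval_reg]
    rw [hr₂.dim, hr₂.half, hc₂, ha₂.nat 4 rfl, hi₁, hr₂.mean (n / 2 + i) (by omega) c hc,
      ha₂.real 8 rfl, ha₁.real 8 rfl, hu c hc]
  · have hi₂ : s₂.nat 4 = i := (ha₂.nat 4 rfl).trans hi₁
    have hp₂ := (hp.agree ha₁ rfl).agree ha₂ rfl
    have hiff : Test.Holds s₂ (.realLT (.cell 4 4) (.sqrt (.cell 9 0))) ↔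
        ρ < Real.sqrt (distSq d (meanCoord X (n / 2 + i)) u) := by
      simp only [Test.Holds, RealExpr.eval_cell, RealExpr.eval_sqrt, NatExpr.eval_numeral]
      rw [h₂, hp₂.radius]; rfl
    refine Runs.branch (c := 6) (T := 8) rfl (fun hb => ?_) fun hb => ?_
    · refine Runs.setReal i (clipFactor d ρ (meanCoord X (n / 2 + i)) u) hi₂ ?_ ?_ rfl
      · rw [clipFactor, if_pos (hiff.1 hb)]
        simp only [RealExpr.eval_div, RealExpr.eval_cell, RealExpr.eval_sqrt, NatExpr.eval_numeral]
        rw [h₂, hp₂.radius]; rfl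
      · rw [State.write_real_self, ha₂.real 7 rfl]
    · refine Runs.setReal i (clipFactor d ρ (meanCoord X (n / 2 + i)) u) hi₂ ?_ ?_ rfl
      · rw [clipFactor, if_neg (mt hiff.2 hb)]
        simp
      · rw [State.write_real_self, ha₂.real 7 rfl]

theorem runs_roundProgram {s : State} {u f : ℕ → ℝ} (h : Ready X p ω s)
    (hp : HasParameters n m d ε δ ρ s) (hu : ∀ c < d, s.real 8 c = u c)
    (hf : ∀ i < n - n / 2, s.real 7 i = f i) :
    Runs ω roundProgram s (d * (4 + (n * (28 + 7) + 5) + 20 + 7) + 5)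
      fun s' => ∀ c < d, s'.real 2 c = (∑ i ∈ Finset.range (n - n / 2),
        (u c + f i * (meanCoord X (n / 2 + i) c - u c))) / (n - n / 2 : ℕ) +
          noiseMult ε δ * (2 * ρ / (n - n / 2 : ℕ)) * ω (d + 1 + c) := by
  refine Runs.tabulate _ (by decide) rfl rfl h.dim le_rfl fun c hc s₁ ha₁ hc₁ => ?_
  have hr₁ := h.agree ha₁ rfl
  refine Runs.seq (Runs.sumLoop (c := 28) (fun i => u c + f i * (meanCoord X (n / 2 + i) c - u c))
    (by decide) hr₁.rest (Nat.sub_le _ _) rfl fun i hi s₂ ha₂ hi₂ => ?_) fun s₂ ha₂ h₂ => ?_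
  · have hr₂ := hr₁.agree ha₂ rfl
    simp only [RealExpr.eval_mul, RealExpr.eval_sub, RealExpr.eval_add, RealExpr.eval_cell,
      NatExpr.eval_add, NatExpr.eval_mul, NatExpr.eval_reg]
    rw [hr₂.dim, hr₂.half, hi₂, ha₂.nat 6 rfl, hc₁, hr₂.mean (n / 2 + i) (by omega) c hc,
      ha₂.real 8 rfl, ha₁.real 8 rfl, hu c hc, ha₂.real 7 rfl, ha₁.real 7 rfl, hf i hi]
  · have hr₂ := hr₁.agree ha₂ rfl
    have hp₂ := (hp.agree ha₁ rfl).agree ha₂ rfl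
    refine Runs.setReal c _ ((ha₂.nat 6 rfl).trans hc₁) ?_
      (by rw [State.write_real_self, ha₂.real 2 rfl]) rfl
    simp only [RealExpr.eval_mul, RealExpr.eval_div, RealExpr.eval_add, RealExpr.eval_cell,
      RealExpr.eval_ofNat, NatExpr.eval_add, NatExpr.eval_numeral, NatExpr.eval_reg]
    rw [h₂, hr₂.rest, hr₂.dim, ha₂.nat 6 rfl, hc₁, hp₂.roundNoise, hr₂.draw (d + 1 + c) (by omega)]

end TwoStage

end RealRAM

namespace RealRAM

/-! ### The computed numbers are the coordinates of the mechanism -/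

section Correctness

variable {n m d : ℕ} {ω : ℕ → ℝ} {X : Dataset n m d} {p : ℕ → ℝ} {ε δ ρ : ℝ}

theorem meanCoord_val (X : Dataset n m d) (i : Fin n) (c : Fin d) :
    meanCoord X i c = sampleMean (X i) c := by
  rw [meanCoord, dif_pos ⟨i.isLt, c.isLt⟩]

theorem sum_firstHalf {M : Type*} [AddCommMonoid M] (g : ℕ → M) :
    ∑ i ∈ firstHalf n, g i = ∑ i ∈ Finset.range (n / 2), g i := by
  refine Finset.sum_nbij (fun i => i.val) (fun i hi => ?_) (fun i _ j _ h => Fin.ext h)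
    (fun i hi => ?_) fun _ _ => rfl
  · simpa [firstHalf] using hi
  · have hi : i < n / 2 := by simpa using hi
    exact ⟨⟨i, by omega⟩, by simpa [firstHalf] using hi, rfl⟩

theorem sum_firstHalf_compl (g : ℕ → ℝ) :
    ∑ i ∈ (firstHalf n)ᶜ, g i = ∑ i ∈ Finset.range (n - n / 2), g (n / 2 + i) := by
  have h := Finset.sum_add_sum_compl (firstHalf n) fun i : Fin n => g i
  have h' := Finset.sum_range_add g (n / 2) (n - n / 2)
  rw [Nat.add_sub_cancel' (Nat.div_le_self n 2)] at h'
  rw [sum_firstHalf, Fin.sum_univ_eq_sum_range, h'] at h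
  exact add_left_cancel h

theorem norm_sub_sq_eq_distSq {x y : Vec d} {f g : ℕ → ℝ} (hf : ∀ c : Fin d, f c = x c)
    (hg : ∀ c : Fin d, g c = y c) : ‖x - y‖ ^ 2 = distSq d f g := by
  rw [EuclideanSpace.real_norm_sq_eq, distSq, Finset.sum_range]
  refine Finset.sum_congr rfl fun c _ => ?_
  rw [hf, hg, PiLp.sub_apply, pow_two]

theorem norm_sub_eq_sqrt_distSq {x y : Vec d} {f g : ℕ → ℝ} (hf : ∀ c : Fin d, f c = x c)
    (hg : ∀ c : Fin d, g c = y c) : ‖x - y‖ = Real.sqrt (distSq d f g) := by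
  rw [← norm_sub_sq_eq_distSq hf hg, Real.sqrt_sq (norm_nonneg _)]

theorem stableWeight_firstHalf (X : Dataset n m d) (τ : ℝ) (i : Fin n) :
    stableWeight (firstHalf n) τ (fun i => sampleMean (X i)) i =
      weightAt (n / 2) d τ (meanCoord X) i := by
  classical
  rw [stableWeight, weightAt, card_firstHalf, closeCount, Finset.card_filter,
    ← sum_firstHalf (n := n) fun j => if distSq d (meanCoord X i) (meanCoord X j) < τ then 1 else 0]
  congr 2
  refine Finset.sum_congr rfl fun j _ => ?_
  rw [norm_sub_sq_eq_distSq (meanCoord_val X i) (meanCoord_val X j)]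

theorem totalWeight_firstHalf (X : Dataset n m d) (τ : ℝ) :
    (totalWeight (firstHalf n) τ (fun i => sampleMean (X i)) : ℝ) =
      ∑ i ∈ Finset.range (n / 2), (weightAt (n / 2) d τ (meanCoord X) i : ℝ) := by
  rw [totalWeight, Nat.cast_sum, ← sum_firstHalf]
  exact Finset.sum_congr rfl fun i _ => by rw [stableWeight_firstHalf]

theorem stableCenter_firstHalf (X : Dataset n m d) (τ : ℝ) (c : Fin d) :
    stableCenter (firstHalf n) τ (fun i => sampleMean (X i)) c =
      (∑ i ∈ Finset.range (n / 2), weightAt (n / 2) d τ (meanCoord X) i * meanCoord X i c) /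
        ∑ i ∈ Finset.range (n / 2), (weightAt (n / 2) d τ (meanCoord X) i : ℝ) := by
  rw [stableCenter, totalWeight_firstHalf, ← sum_firstHalf (fun i => (weightAt (n / 2) d τ
    (meanCoord X) i : ℝ) * meanCoord X i c), div_eq_inv_mul]
  simp only [PiLp.smul_apply, WithLp.ofLp_sum, Finset.sum_apply, smul_eq_mul]
  congr 1
  exact Finset.sum_congr rfl fun i _ => by rw [stableWeight_firstHalf, meanCoord_val]

theorem coarseFun_coord (X : Dataset n m d) (c : Fin d) :
    coarseFun ε δ X (fun i => ω i) c =
      flagAt (coarseThreshold (n / 2 : ℕ) ε δ) (∑ i ∈ Finset.range (n / 2),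
          (weightAt (n / 2) d ((2 * coarseRadius m d) ^ 2) (meanCoord X) i : ℝ))
          (3 * (n / 2 : ℕ) * noiseMult ε δ) (ω 0) *
        ((∑ i ∈ Finset.range (n / 2), weightAt (n / 2) d ((2 * coarseRadius m d) ^ 2)
          (meanCoord X) i * meanCoord X i c) / (∑ i ∈ Finset.range (n / 2),
          (weightAt (n / 2) d ((2 * coarseRadius m d) ^ 2) (meanCoord X) i : ℝ)) +
        112 * (coarseRadius m d / (n / 2 : ℕ)) * noiseMult ε δ * ω (c + 1)) := by
  rw [coarseFun, coarseVal, card_firstHalf, totalWeight_firstHalf, flagAt, Fin.val_zero]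
  split_ifs
  · rw [one_mul, PiLp.add_apply, stableCenter_firstHalf]
    simp
  · simp

/-- A factor `1` for points inside the ball gives both cases of clipping one formula. -/
theorem clip_coord {x u : Vec d} {f g : ℕ → ℝ} (hf : ∀ c : Fin d, f c = x c)
    (hg : ∀ c : Fin d, g c = u c) (c : Fin d) :
    clip ρ u x c = g c + clipFactor d ρ f g * (f c - g c) := by
  rw [clip, clipFactor, norm_sub_eq_sqrt_distSq hf hg, hf, hg]
  rcases le_or_gt (Real.sqrt (distSq d f g)) ρ with h | h
  · rw [if_pos h, if_neg (not_lt.2 h)]; ring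
  · rw [if_neg (not_le.2 h), if_pos h]; simp

theorem twoStage_coord (X : Dataset n m d) {u : ℕ → ℝ}
    (hu : ∀ c : Fin d, u c = coarseFun ε δ X (fun i => ω i) c) (c : Fin d) :
    twoStage ε δ ρ X ω c = (∑ i ∈ Finset.range (n - n / 2),
      (u c + clipFactor d ρ (meanCoord X (n / 2 + i)) u * (meanCoord X (n / 2 + i) c - u c))) /
        (n - n / 2 : ℕ) + noiseMult ε δ * (2 * ρ / (n - n / 2 : ℕ)) * ω (d + 1 + c) := by
  rw [twoStage, PiLp.add_apply, clippedMean_eq, roundNoise, card_firstHalf_compl,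
    ← sum_firstHalf_compl fun i => u c + clipFactor d ρ (meanCoord X i) u * (meanCoord X i c - u c)]
  simp only [PiLp.smul_apply, WithLp.ofLp_sum, Finset.sum_apply, smul_eq_mul]
  rw [inv_mul_eq_div]
  congr 2
  exact Finset.sum_congr rfl fun i _ => clip_coord (meanCoord_val X i) hu c

theorem releaseFun_coord (X : Dataset n m d) (c : Fin d) :
    releaseFun X ω c = (if 0 < ω 0 ∨ 0 < ω 1 then 1 else 0) *
      ((∑ i ∈ Finset.range n, meanCoord X i c) / n) := by
  rw [releaseFun]
  split_ifs
  · rw [one_mul, Finset.sum_range, div_eq_inv_mul]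
    simp only [PiLp.smul_apply, WithLp.ofLp_sum, Finset.sum_apply, smul_eq_mul]
    congr 1
    exact Finset.sum_congr rfl fun i _ => (meanCoord_val X i c).symm
  · simp

/-- The output of the program as a function of the draws. -/
noncomputable def meanEstimate (K : ℕ) (k ε δ α : ℝ) (X : Dataset n m d) (ω : ℕ → ℝ) : Vec d :=
  if δ < 3 / 4 then twoStage (min ε 1 / 2) (min δ (1 / 2) / 2) (clipRadius K k m d α) X ω
  else releaseFun X ω

theorem runs_meanEstimationProgram (K : ℕ) (ε δ α R k : ℝ) (X : Dataset n m d) (hn : 1 ≤ n)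
    (hm : 1 ≤ m) (hd : 1 ≤ d) :
    Runs ω (meanEstimationProgram K) (input ε δ α R k X) (5000 * (n + m + d) ^ 3)
      fun s => ∀ c : Fin d, s.real 2 c = meanEstimate K k ε δ α X ω c := by
  have h := Runs.seq (T' := 8 + (300 + (n * (2 + (n * (4 + (d * (32 + 7) + 5) + (5 + 4) + 7) + 5) +
      8 + 7) + 5 + (4 + (n * (9 + 7) + 5) + (4 + (4 + (11 + 4)))) +
      (d * (4 + (n * (14 + 7) + 5) + 20 + 7) + 5 + (n * (4 + (d * (32 + 7) + 5) + (6 + 8) + 7) + 5 +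
      (d * (4 + (n * (28 + 7) + 5) + 20 + 7) + 5))))))
    (Q := fun s => ∀ c : Fin d, s.real 2 c = meanEstimate K k ε δ α X ω c)
    (q := .branch (.realLT (.cell 0 1) (3 / 4)) (.seq (parameterProgram K)
      (.seq weightProgram (.seq centerProgram (.seq factorProgram roundProgram)))) releaseProgram)
    (runs_setupProgram (ω := ω) ε δ α R k X) fun s ha hr => ?_
  · refine h.weaken ?_ fun _ _ h => h
    obtain ⟨N, hN⟩ : ∃ N, N = n + m + d := ⟨_, rfl⟩
    -- Every monomial of the exact time has degree at most three. The cubic ones come from computing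
    -- the sample means and from comparing all pairs of people.
    have h1 : n * (m * d) ≤ N ^ 3 := by
      rw [pow_three]
      exact Nat.mul_le_mul (by omega) (Nat.mul_le_mul (by omega) (by omega))
    have h2 : n * (n * d) ≤ N ^ 3 := by
      rw [pow_three]
      exact Nat.mul_le_mul (by omega) (Nat.mul_le_mul (by omega) (by omega))
    have h3 : n * (1 * d) ≤ N ^ 3 := by
      rw [pow_three]
      exact Nat.mul_le_mul (by omega) (Nat.mul_le_mul (by omega) (by omega))
    have h4 : n * (n * 1) ≤ N ^ 3 := by
      rw [pow_three]
      exact Nat.mul_le_mul (by omega) (Nat.mul_le_mul (by omega) (by omega))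
    have h5 : n * (1 * 1) ≤ N ^ 3 := by
      rw [pow_three]
      exact Nat.mul_le_mul (by omega) (Nat.mul_le_mul (by omega) (by omega))
    have h6 : d * (1 * 1) ≤ N ^ 3 := by
      rw [pow_three]
      exact Nat.mul_le_mul (by omega) (Nat.mul_le_mul (by omega) (by omega))
    have h7 : 1 * (1 * 1) ≤ N ^ 3 := by
      rw [pow_three]
      exact Nat.mul_le_mul (by omega) (Nat.mul_le_mul (by omega) (by omega))
    rw [← hN]
    nlinarith
  · have hp0 : s.real 0 0 = ε := by rw [hr.param]; simp [input]
    have hp1 : s.real 0 1 = δ := by rw [hr.param]; simp [input]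
    have hiff : Test.Holds s (.realLT (.cell 0 1) (3 / 4)) ↔ δ < 3 / 4 := by
      simp [Test.Holds, hp1]
    refine Runs.branch (c := 8) rfl (fun hb => ?_) fun hb => ?_
    · have hdef : ∀ c : Fin d, meanEstimate K k ε δ α X ω c = twoStage (min ε 1 / 2)
          (min δ (1 / 2) / 2) (clipRadius K k m d α) X ω c := fun c => by
        rw [meanEstimate, if_pos (hiff.1 hb)]
      refine Runs.seq (runs_parameterProgram hr K) fun s₁ ha₁ hp₁ => ?_
      rw [show (input ε δ α R k X).real 0 0 = ε by simp [input],
        show (input ε δ α R k X).real 0 1 = δ by simp [input],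
        show (input ε δ α R k X).real 0 2 = α by simp [input],
        show (input ε δ α R k X).real 0 4 = k by simp [input]] at hp₁
      have hr₁ := hr.agree ha₁ rfl
      refine Runs.seq (runs_weightProgram hr₁ hp₁) fun s₂ ha₂ h₂ => ?_
      have hr₂ := hr₁.agree ha₂ rfl
      have hp₂ := hp₁.agree ha₂ rfl
      refine Runs.seq (runs_centerProgram hr₂ hp₂ h₂.1 h₂.2.1 h₂.2.2) fun s₃ ha₃ h₃ => ?_
      have hr₃ := hr₂.agree ha₃ rfl
      have hp₃ := hp₂.agree ha₃ rfl
      -- The array itself serves as the center `u`; only its first `d` cells are identified with the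
      -- coarse estimate, at the end.
      have hu : ∀ c < d, s₃.real 8 c = s₃.real 8 c := fun _ _ => rfl
      refine Runs.seq (runs_factorProgram hr₃ hp₃ hu) fun s₄ ha₄ h₄ => ?_
      refine (runs_roundProgram (u := s₃.real 8) (hr₃.agree ha₄ rfl) (hp₃.agree ha₄ rfl)
        (fun c _ => by rw [ha₄.real 8 rfl]) h₄).weaken le_rfl fun s₅ _ h₅ c => ?_
      rw [h₅ c c.isLt, hdef c]
      refine (twoStage_coord X (fun c => ?_) c).symm
      rw [coarseFun_coord, h₃ c c.isLt]
    · have hdef : ∀ c : Fin d, meanEstimate K k ε δ α X ω c = releaseFun X ω c := fun c => by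
        rw [meanEstimate, if_neg (mt hiff.2 hb)]
      refine (runs_releaseProgram hr hd).weaken ?_ fun s₁ _ h₁ c => ?_
      · nlinarith [Nat.zero_le (n * d), Nat.zero_le (n * (n * d)), Nat.zero_le (n * n)]
      · rw [h₁ c c.isLt, hdef c, releaseFun_coord]

end Correctness

end RealRAM

/-! ### Assembling the theorem -/

section Main

variable {n m d : ℕ} {k ε δ α R : ℝ}

theorem time_bound {K : ℕ} (hK : 1 ≤ K) (hR : 0 ≤ R) :
    ((5000 * (n + m + d) ^ 3 : ℕ) : ℝ) ≤ 200000 * K * (n + m + d + Real.log (2 + R)) ^ 3 := by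
  have hK1 : (1 : ℝ) ≤ K := by exact_mod_cast hK
  have hlog : 0 ≤ Real.log (2 + R) := Real.log_nonneg (by linarith)
  push_cast
  refine mul_le_mul (by linarith) (pow_le_pow_left₀ (by positivity) (by linarith) 3)
    (by positivity) (by positivity)

theorem computes_of_map {M : Kernel (Dataset n m d) (Vec d)} {K : ℕ} (hn : 1 ≤ n) (hm : 1 ≤ m)
    (hd : 1 ≤ d) (hK : 1 ≤ K) (hR : 0 ≤ R)
    (hM : ∀ X, M X = RealRAM.drawLaw.map (RealRAM.meanEstimate K k ε δ α X)) :
    RealRAM.Computes (RealRAM.meanEstimationProgram K) ε δ α R k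
      (200000 * K * (n + m + d + Real.log (2 + R)) ^ 3) M := by
  refine ⟨RealRAM.meanEstimate K k ε δ α, fun X ω => ?_, hM⟩
  obtain ⟨s, t, he, ht, hs⟩ := RealRAM.runs_meanEstimationProgram (ω := ω) K ε δ α R k X hn hm hd
  exact ⟨s, t, he, le_trans (by exact_mod_cast ht) (time_bound hK hR), hs⟩

theorem estimatesMean_releaseKernel_of_sampleBound {K : ℕ} (hn1 : 1 ≤ n) (hm : 1 ≤ m) (hd : 1 ≤ d)
    (hk2 : 2 < k) (hε : 0 < ε) (hδ : 0 < δ) (hδ1 : δ ≤ 1) (hα : 0 < α) (hK : 1 ≤ K)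
    (hn : 200000 * K * Real.log (2 + m * d) ^ 1 * sampleBound k m d ε δ α ≤ n) (R : ℝ) :
    EstimatesMean (releaseKernel n m d) k R α := by
  refine estimatesMean_releaseKernel hn1 hm hk2 hα ?_ R
  have hm0 : (0 : ℝ) < m := by exact_mod_cast hm
  have hn0 : (0 : ℝ) < n := by exact_mod_cast hn1
  have hK1 : (1 : ℝ) ≤ K := by exact_mod_cast hK
  have hL := one_le_log_two_add hm hd
  obtain ⟨h1, h2, h3, h4⟩ := sampleBound_term_nonneg (k := k) (d := d) (m := m) hε hα hδ1 hδ
  have hT : (d : ℝ) / (α ^ 2 * m) ≤ sampleBound k m d ε δ α := by unfold sampleBound; linarith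
  have hKL : 1 ≤ K * Real.log (2 + m * d) := one_le_mul_of_one_le_of_one_le hK1 hL
  have h12 : 12 * ((d : ℝ) / (α ^ 2 * m)) ≤ n := by
    refine le_trans (mul_le_mul ?_ hT h1 (by positivity)) hn
    rw [pow_one]; linarith
  calc (d : ℝ) / m / ((n : ℝ) * α ^ 2) = 12 * ((d : ℝ) / (α ^ 2 * m)) / (12 * n) := by
        field_simp
    _ ≤ (n : ℝ) / (12 * n) := by gcongr
    _ = 1 / 12 := by field_simp

theorem sqrt_div_le_clipRadius {K : ℕ} (hm : 1 ≤ m) (hd : 1 ≤ d) {c : ℝ} (hc : c ≤ K) :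
    c * (Real.sqrt (d / m) * Real.log (2 + m * d)) ≤ clipRadius K k m d α := by
  have := zero_le_one.trans (one_le_log_two_add hm hd)
  exact le_trans (by gcongr) sqrt_mul_le_clipRadius

end Main

/-- For every `k > 2` there is one real-RAM program that, for all parameters, runs in time polynomial
in `n`, `m`, `d` and `log (2 + R)` (the degree `a` does not depend on `k`) and is person-level
`(ε, δ)`-DP; for `ε, δ ≤ 1` and `n = Õ_k(sampleBound)` people it estimates the mean to accuracy `α`.
For `δ ≤ 1/2` it is a coarse estimate up to `O_k(√(d/m))` followed by one clip-and-noise round.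
`Õ_k` hides a factor depending on `k` and powers, depending on `k`, of `log (2 + m d)`. -/
theorem mainTheorem8 :
    ∃ a : ℕ, ∀ k : ℝ, 2 < k → ∃ (P : RealRAM.Program) (C : ℝ) (b : ℕ), 0 < C ∧
      ∀ (n m d : ℕ) (ε δ α R : ℝ), 1 ≤ n → 1 ≤ m → 1 ≤ d → 0 < ε → 0 < δ → 0 < α → 0 ≤ R →
        ∃ M : Kernel (Dataset n m d) (Vec d), IsMarkovKernel M ∧
          RealRAM.Computes P ε δ α R k (C * (n + m + d + Real.log (2 + R)) ^ a) M ∧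
          PersonLevelDP M ε δ ∧
          (ε ≤ 1 → δ ≤ 1 →
            C * Real.log (2 + m * d) ^ b * sampleBound k m d ε δ α ≤ n →
            EstimatesMean M k R α) ∧
          (δ ≤ 1 / 2 →
            ∃ coarse : Kernel (Dataset n m d) (Vec d), IsMarkovKernel coarse ∧
              IsSingleRoundClipAndNoise M coarse ε δ ∧
              (ε ≤ 1 →
                C * Real.log (2 + m * d) ^ b * sampleBound k m d ε δ α ≤ n →
                EstimatesMean coarse k R (C * Real.sqrt (d / m)))) := by
  refine ⟨3, fun k hk2 => ?_⟩
  -- The three summands serve three conditions on the radius: `4 * coarseRadius = 80 √(d/m) ≤ ρ /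
  -- 2`, the range `16 k² √(d/m) log(2 + md) ≤ ρ / 2` of the tail bound, and a bias of at most `α /
  -- 3`. Program constants must be natural numbers, hence an integer `K`.
  obtain ⟨K, hK⟩ := exists_nat_ge (160 + 32 * k ^ 2 + 6 * tailConst k)
  have htc := tailConst_pos (k := k)
  have hk0 : 0 ≤ k ^ 2 := sq_nonneg k
  have hK160 : (160 : ℝ) ≤ K := by linarith
  have hKk : 32 * k ^ 2 ≤ K := by linarith
  have hKt : 6 * tailConst k ≤ K := by linarith
  have hK2 : 2 ≤ K := by
    have : (2 : ℝ) ≤ K := by linarith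
    exact_mod_cast this
  have hK1 : 1 ≤ K := by omega
  refine ⟨RealRAM.meanEstimationProgram K, 200000 * K, 1, by positivity, ?_⟩
  intro n m d ε δ α R hn hm hd hε hδ hα hR
  -- The same comparison is made by the program. Any cut strictly between `1/2` and `1` would keep
  -- the two-stage form for `δ ≤ 1/2`; at `3/4` the release probability matches two fair coins.
  rcases lt_or_ge δ (3 / 4) with hδ1 | hδ1
  -- The caps make the Gaussian mechanism applicable for all `ε` and `δ`; the halves give each stage
  -- its `(ε/2, δ/2)` guarantee.
  · set ε₀ := min ε 1 / 2 with hε₀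
    set δ₀ := min δ (1 / 2) / 2 with hδ₀
    set ρ := clipRadius K k m d α with hρ
    have hε0 : 0 < ε₀ := by have := lt_min hε one_pos; positivity
    have hδ0 : 0 < δ₀ := by have : 0 < min δ (1 / 2) := lt_min hδ (by norm_num); positivity
    have hε01 : ε₀ ≤ 1 := by have := min_le_right ε 1; linarith
    have hδ01 : δ₀ ≤ 1 := by have := min_le_right δ (1 / 2); linarith
    have hεl : ε₀ ≤ ε / 2 := by have := min_le_left ε 1; linarith
    have hδl : δ₀ ≤ δ / 2 := by have := min_le_left δ (1 / 2); linarith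
    have hρ0 : 0 < ρ := clipRadius_pos hK1 hm
    have hL := one_le_log_two_add hm hd
    refine ⟨twoStageKernel n m d ε₀ δ₀ ρ, inferInstance, computes_of_map hn hm hd hK1 hR fun X => ?_,
      (personLevelDP_twoStageKernel hn hm hd hε0 hε01 hδ0 hδ01 hρ0).mono (by linarith) (by linarith),
      fun hε1 _ hnb => ?_, fun hδ2 => ⟨coarseKernel n m d ε₀ δ₀, inferInstance,
        ⟨(personLevelDP_coarseKernel hn hm hd hε0 hε01 hδ0 hδ01).mono hεl hδl, (firstHalf n)ᶜ, ρ,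
          roundNoise n ε₀ δ₀ ρ, firstHalf_compl_nonempty hn, hρ0, roundNoise_pos hn hε0 hρ0,
          fun u => (personLevelDP_clipAndNoise hn (firstHalf_compl_nonempty hn) hρ0 hε0 hε01 hδ0
            hδ01 u).mono hεl hδl, twoStageKernel_eq_bind ε₀ δ₀ ρ⟩, fun hε1 hnb => ?_⟩⟩
    · have : RealRAM.meanEstimate K k ε δ α X = twoStage ε₀ δ₀ ρ X := by
        ext1 ω
        rw [RealRAM.meanEstimate, if_pos hδ1]
      rw [this]
      rfl
    · obtain ⟨h1, h2, h3, h4⟩ := twoStage_conditions hm hd hk2 hα hε hε1 hδ hδ1 hK1 hnb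
      refine estimatesMean_twoStageKernel hn hm hd hk2 hε0 hρ0 hα h1 h2 ?_ ?_
        (clipRadius_bias hk2 hm hd hα hKt hK2) h3 h4 R
      · have := sqrt_div_le_clipRadius (k := k) (α := α) hm hd hKk
        linarith
      · have := sqrt_div_le_clipRadius (k := k) (α := α) hm hd hK160
        have hs : Real.sqrt (d / m) ≤ Real.sqrt (d / m) * Real.log (2 + m * d) :=
          le_mul_of_one_le_right (Real.sqrt_nonneg _) hL
        unfold coarseRadius
        linarith
    · obtain ⟨h1, h2, -, -⟩ := twoStage_conditions hm hd hk2 hα hε hε1 hδ hδ1 hK1 hnb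
      refine estimatesMean_coarseKernel hm hd hk2 hε0 h1 h2 ?_ R
      rw [coarseRadius, ← mul_assoc]
      exact mul_le_mul_of_nonneg_right (by linarith) (Real.sqrt_nonneg _)
  · refine ⟨releaseKernel n m d, inferInstance, computes_of_map hn hm hd hK1 hR fun X => ?_,
      personLevelDP_releaseKernel hε hδ1, fun _ hδ2 hnb =>
        estimatesMean_releaseKernel_of_sampleBound hn hm hd hk2 hε hδ hδ2 hα hK1 hnb R,
      fun hδ2 => absurd (hδ1.trans hδ2) (by norm_num)⟩
    have : RealRAM.meanEstimate K k ε δ α X = releaseFun X := by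
      ext1 ω
      rw [RealRAM.meanEstimate, if_neg (not_lt.2 hδ1)]
    rw [this]
    rfl
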